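/- Let $\Gamma$ be an undirected simple graph with vertex set $V$ and edge set $E$, and let $\Bbbk$ be a nonzero commutative ring. Let $A_\Gamma=\langle V\mid vw=wv \text{ if }\{v,w\}\in E\rangle$ be the associated right-angled Artin group and $\gamma_1=A_\Gamma$, $\gamma_{n+1}=[\gamma_n,A_\Gamma]$ its lower central series. Let $R_\Gamma=\langle V\mid vw=wv\text{ if }\{v,w\}\in E\rangle$ be the unital associative $\Bbbk$-algebra of polynomials in partially commuting variables, graded by $\deg v=1$, with augmentation ideal $\varpi$ (the polynomials without constant term), completion $\overline{R_\Gamma}=\varprojlim R_\Gamma/\varpi^n$, and let $\overline\varpi^n=\ker(\overline{R_\Gamma}\to R_\Gamma/\varpi^n)$ be the closure of $\varpi^n$. Let $\varpi(A_\Gamma)$ be the augmentation ideal of the group algebra $\Bbbk A_\Gamma$, let $\overline{\Bbbk A_\Gamma}=\varprojlim \Bbbk A_\Gamma/\varpi(A_\Gamma)^n$, let $\overline{\varpi(A_\Gamma)^n}$ be the kernel of $\overline{\Bbbk A_\Gamma}\to \Bbbk A_\Gamma/\varpi(A_\Gamma)^n$, and let $\operatorname{gr}(\Bbbk A_\Gamma)=\bigoplus_{n\ge0}\varpi(A_\Gamma)^n/\varpi(A_\Gamma)^{n+1}$.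 The Magnus map is the homomorphism $\mu\colon A_\Gamma\to 1+\overline\varpi\subseteq\overline{R_\Gamma}^\times$ with $\mu(v)=1+v$ for $v\in V$. A word $v_1^{e_1}\cdots v_n^{e_n}$ ($v_i\in V$, $e_i\in\mathbb Z$) is called $\Gamma$-reduced if its number $n$ of factors cannot be decreased by any sequence of moves of the following kinds: remove a factor $v^0$; replace $v^ev^f$ by $v^{e+f}$; replace $v^ew^f$ by $w^fv^e$ if $\{v,w\}\in E$. A monomial is an element of the monoid $\langle V\mid vw=wv\text{ if }\{v,w\}\in E\rangle$; the monomials form a basis of $R_\Gamma$, and every element of $\overline{R_\Gamma}$ has a coefficient at every monomial. 1. Suppose that $\Bbbk$ has prime characteristic $p$, and let $g\in A_\Gamma$. Consider the monomials that have non-zero coefficient in $\mu(g)$ and can be written as $w_1^{p^{s_1}}\cdots w_k^{p^{s_k}}$ with this word $\Gamma$-reduced and $s_i\in\mathbb N$. There is exactly one such monomial $m$ for which $k$ is maximal and the $s_i$ are minimal, in the sense that for any other such monomial $u_1^{p^{t_1}}\cdots u_k^{p^{t_k}}$ with the same number $k$ of factors one can write $m=u_1^{p^{s_1}}\cdots u_k^{p^{s_k}}$,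 as a $\Gamma$-reduced word, with $s_i\le t_i$ for all $i$. Furthermore, let $v_1^{e_1}\cdots v_n^{e_n}$ be any $\Gamma$-reduced word representing $g$. Then for every $\Gamma$-reduced expression $m=w_1^{p^{s_1}}\cdots w_k^{p^{s_k}}$ one has $n=k$ and $v_1\cdots v_n=w_1\cdots w_k$ as monomials; and there is such an expression with $w_i=v_i$ for all $i$, with $p^{s_i}\mid e_i$ for all $i$, and such that the coefficient of $m$ in $\mu(g)$ is $(e_1p^{-s_1})\cdots(e_np^{-s_n})$. 2. For arbitrary $\Bbbk$, the map $\mu\colon A_\Gamma\to\overline{R_\Gamma}$ is injective. 3. For all $n\ge1$, $\mu(\gamma_n)\subseteq 1+\overline\varpi^n$. Hence $\mu$ induces a map of graded Lie algebras (over $\mathbb Z$, with brackets induced by group commutators) $$\bigoplus_{n\ge1}\gamma_n/\gamma_{n+1}\to\bigoplus_{n\ge1}(1+\overline\varpi^n)/(1+\overline\varpi^{n+1}).$$ The map $[1+w]\mapsto[w]$ is an isomorphism of the latter with the graded Lie algebra $\bigoplus_{n\ge1}\varpi^n/\varpi^{n+1}$ contained in $\bigoplus_{n\ge0}\varpi^n/\varpi^{n+1}\cong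 R_\Gamma$ (with the commutator bracket; the last isomorphism sends a homogeneous element $r$ of degree $n$ to its class in $\varpi^n/\varpi^{n+1}$). The composite $\mu_L\colon\bigoplus_{n\ge1}\gamma_n/\gamma_{n+1}\to R_\Gamma$ is a homomorphism of Lie algebras which sends the class of $g\in\gamma_n$ to a homogeneous element of degree $n$ that is congruent to $\mu(g)-1$ modulo $\overline\varpi^{n+1}$. 4. The $\Bbbk$-linear extension $\Bbbk A_\Gamma\to\overline{R_\Gamma}$ of $\mu$ extends uniquely to a continuous algebra homomorphism $\overline\mu\colon\overline{\Bbbk A_\Gamma}\to\overline{R_\Gamma}$, and $\overline\mu$ is an isomorphism of filtered $\Bbbk$-algebras: it is bijective, and $x\in\overline{\varpi(A_\Gamma)^n}$ if and only if $\overline\mu(x)\in\overline\varpi^n$. In particular, for all $n\ge0$ there are isomorphisms of $\Bbbk$-algebras $$\Bbbk A_\Gamma/\varpi(A_\Gamma)^n\cong\overline{\Bbbk A_\Gamma}/\overline{\varpi(A_\Gamma)^n}\cong\overline{R_\Gamma}/\overline\varpi^n\cong R_\Gamma/\varpi^n\cong\operatorname{gr}(\Bbbk A_\Gamma)/\operatorname{gr}(\Bbbk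 A_\Gamma)_{\ge n},$$ of which the first and the third are induced by the canonical maps to the completions, the second by $\overline\mu$, and the last sends the class of $v\in V$ to that of $[v-1]\in\varpi(A_\Gamma)/\varpi(A_\Gamma)^2$. As $\Bbbk$-modules, $(R_\Gamma)_{<n}\cong R_\Gamma/\varpi^n$ and $\operatorname{gr}(\Bbbk A_\Gamma)_{<n}\cong\operatorname{gr}(\Bbbk A_\Gamma)/\operatorname{gr}(\Bbbk A_\Gamma)_{\ge n}$ through the natural maps. -/

import Mathlib

set_option linter.unusedSectionVars false

open scoped DirectSum commutatorElement

/-- A central filtration (N-series) of a group: a decreasing sequence of subgroups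
`F 1 ≥ F 2 ≥ ⋯` with `[F m, F n] ≤ F (m + n)`. -/
structure NSeries (G : Type*) [Group G] where
  term : ℕ+ → Subgroup G
  antitone : Antitone term
  commutator_mem : ∀ (m n : ℕ+) (x y : G), x ∈ term m → y ∈ term n → ⁅x, y⁆ ∈ term (m + n)

namespace NSeries

section

variable {G : Type*} [Group G] (F : NSeries G)

theorem succ_le (n : ℕ+) : F.term (n + 1) ≤ F.term n :=
  F.antitone (PNat.lt_add_right n 1).le

theorem conj_mul_inv_mem {m n : ℕ+} {x y : G} (hx : x ∈ F.term m) (hy : y ∈ F.term n) :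
    x * y * x⁻¹ * y⁻¹ ∈ F.term (m + n) := F.commutator_mem m n x y hx hy

instance (n : ℕ+) : ((F.term (n + 1)).subgroupOf (F.term n)).Normal where
  conj_mem := by
    rintro ⟨y, hy⟩ hy' ⟨x, hx⟩
    rw [Subgroup.mem_subgroupOf] at hy' ⊢
    have h := F.conj_mul_inv_mem hx hy'
    have h2 := (F.term (n + 1)).mul_mem (F.antitone (PNat.lt_add_left (n + 1) n).le h) hy'
    simpa using h2

/-- The quotient group `F n / F (n + 1)`. -/
abbrev Quot (n : ℕ+) : Type _ := F.term n ⧸ (F.term (n + 1)).subgroupOf (F.term n)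

theorem cl_eq {n : ℕ+} {x y : F.term n} (h : (x : G)⁻¹ * y ∈ F.term (n + 1)) :
    (QuotientGroup.mk x : F.Quot n) = QuotientGroup.mk y :=
  QuotientGroup.eq.2 h

instance (n : ℕ+) : CommGroup (F.Quot n) :=
  { (inferInstance : Group (F.Quot n)) with
    mul_comm := by
      rintro ⟨x⟩ ⟨y⟩
      refine F.cl_eq ?_
      have h := F.conj_mul_inv_mem ((F.term n).inv_mem y.2) ((F.term n).inv_mem x.2)
      have h' := F.antitone (show n + 1 ≤ n + n from add_le_add_right one_le n) h
      simpa [mul_assoc] using h' }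

/-- `F n / F (n + 1)`, written additively. -/
abbrev Component (n : ℕ+) : Type _ := Additive (F.Quot n)

/-- The class in `F n / F (n + 1)` of an element of `F n`. -/
def cl (n : ℕ+) (x : F.term n) : F.Component n := Additive.ofMul (QuotientGroup.mk x)

theorem cl_surjective (n : ℕ+) : Function.Surjective (F.cl n) := by
  intro a
  obtain ⟨x, hx⟩ := QuotientGroup.mk_surjective (Additive.toMul a)
  exact ⟨x, congrArg Additive.ofMul hx⟩

theorem cl_mul (n : ℕ+) (x y : F.term n) : F.cl n (x * y) = F.cl n x + F.cl n y := rfl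

theorem cl_congr {n : ℕ+} {x y : F.term n} (h : (x : G)⁻¹ * y ∈ F.term (n + 1)) :
    F.cl n x = F.cl n y := congrArg Additive.ofMul (F.cl_eq h)

theorem cl_eq_iff {n : ℕ+} {x y : F.term n} :
    F.cl n x = F.cl n y ↔ (x : G)⁻¹ * y ∈ F.term (n + 1) :=
  ⟨fun h => (QuotientGroup.eq (s := (F.term (n + 1)).subgroupOf (F.term n))).1 h, F.cl_congr⟩

/-- Modulo `F (n + 1)`, elements of `F n` are unchanged by conjugation by elements of `F m`. -/
theorem cl_conj {m n : ℕ+} {x : G} (hx : x ∈ F.term m) (y z : F.term n)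
    (hz : (z : G) = x * y * x⁻¹) : F.cl n z = F.cl n y := by
  refine F.cl_congr ?_
  rw [hz]
  have h := F.conj_mul_inv_mem hx ((F.term n).inv_mem y.2)
  refine F.antitone (show n + 1 ≤ m + n by rw [add_comm]; exact add_le_add_left one_le n) ?_
  simpa [mul_assoc] using h

/-- The commutator of elements of `F m` and `F n`, as an element of `F (m + n)`. -/
def comm (m n : ℕ+) (x : F.term m) (y : F.term n) : F.term (m + n) :=
  ⟨⁅(x : G), (y : G)⁆, F.commutator_mem m n x y x.2 y.2⟩

theorem cl_comm_mul_right (m n : ℕ+) (x : F.term m) (y z : F.term n) :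
    F.cl (m + n) (F.comm m n x (y * z)) =
      F.cl (m + n) (F.comm m n x y) + F.cl (m + n) (F.comm m n x z) := by
  have hc : (y : G) * F.comm m n x z * (y : G)⁻¹ ∈ F.term (m + n) := by
    have h := F.conj_mul_inv_mem y.2 (F.comm m n x z).2
    have h2 := (F.term (m + n)).mul_mem (F.antitone (PNat.lt_add_left (m + n) n).le h)
      (F.comm m n x z).2
    simpa using h2
  rw [← F.cl_conj y.2 (F.comm m n x z) ⟨_, hc⟩ rfl, ← F.cl_mul]
  congr 1
  ext
  simp [comm, commutatorElement_def, mul_assoc]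

theorem cl_comm_mul_left (m n : ℕ+) (x y : F.term m) (z : F.term n) :
    F.cl (m + n) (F.comm m n (x * y) z) =
      F.cl (m + n) (F.comm m n x z) + F.cl (m + n) (F.comm m n y z) := by
  have hc : (x : G) * F.comm m n y z * (x : G)⁻¹ ∈ F.term (m + n) := by
    have h := F.conj_mul_inv_mem x.2 (F.comm m n y z).2
    have h2 := (F.term (m + n)).mul_mem (F.antitone (PNat.lt_add_left (m + n) m).le h)
      (F.comm m n y z).2
    simpa using h2
  rw [← F.cl_conj x.2 (F.comm m n y z) ⟨_, hc⟩ rfl, add_comm (F.cl (m + n) (F.comm m n x z)), ← F.cl_mul]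
  congr 1
  ext
  simp [comm, commutatorElement_def, mul_assoc]

theorem cl_eq_zero {n : ℕ+} {x : F.term n} (h : (x : G) ∈ F.term (n + 1)) : F.cl n x = 0 := by
  have : F.cl n x = F.cl n 1 := F.cl_congr (by simpa using h)
  rw [this]
  rfl

theorem cl_comm_congr (m n : ℕ+) {x x' : F.term m} {y y' : F.term n}
    (hx : F.cl m x = F.cl m x') (hy : F.cl n y = F.cl n y') :
    F.cl (m + n) (F.comm m n x y) = F.cl (m + n) (F.comm m n x' y') := by
  obtain ⟨a, rfl⟩ : ∃ a, x' = x * a := ⟨x⁻¹ * x', by simp⟩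
  obtain ⟨b, rfl⟩ : ∃ b, y' = y * b := ⟨y⁻¹ * y', by simp⟩
  have ha : (a : G) ∈ F.term (m + 1) := by simpa using F.cl_eq_iff.1 hx
  have hb : (b : G) ∈ F.term (n + 1) := by simpa using F.cl_eq_iff.1 hy
  rw [cl_comm_mul_left, cl_comm_mul_right, cl_comm_mul_right]
  have h1 : F.cl (m + n) (F.comm m n x b) = 0 := F.cl_eq_zero (by
    rw [add_assoc]; exact F.commutator_mem m (n + 1) x b x.2 hb)
  have h2 : ∀ c : F.term n, F.cl (m + n) (F.comm m n a c) = 0 := fun c => F.cl_eq_zero (by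
    rw [add_right_comm]; exact F.commutator_mem (m + 1) n a c ha c.2)
  rw [h1, h2, h2]
  simp

/-- A representative in `F n` of a class in `F n / F (n + 1)`. -/
noncomputable def rep (n : ℕ+) (a : F.Component n) : F.term n :=
  Function.surjInv (F.cl_surjective n) a

theorem cl_rep (n : ℕ+) (a : F.Component n) : F.cl n (F.rep n a) = a :=
  Function.surjInv_eq (F.cl_surjective n) a

/-- The biadditive map `F m / F (m + 1) × F n / F (n + 1) → F (m + n) / F (m + n + 1)` induced by
the group commutator; it does not depend on the representatives (see `bracketHom_cl`). -/
noncomputable def bracketHom (m n : ℕ+) : F.Component m →+ F.Component n →+ F.Component (m + n) :=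
  AddMonoidHom.mk' (fun a => AddMonoidHom.mk'
      (fun b => F.cl (m + n) (F.comm m n (F.rep m a) (F.rep n b)))
      (fun b c => by
        rw [← cl_comm_mul_right]
        refine F.cl_comm_congr m n rfl ?_
        rw [cl_mul, cl_rep, cl_rep, cl_rep]))
    (fun a b => by
      refine AddMonoidHom.ext fun c => ?_
      change F.cl (m + n) _ = F.cl (m + n) _ + F.cl (m + n) _
      rw [← cl_comm_mul_left]
      refine F.cl_comm_congr m n ?_ rfl
      rw [cl_mul, cl_rep, cl_rep, cl_rep])

theorem bracketHom_cl (m n : ℕ+) (x : F.term m) (y : F.term n) :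
    F.bracketHom m n (F.cl m x) (F.cl n y) = F.cl (m + n) (F.comm m n x y) := by
  simp only [bracketHom, AddMonoidHom.mk'_apply]
  exact F.cl_comm_congr m n (F.cl_rep _ _) (F.cl_rep _ _)

end

/-- The graded abelian group `⨁_{n ≥ 1} F n / F (n + 1)`. -/
def Gr {G : Type*} [Group G] (F : NSeries G) : Type _ := ⨁ n : ℕ+, F.Component n

section

variable {G : Type*} [Group G] (F : NSeries G)

noncomputable instance : AddCommGroup F.Gr := inferInstanceAs (AddCommGroup (⨁ n : ℕ+, F.Component n))

/-- The class in degree `n` of an element of `F n`. -/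
noncomputable def cls (n : ℕ+) (x : F.term n) : F.Gr := DirectSum.of F.Component n (F.cl n x)

/-- The Lie bracket on `⨁ F n / F (n + 1)`, as a biadditive map on the underlying direct sum. -/
noncomputable def sumHom :
    (⨁ n : ℕ+, F.Component n) →+ (⨁ n : ℕ+, F.Component n) →+ ⨁ n : ℕ+, F.Component n :=
  DirectSum.toAddMonoid fun m => AddMonoidHom.flip <| DirectSum.toAddMonoid fun n =>
    AddMonoidHom.flip <| (DirectSum.of F.Component (m + n)).compHom.comp (F.bracketHom m n)

theorem sumHom_of (m n : ℕ+) (x : F.Component m) (y : F.Component n) :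
    F.sumHom (DirectSum.of F.Component m x) (DirectSum.of F.Component n y) =
      DirectSum.of F.Component (m + n) (F.bracketHom m n x y) := by
  simp [sumHom]

/-- The Lie bracket on `⨁ F n / F (n + 1)`. -/
noncomputable def lieHom : F.Gr →+ F.Gr →+ F.Gr := F.sumHom

theorem lieHom_cls (m n : ℕ+) (x : F.term m) (y : F.term n) :
    F.lieHom (F.cls m x) (F.cls n y) = F.cls (m + n) (F.comm m n x y) :=
  (F.sumHom_of m n _ _).trans (congrArg _ (F.bracketHom_cl m n x y))

theorem cls_mul (n : ℕ+) (x y : F.term n) : F.cls n (x * y) = F.cls n x + F.cls n y := by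
  simp only [cls, cl_mul]
  exact map_add _ _ _

theorem cls_congr {m n : ℕ+} (h : m = n) (x : F.term m) (y : F.term n) (hxy : (x : G) = y) :
    F.cls m x = F.cls n y := by
  subst h
  obtain rfl : x = y := Subtype.ext hxy
  rfl

theorem gr_induction {p : F.Gr → Prop} (h0 : p 0) (hc : ∀ n x, p (F.cls n x))
    (ha : ∀ x y, p x → p y → p (x + y)) (x : F.Gr) : p x := by
  refine DirectSum.induction_on (motive := p) x h0 (fun n a => ?_) ha
  obtain ⟨y, rfl⟩ := F.cl_surjective n a
  exact hc n y

theorem cls_one (n : ℕ+) : F.cls n 1 = 0 := by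
  have h := F.cls_mul n 1 1
  rw [mul_one] at h
  exact left_eq_add.1 h

theorem lieHom_skew (x y : F.Gr) : F.lieHom x y + F.lieHom y x = 0 := by
  induction x using F.gr_induction with
  | h0 => simp
  | ha x x' hx hx' =>
    simp only [map_add, AddMonoidHom.add_apply]
    rw [add_add_add_comm, hx, hx', add_zero]
  | hc m x =>
    induction y using F.gr_induction with
    | h0 => simp
    | ha y y' hy hy' =>
      simp only [map_add, AddMonoidHom.add_apply]
      rw [add_add_add_comm, hy, hy', add_zero]
    | hc n y =>
      rw [lieHom_cls, lieHom_cls,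
        F.cls_congr (add_comm m n) (F.comm m n x y) ((F.comm n m y x)⁻¹)
          (by simp [comm]), ← F.cls_mul, inv_mul_cancel, F.cls_one]

theorem lieHom_self (x : F.Gr) : F.lieHom x x = 0 := by
  induction x using F.gr_induction with
  | h0 => simp
  | ha x y hx hy =>
    simp only [map_add, AddMonoidHom.add_apply]
    rw [hx, hy, zero_add, add_zero, add_comm, F.lieHom_skew]
  | hc m x =>
    rw [lieHom_cls, ← F.cls_one (m + m)]
    exact F.cls_congr rfl _ _ (by simp [comm])

theorem cls_conj {m n : ℕ+} {x : G} (hx : x ∈ F.term m) (y z : F.term n)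
    (hz : (z : G) = x * y * x⁻¹) : F.cls n z = F.cls n y :=
  congrArg (DirectSum.of F.Component n) (F.cl_conj hx y z hz)

theorem conj_mem {m n : ℕ+} {x y : G} (hx : x ∈ F.term m) (hy : y ∈ F.term n) :
    x * y * x⁻¹ ∈ F.term n := by
  have h2 := (F.term n).mul_mem (F.antitone (PNat.lt_add_left n m).le (F.conj_mul_inv_mem hx hy)) hy
  simpa using h2

theorem lieHom_jacobi (x y z : F.Gr) :
    F.lieHom (F.lieHom x y) z + F.lieHom (F.lieHom y z) x + F.lieHom (F.lieHom z x) y = 0 := by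
  induction x using F.gr_induction with
  | h0 => simp
  | ha x x' hx hx' =>
    simp only [map_add, AddMonoidHom.add_apply]
    calc _ = (F.lieHom (F.lieHom x y) z + F.lieHom (F.lieHom y z) x + F.lieHom (F.lieHom z x) y) +
        (F.lieHom (F.lieHom x' y) z + F.lieHom (F.lieHom y z) x' + F.lieHom (F.lieHom z x') y) := by
          abel
      _ = 0 := by rw [hx, hx', add_zero]
  | hc a x =>
  induction y using F.gr_induction with
  | h0 => simp
  | ha y y' hy hy' =>
    simp only [map_add, AddMonoidHom.add_apply]
    calc _ = (F.lieHom (F.lieHom (F.cls a x) y) z + F.lieHom (F.lieHom y z) (F.cls a x) +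
            F.lieHom (F.lieHom z (F.cls a x)) y) +
        (F.lieHom (F.lieHom (F.cls a x) y') z + F.lieHom (F.lieHom y' z) (F.cls a x) +
            F.lieHom (F.lieHom z (F.cls a x)) y') := by
          abel
      _ = 0 := by rw [hy, hy', add_zero]
  | hc b y =>
  induction z using F.gr_induction with
  | h0 => simp
  | ha z z' hz hz' =>
    simp only [map_add, AddMonoidHom.add_apply]
    calc _ = (F.lieHom (F.lieHom (F.cls a x) (F.cls b y)) z +
            F.lieHom (F.lieHom (F.cls b y) z) (F.cls a x) +
            F.lieHom (F.lieHom z (F.cls a x)) (F.cls b y)) +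
        (F.lieHom (F.lieHom (F.cls a x) (F.cls b y)) z' +
            F.lieHom (F.lieHom (F.cls b y) z') (F.cls a x) +
            F.lieHom (F.lieHom z' (F.cls a x)) (F.cls b y)) := by
          abel
      _ = 0 := by rw [hz, hz', add_zero]
  | hc c z =>
    have e1 := F.cls_conj y.2 z ⟨_, F.conj_mem y.2 z.2⟩ rfl
    have e2 := F.cls_conj z.2 x ⟨_, F.conj_mem z.2 x.2⟩ rfl
    have e3 := F.cls_conj x.2 y ⟨_, F.conj_mem x.2 y.2⟩ rfl
    have k1 : F.lieHom (F.lieHom (F.cls a x) (F.cls b y)) (F.cls c z) = F.cls (a + b + c)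
        (F.comm (a + b) c (F.comm a b x y) ⟨_, F.conj_mem y.2 z.2⟩) := by
      rw [← e1, lieHom_cls, lieHom_cls]
    have k2 : F.lieHom (F.lieHom (F.cls b y) (F.cls c z)) (F.cls a x) = F.cls (b + c + a)
        (F.comm (b + c) a (F.comm b c y z) ⟨_, F.conj_mem z.2 x.2⟩) := by
      rw [← e2, lieHom_cls, lieHom_cls]
    have k3 : F.lieHom (F.lieHom (F.cls c z) (F.cls a x)) (F.cls b y) = F.cls (c + a + b)
        (F.comm (c + a) b (F.comm c a z x) ⟨_, F.conj_mem x.2 y.2⟩) := by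
      rw [← e3, lieHom_cls, lieHom_cls]
    have d2 : b + c + a = a + b + c := by rw [add_comm, add_assoc]
    have d3 : c + a + b = a + b + c := by rw [add_assoc, add_comm]
    rw [k1, k2, k3, F.cls_congr d2 _ ⟨_, d2 ▸ (F.comm (b + c) a (F.comm b c y z)
        ⟨_, F.conj_mem z.2 x.2⟩).2⟩ rfl, F.cls_congr d3 _ ⟨_, d3 ▸ (F.comm (c + a) b
        (F.comm c a z x) ⟨_, F.conj_mem x.2 y.2⟩).2⟩ rfl, ← F.cls_mul, ← F.cls_mul,
      ← F.cls_one (a + b + c)]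
    exact F.cls_congr rfl _ _ (commutatorElement_commutatorElement_conj_mul (x : G) y z)

/-- The Lie ring `⨁ F n / F (n + 1)`, with bracket induced by the group commutator. -/
noncomputable instance : LieRing F.Gr where
  bracket x y := F.lieHom x y
  add_lie x y z := by
    change F.lieHom (x + y) z = F.lieHom x z + F.lieHom y z
    rw [map_add, AddMonoidHom.add_apply]
  lie_add x y z := map_add _ _ _
  lie_self x := F.lieHom_self x
  leibniz_lie x y z := by
    change F.lieHom x (F.lieHom y z) = F.lieHom (F.lieHom x y) z + F.lieHom y (F.lieHom x z)
    have h := F.lieHom_jacobi x y z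
    have h1 := F.lieHom_skew (F.lieHom y z) x
    have h2 := F.lieHom_skew (F.lieHom z x) y
    have h3 := F.lieHom_skew z x
    have h4 : F.lieHom y (F.lieHom z x) + F.lieHom y (F.lieHom x z) = 0 := by
      rw [← map_add, h3, map_zero]
    rw [eq_neg_of_add_eq_zero_right h1, eq_neg_of_add_eq_zero_right h4,
      eq_neg_of_add_eq_zero_right h2, neg_neg]
    rw [neg_eq_iff_add_eq_zero, ← h]
    abel

theorem lie_cls (m n : ℕ+) (x : F.term m) (y : F.term n) :
    ⁅F.cls m x, F.cls n y⁆ = F.cls (m + n) (F.comm m n x y) := F.lieHom_cls m n x y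

end

end NSeries
namespace NSeries

/-- A form of the three subgroups lemma, modulo a normal subgroup. -/
theorem three_subgroups {G : Type*} [Group G] (A B C N : Subgroup G) [N.Normal]
    (h1 : ⁅⁅B, C⁆, A⁆ ≤ N) (h2 : ⁅⁅C, A⁆, B⁆ ≤ N) : ⁅⁅A, B⁆, C⁆ ≤ N := by
  have key : ∀ H : Subgroup G, H ≤ N ↔ H.map (QuotientGroup.mk' N) = ⊥ := fun H => by
    rw [Subgroup.map_eq_bot_iff, QuotientGroup.ker_mk']
  rw [key] at h1 h2 ⊢
  simp only [Subgroup.map_commutator] at h1 h2 ⊢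
  exact Subgroup.commutator_commutator_eq_bot_of_rotate h1 h2

theorem commutator_lowerCentralSeries_le {G : Type*} [Group G] (n : ℕ) : ∀ m : ℕ,
    ⁅(⊤ : Subgroup G).lowerCentralSeries m, (⊤ : Subgroup G).lowerCentralSeries n⁆ ≤
      (⊤ : Subgroup G).lowerCentralSeries (m + n + 1) := by
  induction n with
  | zero => exact fun m => le_rfl
  | succ n ih =>
    intro m
    rw [Subgroup.commutator_comm, Subgroup.lowerCentralSeries_succ]
    have e : m + (n + 1) + 1 = m + n + 1 + 1 := by ring
    refine three_subgroups _ _ _ _ ?_ ?_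
    · rw [Subgroup.commutator_comm ⊤, ← Subgroup.lowerCentralSeries_succ, e]
      have h := ih (m + 1)
      rwa [show m + 1 + n + 1 = m + n + 1 + 1 by ring] at h
    · rw [e]
      exact Subgroup.commutator_mono (ih m) le_rfl

/-- The lower central series `γ 1 = G`, `γ (n + 1) = [γ n, G]` of a group `G`. -/
def lowerCentral (G : Type*) [Group G] : NSeries G where
  term n := (⊤ : Subgroup G).lowerCentralSeries (n - 1)
  antitone m n h := Subgroup.lowerCentralSeries_antitone _
    (Nat.sub_le_sub_right (PNat.coe_le_coe m n |>.2 h) 1)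
  commutator_mem m n x y hx hy := by
    have h := commutator_lowerCentralSeries_le _ _ (Subgroup.commutator_mem_commutator hx hy)
    have e : (m : ℕ) - 1 + ((n : ℕ) - 1) + 1 = ((m + n : ℕ+) : ℕ) - 1 := by
      have := m.pos
      have := n.pos
      rw [PNat.add_coe]
      omega
    rwa [e] at h

end NSeries

namespace Adic

section

variable (k : Type*) {A : Type*} [CommRing k] [Ring A] [Algebra k A] (I : Ideal A) [I.IsTwoSided]

/-- The completion `lim A / I ^ n` of a (not necessarily commutative) algebra at a two-sided ideal:
the compatible families of residue classes. -/
def Completion : Subalgebra k (∀ n : ℕ, A ⧸ I ^ n) where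
  carrier := {x | ∀ (m n : ℕ) (h : m ≤ n),
    Ideal.Quotient.factorₐ k (Ideal.pow_le_pow_right h) (x n) = x m}
  mul_mem' hx hy m n h := by
    simp only [Pi.mul_apply, map_mul, hx m n h, hy m n h]
  add_mem' hx hy m n h := by
    simp only [Pi.add_apply, map_add, hx m n h, hy m n h]
  algebraMap_mem' r m n h := by
    simp only [Pi.algebraMap_apply, AlgHom.commutes]

/-- The canonical map from `A` to its completion. -/
def toCompletion : A →ₐ[k] Completion k I :=
  (AlgHom.pi fun n => Ideal.Quotient.mkₐ k (I ^ n)).codRestrict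
    (Completion k I) (fun _ _ _ _ => rfl)

/-- The projection from the completion to `A / I ^ n`. -/
def proj (n : ℕ) : Completion k I →ₐ[k] A ⧸ I ^ n :=
  (Pi.evalAlgHom k (fun n : ℕ => A ⧸ I ^ n) n).comp (Completion k I).val

theorem proj_toCompletion (n : ℕ) (a : A) :
    proj k I n (toCompletion k I a) = Ideal.Quotient.mk (I ^ n) a := rfl

theorem proj_ext {x y : Completion k I} (h : ∀ n, proj k I n x = proj k I n y) : x = y :=
  Subtype.ext (funext h)

theorem factor_proj {m n : ℕ} (h : m ≤ n) (x : Completion k I) :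
    Ideal.Quotient.factorₐ k (Ideal.pow_le_pow_right h) (proj k I n x) = proj k I m x :=
  x.2 m n h

/-- The filtration of the completion: the kernel of the projection to `A / I ^ n`, which is the
closure of the image of `I ^ n` (see `mem_fil_iff_closure`). -/
def fil (n : ℕ) : Ideal (Completion k I) := RingHom.ker (proj k I n)

instance (n : ℕ) : (fil k I n).IsTwoSided :=
  inferInstanceAs (RingHom.ker (proj k I n)).IsTwoSided

theorem mem_fil {n : ℕ} {x : Completion k I} : x ∈ fil k I n ↔ proj k I n x = 0 := Iff.rfl

theorem exists_rep {m n : ℕ} (h : m ≤ n) {x : Completion k I} (hx : x ∈ fil k I m) :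
    ∃ a ∈ I ^ m, Ideal.Quotient.mk (I ^ n) a = proj k I n x := by
  obtain ⟨a, ha⟩ := Ideal.Quotient.mk_surjective (proj k I n x)
  refine ⟨a, ?_, ha⟩
  rw [← Ideal.Quotient.eq_zero_iff_mem]
  rw [mem_fil, ← factor_proj k I h, ← ha] at hx
  exact hx

theorem fil_antitone {m n : ℕ} (h : m ≤ n) : fil k I n ≤ fil k I m := fun x hx => by
  rw [mem_fil] at hx ⊢
  rw [← factor_proj k I h, hx, map_zero]

/-- The ideal `fil n` is the closure of the image of `I ^ n`, for the topology of the completion in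
which the `fil N` are a basis of neighbourhoods of zero. -/
theorem mem_fil_iff_closure (n : ℕ) (x : Completion k I) :
    x ∈ fil k I n ↔ ∀ N, ∃ a ∈ I ^ n, x - toCompletion k I a ∈ fil k I N := by
  constructor
  · intro hx N
    rcases le_total n N with h | h
    · obtain ⟨a, ha, e⟩ := exists_rep k I h hx
      refine ⟨a, ha, ?_⟩
      rw [mem_fil, map_sub, proj_toCompletion, e, sub_self]
    · exact ⟨0, zero_mem _, by simpa using fil_antitone k I h hx⟩
  · intro h
    obtain ⟨a, ha, e⟩ := h n
    rw [mem_fil, map_sub, proj_toCompletion, Ideal.Quotient.eq_zero_iff_mem.2 ha, sub_zero] at e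
    exact e

theorem mul_mem_fil {m n : ℕ} {x y : Completion k I} (hx : x ∈ fil k I m) (hy : y ∈ fil k I n) :
    x * y ∈ fil k I (m + n) := by
  obtain ⟨a, ha, ea⟩ := exists_rep k I (Nat.le_add_right m n) hx
  obtain ⟨b, hb, eb⟩ := exists_rep k I (Nat.le_add_left n m) hy
  rw [mem_fil, map_mul, ← ea, ← eb, ← map_mul, Ideal.Quotient.eq_zero_iff_mem,
    Ideal.IsTwoSided.pow_add]
  exact Ideal.mul_mem_mul ha hb

/-- Every element of `1 + fil n` with `n ≥ 1` is a unit. -/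
theorem isUnit_of_sub_one_mem {n : ℕ} (hn : 1 ≤ n) {x : Completion k I}
    (hx : x - 1 ∈ fil k I n) : IsUnit x := by
  have hx1 := fil_antitone k I hn hx
  have hu : ∀ N, IsUnit (proj k I N x) := fun N => by
    rcases Nat.eq_zero_or_pos N with rfl | hN
    · have : Subsingleton (A ⧸ I ^ 0) := by
        rw [Submodule.pow_zero, Ideal.one_eq_top]
        infer_instance
      exact isUnit_of_subsingleton _
    · obtain ⟨a, ha, e⟩ := exists_rep k I hN hx1
      have hnil : IsNilpotent (proj k I N (x - 1)) := by
        refine ⟨N, ?_⟩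
        rw [← e, ← map_pow, Ideal.Quotient.eq_zero_iff_mem]
        exact Ideal.pow_mem_pow (by rwa [Submodule.pow_one] at ha) N
      have h1 : proj k I N x = 1 + proj k I N (x - 1) := by simp
      rw [h1]
      exact hnil.isUnit_one_add
  choose u hu using hu
  let y : Completion k I := ⟨fun N => ((u N)⁻¹ : (A ⧸ I ^ N)ˣ), fun m n h => by
    have h1 := congrArg (Ideal.Quotient.factorₐ k (Ideal.pow_le_pow_right (I := I) h))
      (u n).inv_mul
    rw [map_mul, hu, factor_proj k I h, map_one, ← hu m] at h1
    exact Units.eq_inv_of_mul_eq_one_right h1⟩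
  have hy : ∀ N, proj k I N y = ((u N)⁻¹ : (A ⧸ I ^ N)ˣ) := fun N => rfl
  refine ⟨⟨x, y, ?_, ?_⟩, rfl⟩ <;> refine proj_ext k I fun N => ?_
  · rw [map_mul, hy, ← hu N, map_one, Units.mul_inv]
  · rw [map_mul, hy, ← hu N, map_one, Units.inv_mul]

/-- The group `1 + fil n` (for `n ≥ 1`), as a subgroup of the units of the completion. -/
def onePlus (n : ℕ) : Subgroup (Completion k I)ˣ :=
  (Units.map (proj k I n : Completion k I →* A ⧸ I ^ n)).ker

theorem mem_onePlus {n : ℕ} {u : (Completion k I)ˣ} :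
    u ∈ onePlus k I n ↔ (u : Completion k I) - 1 ∈ fil k I n := by
  rw [onePlus, MonoidHom.mem_ker, Units.ext_iff, mem_fil, map_sub, map_one, sub_eq_zero]
  rfl

/-- The element of `1 + fil n` given by an element of the completion congruent to one. -/
noncomputable def onePlus.mk {n : ℕ} (hn : 1 ≤ n) (x : Completion k I) (hx : x - 1 ∈ fil k I n) :
    onePlus k I n :=
  ⟨(isUnit_of_sub_one_mem k I hn hx).unit, (mem_onePlus k I).2 hx⟩

theorem commutator_mem_onePlus {m n : ℕ} {u v : (Completion k I)ˣ} (hu : u ∈ onePlus k I m)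
    (hv : v ∈ onePlus k I n) : ⁅u, v⁆ ∈ onePlus k I (m + n) := by
  rw [mem_onePlus] at hu hv ⊢
  have h1 := mul_mem_fil k I hu hv
  have h2 := mul_mem_fil k I hv hu
  rw [add_comm n m] at h2
  have h3 := Ideal.mul_mem_right ((u⁻¹ * v⁻¹ : (Completion k I)ˣ) : Completion k I) _
    (sub_mem h1 h2)
  convert h3 using 1
  have e : ((u : Completion k I) - 1) * (v - 1) - (v - 1) * (u - 1) = u * v - v * u := by
    simp only [mul_sub, sub_mul, one_mul, mul_one]
    abel
  rw [e, sub_mul, commutatorElement_def]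
  simp [mul_assoc]

/-- The central filtration of the group `1 + fil 1` by its subgroups `1 + fil n`. -/
def oneSeries : NSeries (onePlus k I 1) where
  term n := (onePlus k I n).subgroupOf (onePlus k I 1)
  antitone m n h u hu := by
    rw [Subgroup.mem_subgroupOf, mem_onePlus] at hu ⊢
    exact fil_antitone k I (PNat.coe_le_coe m n |>.2 h) hu
  commutator_mem m n u v hu hv := by
    rw [Subgroup.mem_subgroupOf] at hu hv ⊢
    exact commutator_mem_onePlus k I hu hv

end

section

variable (k : Type*) {A : Type*} [CommRing k] [Ring A] [Algebra k A] (I : Ideal A) [I.IsTwoSided]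

/-- `I ^ n` as a `k`-submodule. -/
abbrev powSub (n : ℕ) : Submodule k A := (I ^ n).restrictScalars k

/-- The `k`-module `I ^ n / I ^ (n + 1)`. -/
def GrPiece (n : ℕ) : Type _ := powSub k I n ⧸ (powSub k I (n + 1)).submoduleOf (powSub k I n)

instance (n : ℕ) : AddCommGroup (GrPiece k I n) := inferInstanceAs (AddCommGroup (_ ⧸ _))
instance (n : ℕ) : Module k (GrPiece k I n) := inferInstanceAs (Module k (_ ⧸ _))

/-- The class in `I ^ n / I ^ (n + 1)` of an element of `I ^ n`. -/
def grMk (n : ℕ) : powSub k I n →ₗ[k] GrPiece k I n := Submodule.mkQ _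

variable {k I} in
theorem grMk_surjective {n : ℕ} (x : GrPiece k I n) : ∃ a, grMk k I n a = x :=
  Submodule.mkQ_surjective _ x

theorem grMk_eq_iff {n : ℕ} {a b : powSub k I n} :
    grMk k I n a = grMk k I n b ↔ (a : A) - b ∈ I ^ (n + 1) :=
  Submodule.Quotient.eq _

/-- The product of elements of `I ^ m` and `I ^ n`, as an element of `I ^ (m + n)`. -/
def powMul (m n : ℕ) (a : powSub k I m) (b : powSub k I n) : powSub k I (m + n) :=
  ⟨a * b, by
    rw [Submodule.restrictScalars_mem, Ideal.IsTwoSided.pow_add]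
    exact Ideal.mul_mem_mul a.2 b.2⟩

/-- The product `I ^ m / I ^ (m + 1) × I ^ n / I ^ (n + 1) → I ^ (m + n) / I ^ (m + n + 1)`. -/
def grMul {m n : ℕ} : GrPiece k I m → GrPiece k I n → GrPiece k I (m + n) :=
  Quotient.map₂ (powMul k I m n) fun a a' ha b b' hb => by
    replace ha := (grMk_eq_iff k I).1 (Quotient.sound ha : grMk k I m a = grMk k I m a')
    replace hb := (grMk_eq_iff k I).1 (Quotient.sound hb : grMk k I n b = grMk k I n b')
    refine Quotient.exact ((grMk_eq_iff k I).2 ?_ :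
      grMk k I (m + n) (powMul k I m n a b) = grMk k I (m + n) (powMul k I m n a' b'))
    have h1 := Ideal.mul_mem_mul ha b.2
    have h2 := Ideal.mul_mem_mul a'.2 hb
    rw [← Ideal.IsTwoSided.pow_add] at h1 h2
    rw [add_right_comm] at h1
    have h := add_mem h1 h2
    have e : ((a : A) - a') * b + a' * (b - b') = a * b - a' * b' := by noncomm_ring
    rwa [e] at h

theorem grMul_mk {m n : ℕ} (a : powSub k I m) (b : powSub k I n) :
    grMul k I (grMk k I m a) (grMk k I n b) = grMk k I (m + n) (powMul k I m n a b) := rfl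

theorem gradedMk_eq {m n : ℕ} (h : m = n) (a : powSub k I m) (b : powSub k I n)
    (hab : (a : A) = b) :
    GradedMonoid.mk (A := GrPiece k I) m (grMk k I m a) = GradedMonoid.mk n (grMk k I n b) := by
  subst h
  rw [Subtype.ext hab]

/-- The scalar `c` as an element of `I ^ 0`. -/
def powScalar (c : k) : powSub k I 0 :=
  ⟨algebraMap k A c, by
    rw [Submodule.restrictScalars_mem, Submodule.pow_zero, Ideal.one_eq_top]
    trivial⟩

instance : GradedMonoid.GMul (GrPiece k I) where
  mul := grMul k I

instance : GradedMonoid.GOne (GrPiece k I) where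
  one := grMk k I 0 (powScalar k I 1)

instance : GradedMonoid.GMonoid (GrPiece k I) where
  one_mul := by
    rintro ⟨n, x⟩
    obtain ⟨a, rfl⟩ := grMk_surjective x
    exact gradedMk_eq k I (zero_add n) _ _ (by simp [powMul, powScalar])
  mul_one := by
    rintro ⟨n, x⟩
    obtain ⟨a, rfl⟩ := grMk_surjective x
    exact gradedMk_eq k I (add_zero n) _ _ (by simp [powMul, powScalar])
  mul_assoc := by
    rintro ⟨l, x⟩ ⟨m, y⟩ ⟨n, z⟩
    obtain ⟨a, rfl⟩ := grMk_surjective x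
    obtain ⟨b, rfl⟩ := grMk_surjective y
    obtain ⟨c, rfl⟩ := grMk_surjective z
    exact gradedMk_eq k I (add_assoc l m n) _ _ (by simp [powMul, mul_assoc])

instance : DirectSum.GRing (GrPiece k I) where
  mul_zero {m n} x := by
    obtain ⟨a, rfl⟩ := grMk_surjective x
    rw [← map_zero (grMk k I n), ← map_zero (grMk k I (m + n))]
    exact (grMul_mk k I a 0).trans (congrArg _ (Subtype.ext (by simp [powMul])))
  zero_mul {m n} x := by
    obtain ⟨a, rfl⟩ := grMk_surjective x
    rw [← map_zero (grMk k I m), ← map_zero (grMk k I (m + n))]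
    exact (grMul_mk k I 0 a).trans (congrArg _ (Subtype.ext (by simp [powMul])))
  mul_add {m n} x y z := by
    obtain ⟨a, rfl⟩ := grMk_surjective x
    obtain ⟨b, rfl⟩ := grMk_surjective y
    obtain ⟨c, rfl⟩ := grMk_surjective z
    change grMul k I _ _ = grMul k I _ _ + grMul k I _ _
    rw [← map_add, grMul_mk, grMul_mk, grMul_mk, ← map_add]
    exact congrArg _ (Subtype.ext (by simp [powMul, mul_add]))
  add_mul {m n} x y z := by
    obtain ⟨a, rfl⟩ := grMk_surjective x
    obtain ⟨b, rfl⟩ := grMk_surjective y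
    obtain ⟨c, rfl⟩ := grMk_surjective z
    change grMul k I _ _ = grMul k I _ _ + grMul k I _ _
    rw [← map_add, grMul_mk, grMul_mk, grMul_mk, ← map_add]
    exact congrArg _ (Subtype.ext (by simp [powMul, add_mul]))
  natCast n := grMk k I 0 (powScalar k I n)
  natCast_zero := by
    rw [← map_zero (grMk k I 0)]
    exact congrArg _ (Subtype.ext (by simp [powScalar]))
  natCast_succ n := by
    change _ = grMk k I 0 _ + grMk k I 0 (powScalar k I 1)
    rw [← map_add]
    exact congrArg _ (Subtype.ext (by simp [powScalar]))
  intCast n := grMk k I 0 (powScalar k I n)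
  intCast_ofNat n := congrArg _ (Subtype.ext (by simp [powScalar]))
  intCast_negSucc_ofNat n := by
    rw [← map_neg]
    exact congrArg _ (Subtype.ext (by simp [powScalar]))

instance : DirectSum.GAlgebra k (GrPiece k I) where
  toFun := AddMonoidHom.mk' (fun c => grMk k I 0 (powScalar k I c)) fun c d => by
    rw [← map_add]
    exact congrArg _ (Subtype.ext (by simp [powScalar]))
  map_one := rfl
  map_mul r s := gradedMk_eq k I (zero_add 0).symm _ _ (by simp [powMul, powScalar])
  commutes := by
    rintro r ⟨n, x⟩
    obtain ⟨a, rfl⟩ := grMk_surjective x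
    exact gradedMk_eq k I (add_comm 0 n) _ _ (by simp [powMul, powScalar, Algebra.commutes])
  smul_def := by
    rintro r ⟨n, x⟩
    obtain ⟨a, rfl⟩ := grMk_surjective x
    exact gradedMk_eq k I (zero_add n).symm (r • a) _
      (by simp [powMul, powScalar, Algebra.smul_def])

/-- The associated graded algebra `⨁ I ^ n / I ^ (n + 1)`. -/
abbrev Gr : Type _ := ⨁ n : ℕ, GrPiece k I n

/-- The Lie ring structure given by the commutators in the associated graded algebra. -/
instance : LieRing (Gr k I) := LieRing.ofAssociativeRing

/-- The class in degree `n` of the associated graded algebra of an element of `I ^ n`. -/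
noncomputable def symbol (n : ℕ) (a : A) (ha : a ∈ I ^ n) : Gr k I :=
  DirectSum.of (GrPiece k I) n (grMk k I n ⟨a, ha⟩)

theorem gr_mul_apply_eq_zero (x y : Gr k I) (l : ℕ)
    (h : ∀ i j, i + j = l → x i = 0 ∨ y j = 0) : (x * y) l = 0 := by
  classical
  rw [DirectSum.mul_eq_sum_support_ghas_mul, DFinsupp.finsetSum_apply]
  refine Finset.sum_eq_zero fun ij hij => ?_
  rw [Finset.mem_product, DFinsupp.mem_support_iff, DFinsupp.mem_support_iff] at hij
  refine DirectSum.of_eq_of_ne _ _ _ fun e => ?_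
  exact (h ij.1 ij.2 e.symm).elim hij.1 hij.2

/-- The ideal of elements of the associated graded algebra with no terms of degree `< n`. -/
def grGE (n : ℕ) : Ideal (Gr k I) where
  carrier := {x | ∀ i < n, x i = 0}
  zero_mem' i hi := rfl
  add_mem' hx hy i hi := by rw [DirectSum.add_apply, hx i hi, hy i hi, add_zero]
  smul_mem' y x hx l hl := gr_mul_apply_eq_zero k I y x l fun i j e => Or.inr (hx j (by omega))

instance (n : ℕ) : (grGE k I n).IsTwoSided :=
  ⟨fun {x} y hx l hl => gr_mul_apply_eq_zero k I x y l fun i j e => Or.inl (hx i (by omega))⟩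

/-- The submodule of elements of the associated graded algebra with no terms of degree `≥ n`. -/
def grLT (n : ℕ) : Submodule k (Gr k I) where
  carrier := {x | ∀ i, n ≤ i → x i = 0}
  zero_mem' i hi := rfl
  add_mem' hx hy i hi := by rw [DirectSum.add_apply, hx i hi, hy i hi, add_zero]
  smul_mem' c x hx i hi := by rw [DirectSum.smul_apply, hx i hi, smul_zero]

end

end Adic
namespace Raag

section

variable {V : Type*} (Γ : SimpleGraph V)

/-- The right-angled Artin group `⟨V | v w = w v whenever v, w are adjacent⟩`. -/
abbrev ArtinGroup : Type _ :=
  PresentedGroup {r : FreeGroup V | ∃ v w, Γ.Adj v w ∧ r = ⁅FreeGroup.of v, FreeGroup.of w⁆}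

/-- The generator of the right-angled Artin group corresponding to a vertex. -/
def gen (v : V) : ArtinGroup Γ := PresentedGroup.of v

/-- The monoid `⟨V | v w = w v whenever v, w are adjacent⟩` of monomials in partially commuting
variables. -/
abbrev Mon : Type _ := PresentedMonoid fun a b : FreeMonoid V =>
  ∃ v w, Γ.Adj v w ∧ a = FreeMonoid.of v * FreeMonoid.of w ∧ b = FreeMonoid.of w * FreeMonoid.of v

/-- The variable `v`, as a monomial. -/
def monVar (v : V) : Mon Γ := PresentedMonoid.of _ v

/-- The degree of a monomial. -/
def monDeg : Mon Γ →* Multiplicative ℕ :=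
  PresentedMonoid.lift (fun _ => Multiplicative.ofAdd 1) (by
    rintro a b ⟨v, w, -, rfl, rfl⟩
    simp)

theorem monDeg_var (v : V) : monDeg Γ (monVar Γ v) = Multiplicative.ofAdd 1 := rfl

theorem monVar_comm {v w : V} (h : Γ.Adj v w) :
    monVar Γ v * monVar Γ w = monVar Γ w * monVar Γ v :=
  PresentedMonoid.mk_eq_mk_of_rel ⟨v, w, h, rfl, rfl⟩

/-- A word `v₁ ^ e₁ ⋯ vₙ ^ eₙ` with `vᵢ ∈ V` and `eᵢ ∈ ℤ`, as the list of its factors. -/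
abbrev Word (V : Type*) : Type _ := List (V × ℤ)

/-- The three moves on words: remove a factor `v ^ 0`; merge neighbouring powers of the same
letter; swap neighbouring powers of adjacent letters. -/
inductive Move : Word V → Word V → Prop
  | remove (a b : Word V) (v : V) : Move (a ++ (v, 0) :: b) (a ++ b)
  | merge (a b : Word V) (v : V) (e f : ℤ) :
      Move (a ++ (v, e) :: (v, f) :: b) (a ++ (v, e + f) :: b)
  | swap (a b : Word V) (v w : V) (e f : ℤ) (h : Γ.Adj v w) :
      Move (a ++ (v, e) :: (w, f) :: b) (a ++ (w, f) :: (v, e) :: b)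

/-- A word is reduced if no sequence of moves decreases its number of factors. -/
def IsReduced (x : Word V) : Prop :=
  ∀ y, Relation.ReflTransGen (Move Γ) x y → x.length ≤ y.length

/-- The element of the right-angled Artin group represented by a word. -/
def Word.toGroup (x : Word V) : ArtinGroup Γ := (x.map fun a => gen Γ a.1 ^ a.2).prod

/-- The word `w₁ ^ (p ^ s₁) ⋯ wₖ ^ (p ^ sₖ)` given by the list of the pairs `(wᵢ, sᵢ)`. -/
def pWord (p : ℕ) (l : List (V × ℕ)) : Word V := l.map fun a => (a.1, (p : ℤ) ^ a.2)

/-- The monomial `w₁ ^ (p ^ s₁) ⋯ wₖ ^ (p ^ sₖ)` given by the list of the pairs `(wᵢ, sᵢ)`. -/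
def pMon (p : ℕ) (l : List (V × ℕ)) : Mon Γ := (l.map fun a => monVar Γ a.1 ^ p ^ a.2).prod

end

section

variable (k : Type*) [CommRing k] {V : Type*} (Γ : SimpleGraph V)

/-- The defining relations `v w = w v`, for adjacent `v, w`, of the algebra of polynomials in
partially commuting variables. -/
inductive PolyRel : FreeAlgebra k V → FreeAlgebra k V → Prop
  | comm {v w : V} (h : Γ.Adj v w) :
      PolyRel (FreeAlgebra.ι k v * FreeAlgebra.ι k w) (FreeAlgebra.ι k w * FreeAlgebra.ι k v)

/-- The `k`-algebra `⟨V | v w = w v whenever v, w are adjacent⟩` of polynomials in partially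
commuting variables. -/
abbrev Poly : Type _ := RingQuot (PolyRel k Γ)

/-- The Lie ring structure given by the commutators in the algebra of polynomials. -/
instance : LieRing (Poly k Γ) := LieRing.ofAssociativeRing

/-- The variable `v` in the algebra of polynomials in partially commuting variables. -/
def X (v : V) : Poly k Γ := RingQuot.mkAlgHom k (PolyRel k Γ) (FreeAlgebra.ι k v)

theorem X_comm {v w : V} (h : Γ.Adj v w) : X k Γ v * X k Γ w = X k Γ w * X k Γ v := by
  simp only [X, ← map_mul]
  exact RingQuot.mkAlgHom_rel k (.comm h)

/-- The algebra homomorphism out of `Poly k Γ` determined by the images of the variables. -/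
noncomputable def polyLift {B : Type*} [Ring B] [Algebra k B] (f : V → B)
    (hf : ∀ v w, Γ.Adj v w → f v * f w = f w * f v) : Poly k Γ →ₐ[k] B :=
  RingQuot.liftAlgHom k ⟨FreeAlgebra.lift k f, fun _ _ h => by
    cases h with
    | comm h => simpa using hf _ _ h⟩

theorem polyLift_X {B : Type*} [Ring B] [Algebra k B] (f : V → B)
    (hf : ∀ v w, Γ.Adj v w → f v * f w = f w * f v) (v : V) :
    polyLift k Γ f hf (X k Γ v) = f v := by
  simp [polyLift, X]

variable {k Γ} in
theorem poly_hom_ext {B : Type*} [Ring B] [Algebra k B] {f g : Poly k Γ →ₐ[k] B}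
    (h : ∀ v, f (X k Γ v) = g (X k Γ v)) : f = g := by
  exact RingQuot.ringQuot_ext' k _ _ (FreeAlgebra.hom_ext (funext h))

/-- The augmentation of `Poly k Γ`, sending a polynomial to its constant term. -/
noncomputable def polyAug : Poly k Γ →ₐ[k] k :=
  polyLift k Γ (fun _ => 0) (fun _ _ _ => rfl)

/-- The augmentation ideal of `Poly k Γ`. -/
noncomputable def polyIdeal : Ideal (Poly k Γ) := RingHom.ker (polyAug k Γ)

instance : (polyIdeal k Γ).IsTwoSided :=
  inferInstanceAs (RingHom.ker (polyAug k Γ)).IsTwoSided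

theorem X_mem (v : V) : X k Γ v ∈ polyIdeal k Γ := polyLift_X k Γ _ _ v

/-- The homogeneous component of degree `n` of `Poly k Γ`: the span of the products of `n`
variables. -/
def polyHomog (n : ℕ) : Submodule k (Poly k Γ) :=
  Submodule.span k {r | ∃ l : List V, l.length = n ∧ r = (l.map (X k Γ)).prod}

/-- The polynomials in partially commuting variables with no terms of degree `≥ n`. -/
def polyLT (n : ℕ) : Submodule k (Poly k Γ) := ⨆ i : Fin n, polyHomog k Γ i

/-- The completion of `Poly k Γ` at its augmentation ideal: the algebra of power series in
partially commuting variables. -/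
abbrev PowerSeries : Type _ := Adic.Completion k (polyIdeal k Γ)

/-- The group algebra of the right-angled Artin group. -/
abbrev GroupAlg : Type _ := MonoidAlgebra k (ArtinGroup Γ)

/-- The group element `g`, in the group algebra. -/
noncomputable def grp (g : ArtinGroup Γ) : GroupAlg k Γ := MonoidAlgebra.of k (ArtinGroup Γ) g

/-- The augmentation of the group algebra, sending every group element to one. -/
noncomputable def groupAug : GroupAlg k Γ →ₐ[k] k := MonoidAlgebra.lift k k (ArtinGroup Γ) 1

/-- The augmentation ideal of the group algebra. -/
noncomputable def groupIdeal : Ideal (GroupAlg k Γ) := RingHom.ker (groupAug k Γ)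

instance : (groupIdeal k Γ).IsTwoSided :=
  inferInstanceAs (RingHom.ker (groupAug k Γ)).IsTwoSided

theorem grp_sub_one_mem (g : ArtinGroup Γ) : grp k Γ g - 1 ∈ groupIdeal k Γ := by
  rw [groupIdeal, RingHom.mem_ker, map_sub, map_one, sub_eq_zero]
  exact (MonoidAlgebra.lift_of _ _).trans rfl

/-- The completion of the group algebra at its augmentation ideal. -/
abbrev GroupCompletion : Type _ := Adic.Completion k (groupIdeal k Γ)

theorem toCompletion_X_mem (v : V) :
    Adic.toCompletion k (polyIdeal k Γ) (X k Γ v) ∈ Adic.fil k (polyIdeal k Γ) 1 := by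
  rw [Adic.mem_fil, Adic.proj_toCompletion, Ideal.Quotient.eq_zero_iff_mem, Submodule.pow_one]
  exact X_mem k Γ v

/-- The element `1 + v` of the group `1 + ϖ` of power series with constant term one. -/
noncomputable def onePlusX (v : V) : Adic.onePlus k (polyIdeal k Γ) 1 :=
  Adic.onePlus.mk k (polyIdeal k Γ) le_rfl (1 + Adic.toCompletion k (polyIdeal k Γ) (X k Γ v))
    (by rw [add_sub_cancel_left]; exact toCompletion_X_mem k Γ v)

theorem onePlusX_val (v : V) : ((onePlusX k Γ v : (PowerSeries k Γ)ˣ) : PowerSeries k Γ) =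
    1 + Adic.toCompletion k (polyIdeal k Γ) (X k Γ v) := rfl

theorem onePlusX_comm {v w : V} (h : Γ.Adj v w) :
    onePlusX k Γ v * onePlusX k Γ w = onePlusX k Γ w * onePlusX k Γ v := by
  refine Subtype.ext (Units.ext ?_)
  simp only [Subgroup.coe_mul, Units.val_mul, onePlusX_val]
  rw [mul_add, mul_add, add_mul, add_mul, add_mul, add_mul, ← map_mul, ← map_mul, X_comm k Γ h]
  simp only [mul_one, one_mul]
  abel

/-- The Magnus map, from the right-angled Artin group to the group of power series with constant
term one, sending `v` to `1 + v`. -/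
noncomputable def magnus : ArtinGroup Γ →* Adic.onePlus k (polyIdeal k Γ) 1 :=
  PresentedGroup.toGroup (f := onePlusX k Γ) (by
    rintro r ⟨v, w, h, rfl⟩
    rw [map_commutatorElement, FreeGroup.lift_apply_of, FreeGroup.lift_apply_of,
      commutatorElement_eq_one_iff_mul_comm]
    exact onePlusX_comm k Γ h)

theorem magnus_gen (v : V) : magnus k Γ (gen Γ v) = onePlusX k Γ v :=
  PresentedGroup.toGroup.of _

/-- The power series that is the image of a group element under the Magnus map. -/
noncomputable def magnusSeries : ArtinGroup Γ →* PowerSeries k Γ :=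
  (Units.coeHom (PowerSeries k Γ)).comp
    ((Adic.onePlus k (polyIdeal k Γ) 1).subtype.comp (magnus k Γ))

/-- The linear extension of the Magnus map to the group algebra. -/
noncomputable def magnusLinear : GroupAlg k Γ →ₐ[k] PowerSeries k Γ :=
  MonoidAlgebra.lift k (PowerSeries k Γ) (ArtinGroup Γ) (magnusSeries k Γ)

/-- The expansion of a polynomial in partially commuting variables as a combination of monomials. -/
noncomputable def expand : Poly k Γ →ₐ[k] MonoidAlgebra k (Mon Γ) :=
  polyLift k Γ (fun v => MonoidAlgebra.of k (Mon Γ) (monVar Γ v)) fun v w h => by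
    rw [← map_mul, ← map_mul, monVar_comm Γ h]

/-- The coefficient of a monomial in a polynomial in partially commuting variables. -/
noncomputable def polyCoeff (m : Mon Γ) : Poly k Γ →ₗ[k] k where
  toFun r := (expand k Γ r).coeff m
  map_add' r s := by simp
  map_smul' c r := by simp

theorem eq_one_of_monDeg {m : Mon Γ} (hm : (monDeg Γ m).toAdd = 0) : m = 1 := by
  induction m using PresentedMonoid.inductionOn with
  | h a =>
    induction a using FreeMonoid.casesOn with
    | one => exact map_one _
    | of_mul v b =>
      rw [map_mul, map_mul, toAdd_mul] at hm
      exact absurd (Nat.eq_zero_of_add_eq_zero_right hm) one_ne_zero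

/-- The augmentation of the algebra of monomials. -/
noncomputable def monAug : MonoidAlgebra k (Mon Γ) →ₐ[k] k :=
  MonoidAlgebra.lift k k (Mon Γ) (PresentedMonoid.lift (fun _ => 0) (by
    rintro a b ⟨v, w, -, rfl, rfl⟩
    simp))

theorem monAug_expand (r : Poly k Γ) : monAug k Γ (expand k Γ r) = polyAug k Γ r := by
  have h : (monAug k Γ).comp (expand k Γ) = polyAug k Γ := poly_hom_ext fun v => by
    rw [AlgHom.comp_apply, expand, polyLift_X, polyAug, polyLift_X, monAug, MonoidAlgebra.lift_of]
    rfl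
  exact DFunLike.congr_fun h r

theorem monAug_apply (f : MonoidAlgebra k (Mon Γ)) : monAug k Γ f = f.coeff 1 := by
  rw [monAug, MonoidAlgebra.lift_apply, Finsupp.sum, Finset.sum_eq_single 1]
  · simp
  · intro m _ hm
    induction m using PresentedMonoid.inductionOn with
    | h a =>
      induction a using FreeMonoid.casesOn with
      | one => exact absurd (map_one _) hm
      | of_mul v b =>
        rw [map_mul (PresentedMonoid.mk _), map_mul (PresentedMonoid.lift _ _)]
        change _ • ((0 : k) * _) = 0
        rw [zero_mul, smul_zero]
  · intro h
    rw [Finsupp.notMem_support_iff.1 h, zero_smul]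

theorem expand_mul_coeff_eq_zero {a b : ℕ} {f g : MonoidAlgebra k (Mon Γ)}
    (hf : ∀ m, (monDeg Γ m).toAdd < a → f.coeff m = 0)
    (hg : ∀ m, (monDeg Γ m).toAdd < b → g.coeff m = 0) (m : Mon Γ)
    (hm : (monDeg Γ m).toAdd < a + b) : (f * g).coeff m = 0 := by
  classical
  rw [MonoidAlgebra.coeff_mul]
  refine Finset.sum_eq_zero fun m₁ h₁ => Finset.sum_eq_zero fun m₂ h₂ => ?_
  rw [Finsupp.mem_support_iff] at h₁ h₂
  refine if_neg ?_
  rintro rfl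
  rw [map_mul, toAdd_mul] at hm
  rcases lt_or_ge (monDeg Γ m₁).toAdd a with h | h
  · exact h₁ (hf _ h)
  · exact h₂ (hg _ (by omega))

theorem coeff_eq_zero_of_mem_pow {n : ℕ} {m : Mon Γ} (hm : (monDeg Γ m).toAdd < n)
    {r : Poly k Γ} (hr : r ∈ polyIdeal k Γ ^ n) : polyCoeff k Γ m r = 0 := by
  induction n generalizing m r with
  | zero => exact absurd hm (Nat.not_lt_zero _)
  | succ n ih =>
    rw [Ideal.IsTwoSided.pow_succ] at hr
    induction hr using Submodule.smul_induction_on' with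
    | smul a ha b hb =>
      rw [smul_eq_mul]
      change (expand k Γ (a * b)).coeff m = 0
      rw [map_mul]
      refine expand_mul_coeff_eq_zero k Γ (a := 1) (b := n) (fun m' h' => ?_)
        (fun m' h' => ih h' hb) m (by omega)
      rw [eq_one_of_monDeg Γ (m := m') (by omega), ← monAug_apply, monAug_expand]
      exact ha
    | add x hx y hy ex ey => rw [map_add, ex, ey, add_zero]

/-- The coefficient of a monomial in a power series in partially commuting variables. -/
noncomputable def coeff (m : Mon Γ) (x : PowerSeries k Γ) : k :=
  ((((polyIdeal k Γ) ^ ((monDeg Γ m).toAdd + 1)).restrictScalars k).liftQ (polyCoeff k Γ m)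
    fun _ hr => coeff_eq_zero_of_mem_pow k Γ (Nat.lt_succ_self _) hr)
    (Adic.proj k (polyIdeal k Γ) ((monDeg Γ m).toAdd + 1) x)

theorem coeff_toCompletion (m : Mon Γ) (r : Poly k Γ) :
    coeff k Γ m (Adic.toCompletion k (polyIdeal k Γ) r) = polyCoeff k Γ m r := rfl

/-- The monomial `m` has the form `w₁ ^ (p ^ s₁) ⋯ wₖ ^ (p ^ sₖ)` for a reduced word, has non-zero
coefficient in `μ(g)`, and among all such monomials its number `k` of factors is maximal and its
exponents are minimal: any other such monomial `u₁ ^ (p ^ t₁) ⋯ uₖ ^ (p ^ tₖ)` with `k` factors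
satisfies `sᵢ ≤ tᵢ` when the factors of `m` are ordered such that `wᵢ = uᵢ`. -/
def IsLeading (p : ℕ) (g : ArtinGroup Γ) (m : Mon Γ) : Prop :=
  ∃ l : List (V × ℕ), IsReduced Γ (pWord p l) ∧ pMon Γ p l = m ∧
    coeff k Γ m (magnusSeries k Γ g) ≠ 0 ∧
    ∀ u : List (V × ℕ), IsReduced Γ (pWord p u) →
      coeff k Γ (pMon Γ p u) (magnusSeries k Γ g) ≠ 0 →
      u.length ≤ l.length ∧
      (u.length = l.length → ∃ l' : List (V × ℕ), IsReduced Γ (pWord p l') ∧ pMon Γ p l' = m ∧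
        List.Forall₂ (fun a b => a.1 = b.1 ∧ a.2 ≤ b.2) l' u)

end

end Raag

/-!
The whole argument rests on the uniqueness of reduced words for monomials. A word is reduced if and
only if its exponents are non-zero and between any two powers of the same letter `v` there is a
letter that does not commute with `v` (`isReduced_iff`); in particular this depends on the letters
only. For two letters that are not adjacent, deleting all the other letters is a homomorphism from
the monomials to a free monoid (`pairProj`), and in free monoids one can cancel. Hence two reduced
words with positive exponents that represent the same monomial differ by swaps only
(`shuffle_of_sameProj`), and an expression of this monomial that has a factor with exponent zero is
longer than these words (`length_le_of_mono_eq`).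

For a reduced word `v₁ ^ e₁ ⋯ vₙ ^ eₙ`, the product `μ(g) = (1 + v₁) ^ e₁ ⋯ (1 + vₙ) ^ eₙ` expands
by the binomial series into the monomials `v₁ ^ j₁ ⋯ vₙ ^ jₙ`. Those with all `jᵢ` positive are
pairwise distinct and different from the others, so that their coefficients are the products of the
binomial coefficients of `eᵢ` and `jᵢ` (`coeff_magnusSeries_withExps`). In characteristic `p`, the
series `(1 + v) ^ e` begins with `1 + (e / q) v ^ q`, where `q` is the largest power of `p` that
divides `e`; this gives the leading monomial (`isLeading_valList`). For arbitrary `k`, some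
coefficient of positive degree of `(1 + v) ^ e` does not vanish in a residue field of `k`, which
gives injectivity (`magnusSeries_injective`).

The lower central series is the smallest central filtration that starts with the whole group, so
that `μ` maps it into the filtration of `1 + ϖ` and induces a map of graded Lie rings. The relation
`[1 + a, 1 + b] = 1 + a b - b a + ⋯` makes `[1 + w] ↦ [w]` a homomorphism of Lie rings (`grOne`).

Finally, `v ↦ v - 1` defines a homomorphism from the polynomials to the group algebra
(`polyToGroup`), and modulo the `n`-th powers of the augmentation ideals it is inverse to the Magnus
map (`magnusMod`): this has to be checked on the generators of the algebra and of the group only.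
The isomorphisms of the completions and of the associated graded algebras follow
(`magnusCompletion`, `symbolEquiv`).
-/

/-! ### Reduced words -/

namespace Raag

section Words

variable {V : Type*} (Γ : SimpleGraph V)

/-- Equality of two lists up to swapping neighbouring entries whose letters are adjacent in `Γ`.
The letter of an entry `a` is `c a`, so that entries may carry exponents and other data along. -/
inductive Shuffle {α : Type*} (c : α → V) : List α → List α → Prop
  | nil : Shuffle c [] []
  | cons (a : α) {x y : List α} : Shuffle c x y → Shuffle c (a :: x) (a :: y)
  | swap {a b : α} (x : List α) (h : Γ.Adj (c a) (c b)) : Shuffle c (a :: b :: x) (b :: a :: x)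
  | trans {x y z : List α} : Shuffle c x y → Shuffle c y z → Shuffle c x z

/-- In the word `x`, every occurrence of the letter `v` is preceded by a letter different from `v`
and not adjacent to it. -/
def Blocked (v : V) : List V → Prop
  | [] => True
  | w :: x => w ≠ v ∧ (Γ.Adj v w → Blocked v x)

/-- Between any two occurrences of a letter `v` in the word there is a letter different from `v` and
not adjacent to it. -/
def Rigid : List V → Prop
  | [] => True
  | v :: x => Blocked Γ v x ∧ Rigid x

variable {Γ}

namespace Shuffle

variable {α β : Type*} {c : α → V}

theorem refl (x : List α) : Shuffle Γ c x x := by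
  induction x with
  | nil => exact nil
  | cons a x ih => exact ih.cons a

theorem symm {x y : List α} (h : Shuffle Γ c x y) : Shuffle Γ c y x := by
  induction h with
  | nil => exact nil
  | cons a _ ih => exact ih.cons a
  | swap x h => exact swap x h.symm
  | trans _ _ ih₁ ih₂ => exact ih₂.trans ih₁

theorem perm {x y : List α} (h : Shuffle Γ c x y) : x.Perm y := by
  induction h with
  | nil => exact .nil
  | cons a _ ih => exact ih.cons a
  | swap x h => exact .swap _ _ _
  | trans _ _ ih₁ ih₂ => exact ih₁.trans ih₂

/-- Entries of a shuffled list carry additional data along. -/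
theorem exists_lift {φ : β → α} {x : List β} {y : List α} {x' : List α} (hx : x.map φ = x')
    (h : Shuffle Γ c x' y) :
    ∃ z, z.map φ = y ∧ Shuffle Γ (c ∘ φ) x z := by
  induction h generalizing x with
  | nil => exact ⟨x, hx, refl x⟩
  | cons a _ ih =>
    obtain ⟨b, t, rfl, rfl, ht⟩ := List.map_eq_cons_iff.1 hx
    obtain ⟨z, rfl, hz⟩ := ih ht
    exact ⟨b :: z, rfl, hz.cons b⟩
  | swap w hab =>
    obtain ⟨b, t, rfl, rfl, ht⟩ := List.map_eq_cons_iff.1 hx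
    obtain ⟨b', t', rfl, rfl, rfl⟩ := List.map_eq_cons_iff.1 ht
    exact ⟨b' :: b :: t', rfl, swap t' hab⟩
  | trans _ _ ih₁ ih₂ =>
    obtain ⟨z, hz, h₁⟩ := ih₁ hx
    obtain ⟨z', hz', h₂⟩ := ih₂ hz
    exact ⟨z', hz', h₁.trans h₂⟩

theorem map {φ : β → α} {x y : List β} (h : Shuffle Γ (c ∘ φ) x y) :
    Shuffle Γ c (x.map φ) (y.map φ) := by
  induction h with
  | nil => exact nil
  | cons a _ ih => exact ih.cons (φ a)
  | swap x h => exact swap _ h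
  | trans _ _ ih₁ ih₂ => exact ih₁.trans ih₂

theorem prod_eq {M : Type*} [Monoid M] {f : α → M}
    (hf : ∀ a b, Γ.Adj (c a) (c b) → f a * f b = f b * f a) {x y : List α}
    (h : Shuffle Γ c x y) : (x.map f).prod = (y.map f).prod := by
  induction h with
  | nil => rfl
  | cons a _ ih => simp [ih]
  | swap x h => simp only [List.map_cons, List.prod_cons, ← mul_assoc, hf _ _ h]
  | trans _ _ ih₁ ih₂ => exact ih₁.trans ih₂

theorem blocked {x y : List α} (h : Shuffle Γ c x y) (v : V) (hx : Blocked Γ v (x.map c)) :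
    Blocked Γ v (y.map c) := by
  induction h with
  | nil => exact hx
  | cons a _ ih => exact ⟨hx.1, fun h => ih (hx.2 h)⟩
  | @swap a b x h =>
    obtain ⟨h₁, h₂⟩ := hx
    refine ⟨fun e => ?_, fun hb => ⟨h₁, fun ha => (h₂ ha).2 hb⟩⟩
    subst e
    exact (h₂ h.symm).1 rfl
  | trans _ _ ih₁ ih₂ => exact ih₂ (ih₁ hx)

theorem rigid {x y : List α} (h : Shuffle Γ c x y) (hx : Rigid Γ (x.map c)) :
    Rigid Γ (y.map c) := by
  induction h with
  | nil => exact hx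
  | cons a h ih => exact ⟨h.blocked _ hx.1, ih hx.2⟩
  | @swap a b x h =>
    obtain ⟨h₁, h₂, h₃⟩ := hx
    exact ⟨⟨h.ne, fun _ => h₂⟩, (h₁.2 h), h₃⟩
  | trans _ _ ih₁ ih₂ => exact ih₂ (ih₁ hx)

end Shuffle

theorem Move.cons {x y : Word V} (h : Move Γ x y) (a : V × ℤ) : Move Γ (a :: x) (a :: y) := by
  cases h with
  | remove b c v => exact .remove (a :: b) c v
  | merge b c v e f => exact .merge (a :: b) c v e f
  | swap b c v w e f h => exact .swap (a :: b) c v w e f h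

theorem not_rigid_of_repeat (a b : List V) (v : V) : ¬ Rigid Γ (a ++ v :: v :: b) := by
  induction a with
  | nil => exact fun h => h.1.1 rfl
  | cons w a ih => exact fun h => ih h.2

/-- The moves that apply to a word with rigid letters and non-zero exponents are swaps. -/
theorem Move.shuffle {x y : Word V} (h : Move Γ x y) (hr : Rigid Γ (x.map Prod.fst))
    (h0 : ∀ a ∈ x, a.2 ≠ 0) : Shuffle Γ Prod.fst x y := by
  cases h with
  | remove b c v => exact absurd rfl (h0 (v, 0) (by simp))
  | merge b c v e f =>
    rw [List.map_append] at hr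
    exact absurd hr (not_rigid_of_repeat _ _ v)
  | swap b c v w e f h =>
    clear hr h0
    induction b with
    | nil => exact .swap _ h
    | cons a b ih => exact ih.cons a

theorem isReduced_of_rigid {x : Word V} (hr : Rigid Γ (x.map Prod.fst))
    (h0 : ∀ a ∈ x, a.2 ≠ 0) : IsReduced Γ x := by
  intro y hy
  have h : Shuffle Γ Prod.fst x y := by
    induction hy with
    | refl => exact .refl x
    | tail _ hm ih =>
      exact ih.trans (hm.shuffle (ih.rigid hr) fun a ha => h0 a (ih.perm.mem_iff.2 ha))
  exact h.perm.length_eq.le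

theorem exists_shorter_of_not_blocked (v : V) (e : ℤ) (x : Word V)
    (h : ¬ Blocked Γ v (x.map Prod.fst)) :
    ∃ y, Relation.ReflTransGen (Move Γ) ((v, e) :: x) y ∧ y.length < x.length + 1 := by
  induction x with
  | nil => exact absurd trivial h
  | cons a x ih =>
    obtain ⟨w, f⟩ := a
    by_cases hw : w = v
    · subst hw
      exact ⟨_, .single (.merge [] x w e f), by simp⟩
    · have h' : Γ.Adj v w ∧ ¬ Blocked Γ v (x.map Prod.fst) := by
        by_contra hc
        exact h ⟨hw, fun ha => by_contra fun hb => hc ⟨ha, hb⟩⟩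
      obtain ⟨y, hy, hl⟩ := ih h'.2
      refine ⟨(w, f) :: y, .head (.swap [] x v w e f h'.1) ?_, by simpa using hl⟩
      exact hy.lift (List.cons (w, f)) fun _ _ h => h.cons _

/-- A word is reduced if and only if its exponents are non-zero and the letters between two powers
of the same letter `v` do not all commute with `v`. -/
theorem isReduced_iff {x : Word V} :
    IsReduced Γ x ↔ Rigid Γ (x.map Prod.fst) ∧ ∀ a ∈ x, a.2 ≠ 0 := by
  refine ⟨fun h => ?_, fun h => isReduced_of_rigid h.1 h.2⟩
  induction x with
  | nil => exact ⟨trivial, by simp⟩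
  | cons a x ih =>
    obtain ⟨v, e⟩ := a
    have hx : IsReduced Γ x := fun y hy => by
      simpa using h _ (hy.lift (List.cons (v, e)) fun _ _ h => h.cons _)
    obtain ⟨h₁, h₂⟩ := ih hx
    refine ⟨⟨?_, h₁⟩, List.forall_mem_cons.2 ⟨?_, h₂⟩⟩
    · by_contra hb
      obtain ⟨y, hy, hl⟩ := exists_shorter_of_not_blocked v e x hb
      exact absurd (h y hy) (by simpa using hl)
    · rintro (rfl : e = 0)
      simpa using h _ (.single (.remove [] x v))

theorem commute_gen {v w : V} (h : Γ.Adj v w) : Commute (gen Γ v) (gen Γ w) := by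
  rw [← commutatorElement_eq_one_iff_commute]
  exact PresentedGroup.one_of_mem (rels := {r : FreeGroup V | ∃ v w, Γ.Adj v w ∧
    r = ⁅FreeGroup.of v, FreeGroup.of w⁆}) ⟨v, w, h, rfl⟩

theorem Move.toGroup_eq {x y : Word V} (h : Move Γ x y) :
    Word.toGroup Γ x = Word.toGroup Γ y := by
  cases h with
  | remove a b v => simp [Word.toGroup]
  | merge a b v e f => simp [Word.toGroup, zpow_add, mul_assoc]
  | swap a b v w e f h =>
    have h2 := ((commute_gen h).zpow_zpow e f).eq
    simp only [Word.toGroup, List.map_append, List.map_cons, List.prod_append, List.prod_cons]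
    rw [← mul_assoc (gen Γ v ^ e), h2, mul_assoc]

theorem Word.toGroup_surjective : Function.Surjective (Word.toGroup Γ) := by
  intro g
  have hg : g ∈ Subgroup.closure (Set.range (gen Γ)) := by
    rw [show Subgroup.closure (Set.range (gen Γ)) = ⊤ from PresentedGroup.closure_range_of _]
    trivial
  induction hg using Subgroup.closure_induction_left with
  | one => exact ⟨[], rfl⟩
  | mul_left x hx y hy ih =>
    obtain ⟨v, rfl⟩ := hx
    obtain ⟨z, rfl⟩ := ih
    exact ⟨(v, 1) :: z, by simp [Word.toGroup]⟩
  | inv_mul_cancel x hx y hy ih =>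
    obtain ⟨v, rfl⟩ := hx
    obtain ⟨z, rfl⟩ := ih
    exact ⟨(v, -1) :: z, by simp [Word.toGroup]⟩

theorem exists_isReduced (g : ArtinGroup Γ) :
    ∃ x : Word V, IsReduced Γ x ∧ Word.toGroup Γ x = g := by
  classical
  have hex : ∃ n, ∃ x : Word V, x.length = n ∧ Word.toGroup Γ x = g := by
    obtain ⟨x, hx⟩ := Word.toGroup_surjective g
    exact ⟨_, x, rfl, hx⟩
  obtain ⟨x, hn, rfl⟩ := Nat.find_spec hex
  refine ⟨x, fun y hy => ?_, rfl⟩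
  rw [hn]
  refine Nat.find_min' hex ⟨y, rfl, ?_⟩
  induction hy with
  | refl => rfl
  | tail _ h ih => exact h.toGroup_eq.symm.trans ih

/-! ### Monomials -/

variable (Γ) in
/-- The monomial `v₁ ^ j₁ ⋯ vₙ ^ jₙ`. -/
def mono (z : List (V × ℕ)) : Mon Γ := (z.map fun a => monVar Γ a.1 ^ a.2).prod

theorem mono_cons (v : V) (e : ℕ) (z : List (V × ℕ)) :
    mono Γ ((v, e) :: z) = monVar Γ v ^ e * mono Γ z := by simp [mono]

theorem commute_monVar_pow {v w : V} (h : Γ.Adj v w) (e f : ℕ) :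
    monVar Γ v ^ e * monVar Γ w ^ f = monVar Γ w ^ f * monVar Γ v ^ e :=
  (Commute.pow_pow (monVar_comm Γ h) e f).eq

theorem Shuffle.mono_eq {x y : List (V × ℕ)} (h : Shuffle Γ Prod.fst x y) :
    mono Γ x = mono Γ y :=
  h.prod_eq fun _ _ hab => commute_monVar_pow hab _ _

open Classical in
/-- For letters `v`, `w` that are not adjacent (possibly equal), the homomorphism to the free monoid
that deletes all other letters from a monomial. -/
noncomputable def pairProj {v w : V} (h : ¬ Γ.Adj v w) : Mon Γ →* FreeMonoid V :=
  PresentedMonoid.lift (fun u => if u = v ∨ u = w then FreeMonoid.of u else 1) (by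
    rintro _ _ ⟨a, b, hab, rfl, rfl⟩
    simp only [map_mul, FreeMonoid.lift_eval_of]
    by_cases ha : a = v ∨ a = w
    · by_cases hb : b = v ∨ b = w
      · exfalso
        rcases ha with rfl | rfl <;> rcases hb with rfl | rfl
        · exact hab.ne rfl
        · exact h hab
        · exact h hab.symm
        · exact hab.ne rfl
      · simp [hb]
    · simp [ha])

theorem pairProj_of_mem {v w u : V} (h : ¬ Γ.Adj v w) (hu : u = v ∨ u = w) :
    pairProj h (monVar Γ u) = FreeMonoid.of u := if_pos hu

theorem pairProj_of_notMem {v w u : V} (h : ¬ Γ.Adj v w) (hu : ¬ (u = v ∨ u = w)) :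
    pairProj h (monVar Γ u) = 1 := if_neg hu

/-- The projections of the monomial `m` to pairs of letters `v`, `w` with `w` not adjacent to `v`
begin with `v`; this is a way to say that `m` is a multiple of `v`. -/
def StartsWith (v : V) (m : Mon Γ) : Prop :=
  ∀ (w : V) (h : ¬ Γ.Adj v w), ∃ t, pairProj h m = FreeMonoid.of v * t

/-- The two monomials have the same projections to pairs of letters that are not adjacent. -/
def SameProj (m m' : Mon Γ) : Prop :=
  ∀ (v w : V) (h : ¬ Γ.Adj v w), pairProj h m = pairProj h m'

theorem SameProj.symm {m m' : Mon Γ} (h : SameProj m m') : SameProj m' m :=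
  fun v w hvw => (h v w hvw).symm

theorem SameProj.cancel {a m m' : Mon Γ} (h : SameProj (a * m) (a * m')) : SameProj m m' :=
  fun v w hvw => by simpa using h v w hvw

theorem startsWith_pow_mul {v : V} {e : ℕ} (he : 0 < e) (m : Mon Γ) :
    StartsWith v (monVar Γ v ^ e * m) := fun w h => by
  obtain ⟨n, rfl⟩ := Nat.exists_eq_succ_of_ne_zero he.ne'
  exact ⟨pairProj h (monVar Γ v ^ n * m), by
    rw [pow_succ', mul_assoc, map_mul, pairProj_of_mem h (Or.inl rfl)]⟩

theorem SameProj.startsWith {v : V} {m m' : Mon Γ} (h : SameProj m m') (hm : StartsWith v m) :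
    StartsWith v m' := fun w hw => by
  rw [← h v w hw]
  exact hm w hw

theorem not_startsWith_one (v : V) : ¬ StartsWith v (1 : Mon Γ) := fun h => by
  obtain ⟨t, ht⟩ := h v Γ.irrefl
  rw [map_one] at ht
  exact absurd ht.symm (by simp)

/-- If `u ^ f ⋯` with `u ≠ v` starts with `v`, then `u` commutes with `v` and the remaining factors
start with `v`. -/
theorem StartsWith.of_cons {v u : V} {f : ℕ} (hf : 0 < f) (hu : u ≠ v) {m : Mon Γ}
    (h : StartsWith v (monVar Γ u ^ f * m)) : Γ.Adj v u ∧ StartsWith v m := by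
  have hadj : Γ.Adj v u := by
    by_contra hn
    obtain ⟨t, ht⟩ := h u hn
    obtain ⟨n, rfl⟩ := Nat.exists_eq_succ_of_ne_zero hf.ne'
    rw [pow_succ', mul_assoc, map_mul, pairProj_of_mem hn (Or.inr rfl)] at ht
    exact hu (List.cons.inj ht).1
  refine ⟨hadj, fun w hw => ?_⟩
  obtain ⟨t, ht⟩ := h w hw
  refine ⟨t, ?_⟩
  rw [map_mul, map_pow, pairProj_of_notMem hw, one_pow, one_mul] at ht
  · exact ht
  · rintro (rfl | rfl)
    · exact hu rfl
    · exact hw hadj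

theorem exists_shuffle_cons {v : V} {z : List (V × ℕ)} (hz : ∀ a ∈ z, 0 < a.2)
    (h : StartsWith v (mono Γ z)) : ∃ f z', Shuffle Γ Prod.fst z ((v, f) :: z') := by
  induction z with
  | nil => exact absurd h (not_startsWith_one v)
  | cons a z ih =>
    obtain ⟨u, f⟩ := a
    by_cases hu : u = v
    · subst hu
      exact ⟨f, z, .refl _⟩
    · rw [mono_cons] at h
      obtain ⟨h₁, h₂⟩ := h.of_cons (hz _ List.mem_cons_self) hu
      obtain ⟨f', z', h'⟩ := ih (fun a ha => hz a (List.mem_cons_of_mem _ ha)) h₂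
      exact ⟨f', (u, f) :: z', (h'.cons (u, f)).trans (.swap _ h₁.symm)⟩

theorem Blocked.not_startsWith {v : V} {z : List (V × ℕ)} (hz : ∀ a ∈ z, 0 < a.2)
    (hb : Blocked Γ v (z.map Prod.fst)) : ¬ StartsWith v (mono Γ z) := by
  induction z with
  | nil => exact not_startsWith_one v
  | cons a z ih =>
    obtain ⟨u, f⟩ := a
    intro h
    rw [mono_cons] at h
    obtain ⟨h₁, h₂⟩ := h.of_cons (hz _ List.mem_cons_self) hb.1
    exact ih (fun a ha => hz a (List.mem_cons_of_mem _ ha)) (hb.2 h₁) h₂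

theorem SameProj.le_of_blocked {v : V} {e f : ℕ} {x : List (V × ℕ)} {m : Mon Γ}
    (hx : ∀ a ∈ x, 0 < a.2) (hb : Blocked Γ v (x.map Prod.fst))
    (h : SameProj (mono Γ ((v, e) :: x)) (monVar Γ v ^ f * m)) : f ≤ e := by
  by_contra hlt
  obtain ⟨d, rfl⟩ := Nat.exists_eq_add_of_lt (not_le.1 hlt)
  rw [mono_cons, add_assoc, pow_add, mul_assoc] at h
  exact hb.not_startsWith hx (h.cancel.symm.startsWith (startsWith_pow_mul (Nat.succ_pos d) _))

theorem SameProj.eq_of_blocked {v : V} {e f : ℕ} {x y : List (V × ℕ)}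
    (hx : ∀ a ∈ x, 0 < a.2) (hbx : Blocked Γ v (x.map Prod.fst))
    (hy : ∀ a ∈ y, 0 < a.2) (hby : Blocked Γ v (y.map Prod.fst))
    (h : SameProj (mono Γ ((v, e) :: x)) (mono Γ ((v, f) :: y))) :
    e = f ∧ SameProj (mono Γ x) (mono Γ y) := by
  have h₁ : f ≤ e := h.le_of_blocked hx hbx
  have h₂ : e ≤ f := h.symm.le_of_blocked hy hby
  obtain rfl := le_antisymm h₁ h₂
  exact ⟨rfl, h.cancel⟩

theorem eq_nil_of_sameProj_one {y : List (V × ℕ)} (hy : ∀ a ∈ y, 0 < a.2)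
    (h : SameProj (mono Γ y) 1) : y = [] := by
  cases y with
  | nil => rfl
  | cons a y =>
    exact absurd (h.startsWith (startsWith_pow_mul (hy a List.mem_cons_self) _))
      (not_startsWith_one _)

/-- Two reduced words with positive exponents that represent the same monomial differ by a
shuffle. -/
theorem shuffle_of_sameProj {x y : List (V × ℕ)} (hx : ∀ a ∈ x, 0 < a.2)
    (hrx : Rigid Γ (x.map Prod.fst)) (hy : ∀ a ∈ y, 0 < a.2) (hry : Rigid Γ (y.map Prod.fst))
    (h : SameProj (mono Γ x) (mono Γ y)) : Shuffle Γ Prod.fst x y := by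
  induction x generalizing y with
  | nil =>
    rw [eq_nil_of_sameProj_one hy h.symm]
    exact .nil
  | cons a x ih =>
    obtain ⟨v, e⟩ := a
    have hs := h.startsWith (startsWith_pow_mul (hx _ List.mem_cons_self) _)
    obtain ⟨f, z, hz⟩ := exists_shuffle_cons hy hs
    rw [hz.mono_eq] at h
    have hz' : ∀ a ∈ z, 0 < a.2 := fun a ha =>
      hy a (hz.perm.mem_iff.2 (List.mem_cons_of_mem _ ha))
    have hx' : ∀ a ∈ x, 0 < a.2 := fun a ha => hx a (List.mem_cons_of_mem _ ha)
    have hrz := hz.rigid hry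
    obtain ⟨rfl, h'⟩ := h.eq_of_blocked hx' hrx.1 hz' hrz.1
    exact ((ih hx' hrx.2 hz' hrz.2 h').cons _).trans hz.symm

/-- A reduced word with positive exponents is determined by its letters and its monomial. -/
theorem eq_of_sameProj {x y : List (V × ℕ)} (hx : ∀ a ∈ x, 0 < a.2)
    (hr : Rigid Γ (x.map Prod.fst)) (hy : ∀ a ∈ y, 0 < a.2)
    (hxy : x.map Prod.fst = y.map Prod.fst) (h : SameProj (mono Γ x) (mono Γ y)) : x = y := by
  induction x generalizing y with
  | nil => exact (List.map_eq_nil_iff.1 hxy.symm).symm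
  | cons a x ih =>
    obtain ⟨v, e⟩ := a
    obtain ⟨⟨w, f⟩, y, rfl, rfl, hxy'⟩ := List.map_eq_cons_iff.1 hxy.symm
    have hx' : ∀ a ∈ x, 0 < a.2 := fun a ha => hx a (List.mem_cons_of_mem _ ha)
    have hy' : ∀ a ∈ y, 0 < a.2 := fun a ha => hy a (List.mem_cons_of_mem _ ha)
    obtain ⟨rfl, h'⟩ := h.eq_of_blocked hx' hr.1 hy' (hxy' ▸ hr.1)
    rw [ih hx' hr.2 hy' hxy'.symm h']

theorem exists_mono_eq_pow_mul {v : V} (e : ℕ) {z : List (V × ℕ)} (hz : ∀ a ∈ z, 0 < a.2)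
    (hb : ¬ Blocked Γ v (z.map Prod.fst)) :
    ∃ z' : List (V × ℕ), z'.map Prod.fst = z.map Prod.fst ∧ (∀ a ∈ z', 0 < a.2) ∧
      mono Γ z' = monVar Γ v ^ e * mono Γ z := by
  induction z with
  | nil => exact absurd trivial hb
  | cons a z ih =>
    obtain ⟨w, f⟩ := a
    obtain ⟨hf, hz'⟩ := List.forall_mem_cons.1 hz
    by_cases hw : w = v
    · subst hw
      refine ⟨(w, e + f) :: z, rfl, List.forall_mem_cons.2 ⟨Nat.add_pos_right e hf, hz'⟩, ?_⟩
      rw [mono_cons, mono_cons, pow_add, mul_assoc]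
    · have h' : Γ.Adj v w ∧ ¬ Blocked Γ v (z.map Prod.fst) := by
        by_contra hc
        exact hb ⟨hw, fun ha => by_contra fun hb => hc ⟨ha, hb⟩⟩
      obtain ⟨y, h₁, h₂, h₃⟩ := ih hz' h'.2
      refine ⟨(w, f) :: y, by simp [h₁], List.forall_mem_cons.2 ⟨hf, h₂⟩, ?_⟩
      rw [mono_cons, mono_cons, h₃, ← mul_assoc, ← mul_assoc, commute_monVar_pow h'.1]

/-- Every word with exponents in `ℕ` represents the monomial of a reduced word with positive
exponents that is not longer, and shorter if some exponent of the given word is zero. -/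
theorem exists_rigid_mono_eq (y : List (V × ℕ)) :
    ∃ z : List (V × ℕ), Rigid Γ (z.map Prod.fst) ∧ (∀ a ∈ z, 0 < a.2) ∧ mono Γ z = mono Γ y ∧
      z.length ≤ y.length ∧ ((∃ a ∈ y, a.2 = 0) → z.length < y.length) := by
  induction y with
  | nil => exact ⟨[], trivial, by simp, rfl, le_rfl, by simp⟩
  | cons a y ih =>
    obtain ⟨v, e⟩ := a
    obtain ⟨z, h₁, h₂, h₃, h₄, h₅⟩ := ih
    rcases Nat.eq_zero_or_pos e with rfl | he
    · refine ⟨z, h₁, h₂, by rw [mono_cons, pow_zero, one_mul, h₃], ?_, fun _ => ?_⟩ <;>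
      · rw [List.length_cons]
        omega
    · by_cases hb : Blocked Γ v (z.map Prod.fst)
      · refine ⟨(v, e) :: z, ⟨hb, h₁⟩, List.forall_mem_cons.2 ⟨he, h₂⟩,
          by rw [mono_cons, mono_cons, h₃], by simpa using h₄, ?_⟩
        rintro ⟨b, hb, hb0⟩
        rcases List.mem_cons.1 hb with rfl | hb
        · exact absurd hb0 he.ne'
        · simpa using h₅ ⟨b, hb, hb0⟩
      · obtain ⟨z', k₁, k₂, k₃⟩ := exists_mono_eq_pow_mul e h₂ hb
        have hl : z'.length = z.length := by simpa using congrArg List.length k₁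
        refine ⟨z', k₁ ▸ h₁, k₂, by rw [mono_cons, k₃, h₃], ?_, fun _ => ?_⟩ <;>
        · rw [List.length_cons]
          omega

theorem SameProj.of_eq {m m' : Mon Γ} (h : m = m') : SameProj m m' := fun _ _ _ => by rw [h]

/-- A reduced word with positive exponents is a shortest word for its monomial, and all the shortest
words have positive exponents. -/
theorem length_le_of_mono_eq {x y : List (V × ℕ)} (hx : ∀ a ∈ x, 0 < a.2)
    (hr : Rigid Γ (x.map Prod.fst)) (h : mono Γ x = mono Γ y) :
    x.length ≤ y.length ∧ (x.length = y.length → ∀ a ∈ y, 0 < a.2) := by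
  obtain ⟨z, h₁, h₂, h₃, h₄, h₅⟩ := exists_rigid_mono_eq (Γ := Γ) y
  have hs := (shuffle_of_sameProj hx hr h₂ h₁ (.of_eq (h.trans h₃.symm))).perm.length_eq
  refine ⟨by omega, fun hl a ha => Nat.pos_of_ne_zero fun h0 => ?_⟩
  have := h₅ ⟨a, ha, h0⟩
  omega

end Words

end Raag

/-! ### Polynomials in partially commuting variables -/

namespace Raag

section Polynomials

variable (k : Type*) [CommRing k] {V : Type*} (Γ : SimpleGraph V)

/-- The degree of a monomial, as a natural number. -/
def deg (m : Mon Γ) : ℕ := (monDeg Γ m).toAdd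

theorem deg_mul (m m' : Mon Γ) : deg Γ (m * m') = deg Γ m + deg Γ m' := by
  rw [deg, map_mul, toAdd_mul, deg, deg]

theorem deg_var (v : V) : deg Γ (monVar Γ v) = 1 := rfl

theorem deg_one : deg Γ 1 = 0 := by rw [deg, map_one, toAdd_one]

theorem deg_pow (m : Mon Γ) (n : ℕ) : deg Γ (m ^ n) = n * deg Γ m := by
  rw [deg, map_pow, toAdd_pow, smul_eq_mul, deg]

/-- A monomial, as an element of the algebra of polynomials. -/
noncomputable def monoPoly : Mon Γ →* Poly k Γ :=
  PresentedMonoid.lift (X k Γ) (by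
    rintro _ _ ⟨v, w, h, rfl, rfl⟩
    simp [X_comm k Γ h])

theorem monoPoly_var (v : V) : monoPoly k Γ (monVar Γ v) = X k Γ v := rfl

/-- The polynomials are the linear combinations of the monomials. -/
noncomputable def expandEquiv : Poly k Γ ≃ₐ[k] MonoidAlgebra k (Mon Γ) :=
  AlgEquiv.ofAlgHom (expand k Γ) (MonoidAlgebra.lift k (Poly k Γ) (Mon Γ) (monoPoly k Γ))
    (by
      apply (MonoidAlgebra.lift k (MonoidAlgebra k (Mon Γ)) (Mon Γ)).symm.injective
      apply PresentedMonoid.ext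
      intro v
      change expand k Γ (MonoidAlgebra.lift k _ _ _ (MonoidAlgebra.of k _ (monVar Γ v))) =
        MonoidAlgebra.of k _ (monVar Γ v)
      rw [MonoidAlgebra.lift_of, monoPoly_var, expand, polyLift_X])
    (poly_hom_ext fun v => by
      rw [AlgHom.comp_apply, expand, polyLift_X, MonoidAlgebra.lift_of, monoPoly_var]
      rfl)

theorem expandEquiv_apply (r : Poly k Γ) : expandEquiv k Γ r = expand k Γ r := rfl

theorem expandEquiv_symm_single (m : Mon Γ) (c : k) :
    (expandEquiv k Γ).symm (MonoidAlgebra.single m c) = c • monoPoly k Γ m :=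
  MonoidAlgebra.lift_single _ _ _

theorem expand_monoPoly (m : Mon Γ) : expand k Γ (monoPoly k Γ m) = MonoidAlgebra.single m 1 := by
  rw [← expandEquiv_apply, ← AlgEquiv.eq_symm_apply, expandEquiv_symm_single, one_smul]

theorem polyCoeff_apply (m : Mon Γ) (r : Poly k Γ) :
    polyCoeff k Γ m r = (expand k Γ r).coeff m := rfl

theorem polyCoeff_monoPoly_self (m : Mon Γ) : polyCoeff k Γ m (monoPoly k Γ m) = 1 := by
  rw [polyCoeff_apply, expand_monoPoly, MonoidAlgebra.coeff_single, Finsupp.single_eq_same]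

theorem polyCoeff_monoPoly_of_ne {m m' : Mon Γ} (h : m ≠ m') :
    polyCoeff k Γ m (monoPoly k Γ m') = 0 := by
  rw [polyCoeff_apply, expand_monoPoly, MonoidAlgebra.coeff_single, Finsupp.single_eq_of_ne h]

variable {k Γ} in
theorem poly_ext {r s : Poly k Γ} (h : ∀ m, polyCoeff k Γ m r = polyCoeff k Γ m s) : r = s :=
  (expandEquiv k Γ).injective (MonoidAlgebra.ext (Finsupp.ext h))

theorem eq_sum_monoPoly (r : Poly k Γ) :
    r = (expand k Γ r).coeff.sum fun m c => c • monoPoly k Γ m := by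
  have h := (expandEquiv k Γ).symm_apply_apply r
  rw [expandEquiv_apply] at h
  exact h.symm.trans (MonoidAlgebra.lift_apply _ _)

variable {k Γ} in
theorem poly_induction {p : Poly k Γ → Prop} (hz : p 0) (ha : ∀ r s, p r → p s → p (r + s))
    (hm : ∀ (c : k) m, p (c • monoPoly k Γ m)) (r : Poly k Γ) : p r := by
  rw [eq_sum_monoPoly k Γ r]
  exact Finset.sum_induction _ p ha hz fun m _ => hm _ m

variable {k Γ} in
/-- A polynomial is in a submodule if the monomials with non-zero coefficient are. -/
theorem mem_of_monoPoly_mem {S : Submodule k (Poly k Γ)} {r : Poly k Γ}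
    (h : ∀ m, polyCoeff k Γ m r ≠ 0 → monoPoly k Γ m ∈ S) : r ∈ S := by
  rw [eq_sum_monoPoly k Γ r]
  exact S.sum_mem fun m hm => S.smul_mem _ (h m (Finsupp.mem_support_iff.1 hm))

theorem exists_list_eq (m : Mon Γ) :
    ∃ l : List V, l.length = deg Γ m ∧ monoPoly k Γ m = (l.map (X k Γ)).prod := by
  induction m using PresentedMonoid.inductionOn with
  | h a =>
    induction a using FreeMonoid.inductionOn' with
    | one => exact ⟨[], (deg_one Γ).symm, map_one _⟩
    | of_mul v b ih =>
      obtain ⟨l, hl, hp⟩ := ih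
      refine ⟨v :: l, ?_, ?_⟩
      · rw [map_mul, deg_mul, ← hl, List.length_cons, add_comm]
        rfl
      · rw [map_mul, map_mul, hp, List.map_cons, List.prod_cons]
        rfl

theorem list_prod_eq_monoPoly (l : List V) :
    ∃ m, deg Γ m = l.length ∧ (l.map (X k Γ)).prod = monoPoly k Γ m := by
  induction l with
  | nil => exact ⟨1, deg_one Γ, (map_one _).symm⟩
  | cons v l ih =>
    obtain ⟨m, hm, hp⟩ := ih
    exact ⟨monVar Γ v * m, by rw [deg_mul, hm, deg_var, List.length_cons, add_comm],
      by rw [map_mul, ← hp, List.map_cons, List.prod_cons, monoPoly_var]⟩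

theorem monoPoly_mem_homog (m : Mon Γ) : monoPoly k Γ m ∈ polyHomog k Γ (deg Γ m) := by
  obtain ⟨l, hl, hp⟩ := exists_list_eq k Γ m
  exact Submodule.subset_span ⟨l, hl, hp⟩

variable {k Γ} in
/-- Products of `n` elements of an ideal that are indexed by letters lie in its `n`-th power. -/
theorem list_prod_mem_pow {B : Type*} [Ring B] {J : Ideal B} [J.IsTwoSided] {f : V → B}
    (hf : ∀ v, f v ∈ J) (l : List V) : (l.map f).prod ∈ J ^ l.length := by
  induction l with
  | nil => simp [Submodule.pow_zero, Ideal.one_eq_top]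
  | cons v l ih =>
    rw [List.map_cons, List.prod_cons, List.length_cons, Ideal.IsTwoSided.pow_succ]
    exact Ideal.mul_mem_mul (hf v) ih

theorem monoPoly_mem_pow {m : Mon Γ} {n : ℕ} (h : n ≤ deg Γ m) :
    monoPoly k Γ m ∈ polyIdeal k Γ ^ n := by
  obtain ⟨l, hl, hp⟩ := exists_list_eq k Γ m
  rw [hp]
  exact Ideal.pow_le_pow_right (hl ▸ h) (list_prod_mem_pow (X_mem k Γ) l)

variable {k Γ}

theorem mem_polyIdeal_pow_iff {n : ℕ} {r : Poly k Γ} :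
    r ∈ polyIdeal k Γ ^ n ↔ ∀ m, deg Γ m < n → polyCoeff k Γ m r = 0 := by
  refine ⟨fun h m hm => coeff_eq_zero_of_mem_pow k Γ hm h, fun h => ?_⟩
  refine mem_of_monoPoly_mem (S := Adic.powSub k (polyIdeal k Γ) n) fun m hm => ?_
  exact monoPoly_mem_pow k Γ (not_lt.1 fun hlt => hm (h m hlt))

theorem mem_polyHomog_iff {n : ℕ} {r : Poly k Γ} :
    r ∈ polyHomog k Γ n ↔ ∀ m, deg Γ m ≠ n → polyCoeff k Γ m r = 0 := by
  refine ⟨fun h m hm => ?_, fun h => ?_⟩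
  · induction h using Submodule.span_induction with
    | mem x hx =>
      obtain ⟨l, hl, rfl⟩ := hx
      obtain ⟨m', hm', e⟩ := list_prod_eq_monoPoly k Γ l
      rw [e, polyCoeff_monoPoly_of_ne]
      rintro rfl
      exact hm (hm'.trans hl)
    | zero => exact map_zero _
    | add x y _ _ ex ey => rw [map_add, ex, ey, add_zero]
    | smul c x _ ex => rw [map_smul, ex, smul_zero]
  · refine mem_of_monoPoly_mem fun m hm => ?_
    obtain rfl : deg Γ m = n := by_contra fun hne => hm (h m hne)
    exact monoPoly_mem_homog k Γ m

theorem mem_polyLT_iff {n : ℕ} {r : Poly k Γ} :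
    r ∈ polyLT k Γ n ↔ ∀ m, n ≤ deg Γ m → polyCoeff k Γ m r = 0 := by
  refine ⟨fun h m hm => ?_, fun h => ?_⟩
  · have hle : polyLT k Γ n ≤ LinearMap.ker (polyCoeff k Γ m) := iSup_le fun i r hr =>
      mem_polyHomog_iff.1 hr m (i.2.trans_le hm).ne'
    exact hle h
  · refine mem_of_monoPoly_mem fun m hm => ?_
    have hlt : deg Γ m < n := not_le.1 fun hle => hm (h m hle)
    exact le_iSup (fun i : Fin n => polyHomog k Γ i) ⟨_, hlt⟩ (monoPoly_mem_homog k Γ m)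

open Classical in
variable (k Γ) in
/-- The part of a polynomial that consists of the terms whose monomials satisfy `P`. -/
noncomputable def polyPart (P : Mon Γ → Prop) : Poly k Γ →ₗ[k] Poly k Γ where
  toFun r := (expandEquiv k Γ).symm (.ofCoeff ((expand k Γ r).coeff.filter P))
  map_add' r s := by
    rw [map_add, MonoidAlgebra.coeff_add, Finsupp.filter_add, MonoidAlgebra.ofCoeff_add, map_add]
  map_smul' c r := by
    rw [map_smul, MonoidAlgebra.coeff_smul, Finsupp.filter_smul, MonoidAlgebra.ofCoeff_smul,
      map_smul, RingHom.id_apply]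

open Classical in
theorem polyCoeff_polyPart (P : Mon Γ → Prop) (m : Mon Γ) (r : Poly k Γ) :
    polyCoeff k Γ m (polyPart k Γ P r) = if P m then polyCoeff k Γ m r else 0 := by
  rw [polyCoeff_apply, ← expandEquiv_apply, polyPart]
  change ((expandEquiv k Γ) ((expandEquiv k Γ).symm _)).coeff m = _
  rw [AlgEquiv.apply_symm_apply, MonoidAlgebra.coeff_ofCoeff, Finsupp.filter_apply]
  rfl

variable (k Γ) in
/-- The homogeneous component of degree `n` of a polynomial. -/
noncomputable def homogPart (n : ℕ) : Poly k Γ →ₗ[k] Poly k Γ :=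
  polyPart k Γ fun m => deg Γ m = n

theorem homogPart_mem (n : ℕ) (r : Poly k Γ) : homogPart k Γ n r ∈ polyHomog k Γ n :=
  mem_polyHomog_iff.2 fun m hm => by
    rw [homogPart, polyCoeff_polyPart, if_neg hm]

theorem polyCoeff_homogPart {n : ℕ} {m : Mon Γ} (h : deg Γ m = n) (r : Poly k Γ) :
    polyCoeff k Γ m (homogPart k Γ n r) = polyCoeff k Γ m r := by
  rw [homogPart, polyCoeff_polyPart, if_pos h]

theorem mem_pow_of_mem_polyHomog {n : ℕ} {r : Poly k Γ} (h : r ∈ polyHomog k Γ n) :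
    r ∈ polyIdeal k Γ ^ n :=
  mem_polyIdeal_pow_iff.2 fun m hm => mem_polyHomog_iff.1 h m hm.ne

theorem homogPart_of_mem {n : ℕ} {r : Poly k Γ} (h : r ∈ polyHomog k Γ n) :
    homogPart k Γ n r = r := poly_ext fun m => by
  by_cases hm : deg Γ m = n
  · exact polyCoeff_homogPart hm r
  · rw [mem_polyHomog_iff.1 h m hm, mem_polyHomog_iff.1 (homogPart_mem n r) m hm]

theorem homogPart_of_mem_of_ne {n i : ℕ} {r : Poly k Γ} (h : r ∈ polyHomog k Γ n) (hi : n ≠ i) :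
    homogPart k Γ i r = 0 := poly_ext fun m => by
  rw [map_zero]
  by_cases hm : deg Γ m = i
  · rw [polyCoeff_homogPart hm, mem_polyHomog_iff.1 h m (fun e => hi (e.symm.trans hm))]
  · exact mem_polyHomog_iff.1 (homogPart_mem i r) m hm

theorem sub_homogPart_mem {n : ℕ} {r : Poly k Γ} (h : r ∈ polyIdeal k Γ ^ n) :
    r - homogPart k Γ n r ∈ polyIdeal k Γ ^ (n + 1) :=
  mem_polyIdeal_pow_iff.2 fun m hm => by
    rw [map_sub]
    rcases (Nat.lt_succ_iff.1 hm).lt_or_eq with hlt | heq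
    · rw [mem_polyIdeal_pow_iff.1 h m hlt, mem_polyHomog_iff.1 (homogPart_mem n r) m hlt.ne,
        sub_zero]
    · rw [polyCoeff_homogPart heq, sub_self]

theorem mem_polyIdeal_pow_iff_homogPart {n : ℕ} {r : Poly k Γ} :
    r ∈ polyIdeal k Γ ^ n ↔ ∀ i < n, homogPart k Γ i r = 0 := by
  refine ⟨fun h i hi => poly_ext fun m => ?_, fun h => mem_polyIdeal_pow_iff.2 fun m hm => ?_⟩
  · rw [map_zero]
    by_cases hm : deg Γ m = i
    · rw [polyCoeff_homogPart hm, mem_polyIdeal_pow_iff.1 h m (hm ▸ hi)]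
    · exact mem_polyHomog_iff.1 (homogPart_mem i r) m hm
  · rw [← polyCoeff_homogPart rfl r, h _ hm, map_zero]

/-- A homogeneous polynomial of degree `n` that lies in `ϖ ^ (n + 1)` is zero. -/
theorem eq_zero_of_mem_polyHomog {n : ℕ} {r : Poly k Γ} (h : r ∈ polyHomog k Γ n)
    (h' : r ∈ polyIdeal k Γ ^ (n + 1)) : r = 0 := by
  rw [← homogPart_of_mem h]
  exact mem_polyIdeal_pow_iff_homogPart.1 h' n (Nat.lt_succ_self n)

variable (k Γ) in
/-- The polynomials of degree less than `n` represent the classes modulo `ϖ ^ n`. -/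
noncomputable def polyLTEquiv (n : ℕ) :
    polyLT k Γ n ≃ₗ[k] (Poly k Γ ⧸ polyIdeal k Γ ^ n) :=
  LinearEquiv.ofBijective
    ((Ideal.Quotient.mkₐ k (polyIdeal k Γ ^ n)).toLinearMap ∘ₗ (polyLT k Γ n).subtype) (by
    constructor
    · rw [injective_iff_map_eq_zero]
      intro r hr
      have hr' := Ideal.Quotient.eq_zero_iff_mem.1 hr
      refine Subtype.ext (poly_ext fun m => ?_)
      rw [ZeroMemClass.coe_zero, map_zero]
      rcases lt_or_ge (deg Γ m) n with h | h
      · exact mem_polyIdeal_pow_iff.1 hr' m h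
      · exact mem_polyLT_iff.1 r.2 m h
    · intro x
      obtain ⟨r, rfl⟩ := Ideal.Quotient.mk_surjective x
      refine ⟨⟨polyPart k Γ (fun m => deg Γ m < n) r, mem_polyLT_iff.2 fun m hm => ?_⟩,
        Ideal.Quotient.eq.2 (mem_polyIdeal_pow_iff.2 fun m hm => ?_)⟩
      · rw [polyCoeff_polyPart, if_neg hm.not_gt]
      · rw [map_sub, Submodule.subtype_apply, polyCoeff_polyPart, if_pos hm, sub_self])

end Polynomials

end Raag

/-! ### Associated graded algebras -/

namespace Adic

section

variable (k : Type*) {A : Type*} [CommRing k] [Ring A] [Algebra k A] (I : Ideal A) [I.IsTwoSided]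

theorem symbol_mul {m n : ℕ} {a b : A} (ha : a ∈ I ^ m) (hb : b ∈ I ^ n)
    (hab : a * b ∈ I ^ (m + n)) :
    symbol k I m a ha * symbol k I n b hb = symbol k I (m + n) (a * b) hab :=
  DirectSum.of_mul_of _ _

theorem symbol_congr {m n : ℕ} (h : m = n) {a b : A} (ha : a ∈ I ^ m) (hb : b ∈ I ^ n)
    (hab : a - b ∈ I ^ (n + 1)) : symbol k I m a ha = symbol k I n b hb := by
  subst h
  exact congrArg _ ((grMk_eq_iff k I).2 hab)

theorem symbol_add {n : ℕ} {a b : A} (ha : a ∈ I ^ n) (hb : b ∈ I ^ n) :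
    symbol k I n (a + b) (add_mem ha hb) = symbol k I n a ha + symbol k I n b hb := by
  rw [symbol, symbol, symbol, ← map_add]
  rfl

theorem symbol_eq_zero {n : ℕ} {a : A} (ha : a ∈ I ^ n) (h : a ∈ I ^ (n + 1)) :
    symbol k I n a ha = 0 := by
  rw [symbol, ← map_zero (DirectSum.of (GrPiece k I) n), ← map_zero (grMk k I n)]
  exact congrArg _ ((grMk_eq_iff k I).2 (by simpa using h))

theorem symbol_zero_one (h : (1 : A) ∈ I ^ 0) : symbol k I 0 1 h = 1 :=
  congrArg (DirectSum.of (GrPiece k I) 0) (congrArg (grMk k I 0) (Subtype.ext (map_one _).symm))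

theorem smul_symbol {n : ℕ} (c : k) {a : A} (ha : a ∈ I ^ n) (hca : c • a ∈ I ^ n) :
    c • symbol k I n a ha = symbol k I n (c • a) hca :=
  ((DirectSum.lof k ℕ (GrPiece k I) n).map_smul c _).symm

theorem symbol_apply_same {n : ℕ} {a : A} (ha : a ∈ I ^ n) :
    symbol k I n a ha n = grMk k I n ⟨a, ha⟩ := DirectSum.of_eq_same _ _

theorem symbol_apply_of_ne {n i : ℕ} {a : A} (ha : a ∈ I ^ n) (h : n ≠ i) :
    symbol k I n a ha i = 0 := DirectSum.of_eq_of_ne _ _ _ h.symm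

theorem gr_symbol_induction {p : Gr k I → Prop} (hz : p 0)
    (hs : ∀ n a (ha : a ∈ I ^ n), p (symbol k I n a ha)) (ha : ∀ x y, p x → p y → p (x + y))
    (x : Gr k I) : p x := by
  refine DirectSum.induction_on (motive := p) x hz (fun n y => ?_) ha
  obtain ⟨a, rfl⟩ := grMk_surjective y
  exact hs n a a.2

/-- The elements of the associated graded algebra with terms in degrees less than `n` only represent
the classes modulo the ideal of elements without such terms. -/
noncomputable def grLTEquiv (n : ℕ) : grLT k I n ≃ₗ[k] (Gr k I ⧸ grGE k I n) :=
  LinearEquiv.ofBijective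
    ((Ideal.Quotient.mkₐ k (grGE k I n)).toLinearMap ∘ₗ (grLT k I n).subtype) (by
    constructor
    · rw [injective_iff_map_eq_zero]
      intro x hx
      have hx' : (x : Gr k I) ∈ grGE k I n := Ideal.Quotient.eq_zero_iff_mem.1 hx
      refine Subtype.ext (DFinsupp.ext fun i => ?_)
      rcases lt_or_ge i n with h | h
      · exact hx' i h
      · exact x.2 i h
    · intro x
      obtain ⟨y, rfl⟩ := Ideal.Quotient.mk_surjective x
      refine ⟨⟨DFinsupp.filter (· < n) y, fun i hi => ?_⟩, Ideal.Quotient.eq.2 fun i hi => ?_⟩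
      · exact (DFinsupp.filter_apply ..).trans (if_neg hi.not_gt)
      · change DFinsupp.filter (· < n) y i - y i = 0
        rw [DFinsupp.filter_apply, if_pos hi, sub_self])

end

end Adic

namespace Raag

section Symbols

variable {k : Type*} [CommRing k] {V : Type*} {Γ : SimpleGraph V}
  {B : Type*} [Ring B] [Algebra k B] {J : Ideal B} [J.IsTwoSided] (ν : Poly k Γ →ₐ[k] B)

theorem map_mem_pow (h1 : ∀ v, ν (X k Γ v) ∈ J) {n : ℕ} {r : Poly k Γ}
    (hr : r ∈ polyIdeal k Γ ^ n) : ν r ∈ J ^ n := by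
  have h : r ∈ ((J ^ n).restrictScalars k).comap ν.toLinearMap := by
    refine mem_of_monoPoly_mem fun m hm => ?_
    obtain ⟨l, hl, hp⟩ := exists_list_eq k Γ m
    have hn : n ≤ deg Γ m := not_lt.1 fun hlt => hm (mem_polyIdeal_pow_iff.1 hr m hlt)
    change ν _ ∈ J ^ n
    rw [hp, map_list_prod, List.map_map]
    exact Ideal.pow_le_pow_right (hl ▸ hn) (list_prod_mem_pow h1 l)
  exact h

/-- The homomorphism `v ↦ [ν v]` from the polynomials to the associated graded algebra of an ideal
that contains the images `ν v` of the variables. -/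
noncomputable def symbolHom (h1 : ∀ v, ν (X k Γ v) ∈ J) : Poly k Γ →ₐ[k] Adic.Gr k J :=
  polyLift k Γ (fun v => Adic.symbol k J 1 (ν (X k Γ v)) (by
      rw [Submodule.pow_one]
      exact h1 v)) fun v w h => by
    have h1' : ∀ v, ν (X k Γ v) ∈ J ^ 1 := by simpa only [Submodule.pow_one] using h1
    have hm : ∀ v w, ν (X k Γ v) * ν (X k Γ w) ∈ J ^ (1 + 1) := fun v w => by
      rw [Ideal.IsTwoSided.pow_add]
      exact Ideal.mul_mem_mul (h1' v) (h1' w)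
    rw [Adic.symbol_mul k J _ _ (hm v w), Adic.symbol_mul k J _ _ (hm w v)]
    refine Adic.symbol_congr k J rfl _ _ ?_
    rw [← map_mul, ← map_mul, X_comm k Γ h, sub_self]
    exact zero_mem _

variable (h1 : ∀ v, ν (X k Γ v) ∈ J)

theorem symbolHom_X (v : V) (hv : ν (X k Γ v) ∈ J ^ 1) :
    symbolHom ν h1 (X k Γ v) = Adic.symbol k J 1 (ν (X k Γ v)) hv := polyLift_X k Γ _ _ v

theorem symbolHom_monoPoly (m : Mon Γ) (hm : ν (monoPoly k Γ m) ∈ J ^ deg Γ m) :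
    symbolHom ν h1 (monoPoly k Γ m) = Adic.symbol k J (deg Γ m) (ν (monoPoly k Γ m)) hm := by
  obtain ⟨l, hl, hp⟩ := exists_list_eq k Γ m
  revert hm
  rw [hp, ← hl]
  intro hm
  clear hp hl m
  induction l with
  | nil =>
    simp only [List.map_nil, List.prod_nil, map_one, List.length_nil]
    exact (Adic.symbol_zero_one k J _).symm
  | cons v l ih =>
    have hl : ν (l.map (X k Γ)).prod ∈ J ^ l.length := by
      rw [map_list_prod, List.map_map]
      exact list_prod_mem_pow h1 l
    have hv : ν (X k Γ v) ∈ J ^ 1 := by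
      rw [Submodule.pow_one]
      exact h1 v
    have hvl : ν (X k Γ v) * ν (l.map (X k Γ)).prod ∈ J ^ (1 + l.length) := by
      rw [Ideal.IsTwoSided.pow_add]
      exact Ideal.mul_mem_mul hv hl
    trans symbolHom ν h1 (X k Γ v) * symbolHom ν h1 (l.map (X k Γ)).prod
    · rw [← map_mul, List.map_cons, List.prod_cons]
    rw [ih hl, symbolHom_X ν h1 v hv, Adic.symbol_mul k J hv hl hvl]
    refine Adic.symbol_congr k J (add_comm _ _) _ _ ?_
    rw [List.map_cons, List.prod_cons, map_mul, sub_self]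
    exact zero_mem _

theorem symbolHom_of_mem_polyHomog {n : ℕ} {r : Poly k Γ} (hr : r ∈ polyHomog k Γ n)
    (hn : ν r ∈ J ^ n) : symbolHom ν h1 r = Adic.symbol k J n (ν r) hn := by
  induction hr using Submodule.span_induction with
  | mem x hx =>
    obtain ⟨l, rfl, rfl⟩ := hx
    obtain ⟨m, hm, e⟩ := list_prod_eq_monoPoly k Γ l
    revert hn
    rw [e, ← hm]
    exact symbolHom_monoPoly ν h1 m
  | zero =>
    rw [map_zero]
    exact (Adic.symbol_eq_zero k J hn (by rw [map_zero]; exact zero_mem _)).symm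
  | add x y hx hy ex ey =>
    have hx' := map_mem_pow ν h1 (mem_pow_of_mem_polyHomog hx)
    have hy' := map_mem_pow ν h1 (mem_pow_of_mem_polyHomog hy)
    rw [map_add, ex hx', ey hy', ← Adic.symbol_add]
    exact Adic.symbol_congr k J rfl _ _ (by rw [map_add, sub_self]; exact zero_mem _)
  | smul c x hx ex =>
    have hx' := map_mem_pow ν h1 (mem_pow_of_mem_polyHomog hx)
    revert hn
    rw [map_smul, map_smul, ex hx']
    exact Adic.smul_symbol k J c hx'

theorem symbolHom_apply (r : Poly k Γ) (n : ℕ) :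
    symbolHom ν h1 r n = Adic.grMk k J n
      ⟨ν (homogPart k Γ n r), map_mem_pow ν h1 (mem_pow_of_mem_polyHomog (homogPart_mem n r))⟩ := by
  induction r using poly_induction with
  | hz =>
    rw [map_zero, DirectSum.zero_apply, ← map_zero (Adic.grMk k J n)]
    exact congrArg _ (Subtype.ext (by simp))
  | ha r s hr hs =>
    rw [map_add, DirectSum.add_apply, hr, hs, ← map_add]
    exact congrArg _ (Subtype.ext (by simp))
  | hm c m =>
    have hm := Submodule.smul_mem _ c (monoPoly_mem_homog k Γ m)
    rw [symbolHom_of_mem_polyHomog ν h1 hm (map_mem_pow ν h1 (mem_pow_of_mem_polyHomog hm))]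
    by_cases hn : deg Γ m = n
    · subst hn
      rw [Adic.symbol_apply_same]
      exact congrArg _ (Subtype.ext (congrArg ν (homogPart_of_mem hm).symm))
    · rw [Adic.symbol_apply_of_ne k J _ hn, ← map_zero (Adic.grMk k J n)]
      refine congrArg _ (Subtype.ext ?_)
      exact (map_zero ν).symm.trans (congrArg ν (homogPart_of_mem_of_ne hm hn).symm)

theorem symbolHom_mem_grGE (h2 : ∀ n r, ν r ∈ J ^ n → r ∈ polyIdeal k Γ ^ n) {n : ℕ}
    {r : Poly k Γ} : symbolHom ν h1 r ∈ Adic.grGE k J n ↔ r ∈ polyIdeal k Γ ^ n := by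
  rw [mem_polyIdeal_pow_iff_homogPart]
  refine forall₂_congr fun i _ => ?_
  rw [symbolHom_apply, ← map_zero (Adic.grMk k J i), Adic.grMk_eq_iff]
  rw [ZeroMemClass.coe_zero, sub_zero]
  refine ⟨fun h => eq_zero_of_mem_polyHomog (homogPart_mem i r) (h2 _ _ h), fun h => ?_⟩
  change ν _ ∈ _
  rw [h, map_zero]
  exact zero_mem _

/-- If `ν` induces isomorphisms modulo the powers of the ideals, then the polynomials are isomorphic
to the associated graded algebra. -/
noncomputable def symbolEquiv (h2 : ∀ n r, ν r ∈ J ^ n → r ∈ polyIdeal k Γ ^ n)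
    (h3 : ∀ n b, ∃ r, b - ν r ∈ J ^ n) : Poly k Γ ≃ₐ[k] Adic.Gr k J :=
  AlgEquiv.ofBijective (symbolHom ν h1) (by
    constructor
    · rw [injective_iff_map_eq_zero]
      intro r hr
      refine poly_ext fun m => ?_
      rw [map_zero]
      refine mem_polyIdeal_pow_iff.1 ((symbolHom_mem_grGE ν h1 h2).1 ?_) m (Nat.lt_succ_self _)
      rw [hr]
      exact zero_mem _
    · intro x
      induction x using Adic.gr_symbol_induction with
      | hz => exact ⟨0, map_zero _⟩
      | ha x y hx hy =>
        obtain ⟨r, rfl⟩ := hx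
        obtain ⟨s, rfl⟩ := hy
        exact ⟨r + s, map_add _ _ _⟩
      | hs n b hb =>
        obtain ⟨r, hr⟩ := h3 (n + 1) b
        have hνr : ν r ∈ J ^ n := by
          have h := sub_mem hb (Ideal.pow_le_pow_right (Nat.le_succ n) hr)
          rwa [sub_sub_cancel] at h
        have hh := homogPart_mem n r
        refine ⟨homogPart k Γ n r, ?_⟩
        rw [symbolHom_of_mem_polyHomog ν h1 hh (map_mem_pow ν h1 (mem_pow_of_mem_polyHomog hh))]
        refine Adic.symbol_congr k J rfl _ _ ?_
        have h := map_mem_pow ν h1 (sub_homogPart_mem (h2 n r hνr))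
        have h' := neg_mem (add_mem hr h)
        rw [map_sub] at h'
        simpa using h')

end Symbols

end Raag

/-! ### Binomial series -/

section Binomial

variable (k : Type*) [CommRing k]

/-- In characteristic `p`, `(1 + X) ^ (p ^ s * c) = 1 + c X ^ (p ^ s)` up to terms of higher degree;
this holds for negative exponents too. -/
theorem X_pow_dvd_binomialSeries_sub (p : ℕ) [Fact p.Prime] [CharP k p] (s : ℕ) (c : ℤ) :
    (PowerSeries.X : PowerSeries k) ^ (p ^ s + 1) ∣
      PowerSeries.binomialSeries k ((p ^ s : ℕ) * c : ℤ) -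
        (1 + (c : PowerSeries k) * PowerSeries.X ^ p ^ s) := by
  have hq : 0 < p ^ s := pow_pos (Nat.Prime.pos Fact.out) s
  have hb : PowerSeries.binomialSeries k (((p ^ s : ℕ) : ℤ)) =
      1 + (PowerSeries.X : PowerSeries k) ^ p ^ s := by
    rw [PowerSeries.binomialSeries_nat]
    have h := congrArg (fun f : Polynomial k => (f : PowerSeries k))
      (add_pow_char_pow (p := p) (n := s) (1 : Polynomial k) Polynomial.X)
    simpa using h
  have hX : (PowerSeries.X : PowerSeries k) ^ (p ^ s + 1) ∣
      PowerSeries.X ^ p ^ s * PowerSeries.X ^ p ^ s := by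
    rw [← pow_add]
    exact pow_dvd_pow _ (by omega)
  induction c using Int.induction_on with
  | zero => simp
  | succ i ih =>
    rw [mul_add, mul_one, PowerSeries.binomialSeries_add, hb]
    have h := dvd_add (ih.mul_right (1 + PowerSeries.X ^ p ^ s)) (hX.mul_left (i : PowerSeries k))
    convert h using 1
    push_cast
    ring
  | pred i ih =>
    -- multiplication by the inverse of `1 + X ^ q`, which is `1 - X ^ q` up to higher terms
    have hinv : PowerSeries.binomialSeries k ((p ^ s : ℕ) * (-(i : ℤ) - 1) : ℤ) *
        (1 + PowerSeries.X ^ p ^ s) =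
          PowerSeries.binomialSeries k ((p ^ s : ℕ) * (-(i : ℤ)) : ℤ) := by
      rw [← hb, ← PowerSeries.binomialSeries_add]
      congr 1
      ring
    rw [← hinv] at ih
    have h := dvd_add (ih.mul_right (1 - PowerSeries.X ^ p ^ s)) (hX.mul_left
      (PowerSeries.binomialSeries k ((p ^ s : ℕ) * (-(i : ℤ) - 1) : ℤ) + (i : PowerSeries k)))
    convert h using 1
    push_cast
    ring

variable {k}

theorem cast_choose_eq_zero (p : ℕ) [Fact p.Prime] [CharP k p] {s : ℕ} {e : ℤ}
    (he : (p : ℤ) ^ s ∣ e) {j : ℕ} (hj : 0 < j) (hjs : j < p ^ s) :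
    ((Ring.choose e j : ℤ) : k) = 0 := by
  obtain ⟨c, rfl⟩ := he
  have h := PowerSeries.X_pow_dvd_iff.1 (X_pow_dvd_binomialSeries_sub k p s c) j (by omega)
  rw [map_sub, map_add, PowerSeries.binomialSeries_coeff, PowerSeries.coeff_one, if_neg hj.ne',
    ← map_intCast (PowerSeries.C (R := k)), PowerSeries.coeff_C_mul, PowerSeries.coeff_X_pow,
    if_neg hjs.ne] at h
  simpa using h

theorem cast_choose_prime_pow (p : ℕ) [Fact p.Prime] [CharP k p] {s : ℕ} {e : ℤ}
    (he : (p : ℤ) ^ s ∣ e) :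
    ((Ring.choose e (p ^ s) : ℤ) : k) = ((e / (p : ℤ) ^ s : ℤ) : k) := by
  obtain ⟨c, rfl⟩ := he
  have hp : 0 < p := Nat.Prime.pos Fact.out
  have h := PowerSeries.X_pow_dvd_iff.1 (X_pow_dvd_binomialSeries_sub k p s c) (p ^ s) (by omega)
  rw [map_sub, map_add, PowerSeries.binomialSeries_coeff, PowerSeries.coeff_one,
    if_neg (pow_pos hp s).ne', ← map_intCast (PowerSeries.C (R := k)), PowerSeries.coeff_C_mul,
    PowerSeries.coeff_X_pow, if_pos rfl] at h
  rw [Int.mul_ediv_cancel_left _ (pow_ne_zero _ (Int.natCast_ne_zero.2 hp.ne'))]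
  simpa [sub_eq_zero] using h

theorem not_dvd_ediv_pow_padicValInt (p : ℕ) [Fact p.Prime] {e : ℤ} (he : e ≠ 0) :
    ¬ (p : ℤ) ∣ e / (p : ℤ) ^ padicValInt p e := by
  intro h
  have h2 := mul_dvd_mul_left ((p : ℤ) ^ padicValInt p e) h
  rw [Int.mul_ediv_cancel' (padicValInt_dvd e), ← pow_succ, padicValInt_dvd_iff] at h2
  rcases h2 with h2 | h2
  · exact he h2
  · omega

/-- Over a field, some coefficient of positive degree of `(1 + X) ^ e` does not vanish if
`e ≠ 0`. -/
theorem exists_choose_ne_zero (K : Type*) [Field K] {e : ℤ} (he : e ≠ 0) :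
    ∃ j, 0 < j ∧ ((Ring.choose e j : ℤ) : K) ≠ 0 := by
  obtain ⟨p, hp⟩ := CharP.exists K
  rcases CharP.char_is_prime_or_zero K p with hprime | rfl
  · have : Fact p.Prime := ⟨hprime⟩
    refine ⟨p ^ padicValInt p e, pow_pos hprime.pos _, ?_⟩
    rw [cast_choose_prime_pow p (padicValInt_dvd e), Ne, CharP.intCast_eq_zero_iff K p]
    exact not_dvd_ediv_pow_padicValInt p he
  · have := CharP.charP_to_charZero K
    exact ⟨1, one_pos, by rw [Ring.choose_one_right]; exact_mod_cast he⟩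

/-- The substitution of a nilpotent element into power series is multiplicative. -/
theorem aeval_trunc_mul {B : Type*} [Ring B] [Algebra k B] {x : B} {N : ℕ} (hx : x ^ N = 0)
    (f g : PowerSeries k) : Polynomial.aeval x (PowerSeries.trunc N (f * g)) =
      Polynomial.aeval x (PowerSeries.trunc N f) * Polynomial.aeval x (PowerSeries.trunc N g) := by
  rw [← map_mul, ← sub_eq_zero, ← map_sub]
  have h : (Polynomial.X : Polynomial k) ^ N ∣
      PowerSeries.trunc N (f * g) - PowerSeries.trunc N f * PowerSeries.trunc N g := by
    rw [Polynomial.X_pow_dvd_iff]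
    intro d hd
    have h1 := congrArg (fun q => Polynomial.coeff q d)
      (PowerSeries.trunc_trunc_mul_trunc f g (n := N))
    simp only [PowerSeries.coeff_trunc, if_pos hd] at h1
    rw [Polynomial.coeff_sub, PowerSeries.coeff_trunc, if_pos hd, ← h1, ← Polynomial.coe_mul,
      Polynomial.coeff_coe, sub_self]
  obtain ⟨q, hq⟩ := h
  rw [hq, map_mul, map_pow, Polynomial.aeval_X, hx, zero_mul]

/-- The integral powers of a unit `1 + x` with `x` nilpotent are given by the binomial series. -/
theorem units_zpow_eq_aeval {B : Type*} [Ring B] [Algebra k B] {x : B} {N : ℕ} (hx : x ^ N = 0)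
    {u : Bˣ} (hu : (u : B) = 1 + x) (e : ℤ) :
    ((u ^ e : Bˣ) : B) =
      Polynomial.aeval x (PowerSeries.trunc N (PowerSeries.binomialSeries k e)) := by
  rcases Nat.eq_zero_or_pos N with rfl | hN
  · have : Subsingleton B := subsingleton_of_zero_eq_one (by simpa using hx.symm)
    exact Subsingleton.elim _ _
  have h0 : Polynomial.aeval x (PowerSeries.trunc N (1 : PowerSeries k)) = 1 := by
    obtain ⟨n, rfl⟩ := Nat.exists_eq_succ_of_ne_zero hN.ne'
    rw [PowerSeries.trunc_one, map_one]
  have h1 : Polynomial.aeval x (PowerSeries.trunc N (PowerSeries.binomialSeries k (1 : ℤ))) = u := by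
    rw [hu, show (1 : ℤ) = ((1 : ℕ) : ℤ) from rfl, PowerSeries.binomialSeries_nat, pow_one, map_add,
      map_add, h0]
    congr 1
    obtain ⟨n, rfl⟩ := Nat.exists_eq_succ_of_ne_zero hN.ne'
    rcases n with _ | n
    · have hx0 : x = 0 := by simpa using hx
      rw [hx0, PowerSeries.trunc_succ]
      simp
    · rw [PowerSeries.trunc_X, Polynomial.aeval_X]
  induction e using Int.induction_on with
  | zero => rw [zpow_zero, Units.val_one, PowerSeries.binomialSeries_zero, h0]
  | succ i ih =>
    rw [zpow_add_one, Units.val_mul, ih, PowerSeries.binomialSeries_add, aeval_trunc_mul hx, h1]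
  | pred i ih =>
    rw [zpow_sub_one, Units.val_mul, ih, Units.mul_inv_eq_iff_eq_mul, ← h1, ← aeval_trunc_mul hx,
      ← PowerSeries.binomialSeries_add, sub_add_cancel]

end Binomial

/-! ### Coefficients of the Magnus map -/

namespace Raag

section Coefficients

/-- The lists of length `n` of natural numbers less than `N`. -/
def expLists (N : ℕ) : ℕ → Finset (List ℕ)
  | 0 => {[]}
  | n + 1 => (Finset.range N ×ˢ expLists N n).image fun q => q.1 :: q.2

theorem mem_expLists {N n : ℕ} {J : List ℕ} :
    J ∈ expLists N n ↔ J.length = n ∧ ∀ j ∈ J, j < N := by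
  induction n generalizing J with
  | zero =>
    rw [expLists, Finset.mem_singleton, List.length_eq_zero_iff]
    exact ⟨fun h => ⟨h, by simp [h]⟩, fun h => h.1⟩
  | succ n ih =>
    simp only [expLists, Finset.mem_image, Finset.mem_product, Finset.mem_range, Prod.exists, ih]
    constructor
    · rintro ⟨j, J, ⟨h₁, h₂, h₃⟩, rfl⟩
      exact ⟨by simp [h₂], List.forall_mem_cons.2 ⟨h₁, h₃⟩⟩
    · rintro ⟨h₁, h₂⟩
      cases J with
      | nil => simp at h₁
      | cons j J =>
        obtain ⟨h₃, h₄⟩ := List.forall_mem_cons.1 h₂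
        exact ⟨j, J, ⟨h₃, by simpa using h₁, h₄⟩, rfl⟩

variable {V : Type*}

/-- The word with the letters of `x` and the exponents `J`. -/
def withExps (x : Word V) (J : List ℕ) : List (V × ℕ) := List.zipWith (fun a j => (a.1, j)) x J

theorem length_withExps {x : Word V} {J : List ℕ} (h : J.length = x.length) :
    (withExps x J).length = x.length := by simp [withExps, h]

theorem map_fst_withExps {x : Word V} {J : List ℕ} (h : J.length = x.length) :
    (withExps x J).map Prod.fst = x.map Prod.fst := by
  induction x generalizing J with
  | nil => simp [withExps]
  | cons a x ih =>
    cases J with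
    | nil => simp at h
    | cons j J => simpa [withExps] using ih (by simpa using h)

theorem map_snd_withExps {x : Word V} {J : List ℕ} (h : J.length = x.length) :
    (withExps x J).map Prod.snd = J := by
  induction x generalizing J with
  | nil => simpa [withExps] using (List.length_eq_zero_iff.1 h).symm
  | cons a x ih =>
    cases J with
    | nil => simp at h
    | cons j J => simpa [withExps] using ih (by simpa using h)

theorem withExps_map (x : Word V) (f : V × ℤ → ℕ) :
    withExps x (x.map f) = x.map fun a => (a.1, f a) := by
  simp [withExps, List.zipWith_map_right]

variable {k : Type*} [CommRing k] {Γ : SimpleGraph V}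

/-- The coefficient of the product of the `v ^ j` in the product of the `(1 + v) ^ e`, where `(v, e)`
runs over the entries of `x` and `j` over those of `J`. -/
noncomputable def chooseProd (k : Type*) [CommRing k] (x : Word V) (J : List ℕ) : k :=
  (List.zipWith (fun a j => ((Ring.choose a.2 j : ℤ) : k)) x J).prod

theorem chooseProd_map (x : Word V) (f : V × ℤ → ℕ) :
    chooseProd k x (x.map f) = (x.map fun a => ((Ring.choose a.2 (f a) : ℤ) : k)).prod := by
  simp [chooseProd, List.zipWith_map_right]

theorem prod_truncated_eq_sum (N : ℕ) (x : Word V) :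
    (x.map fun a => Polynomial.aeval (X k Γ a.1)
        (PowerSeries.trunc N (PowerSeries.binomialSeries k a.2))).prod =
      ∑ J ∈ expLists N x.length, chooseProd k x J • monoPoly k Γ (mono Γ (withExps x J)) := by
  induction x with
  | nil => simp [expLists, chooseProd, withExps, mono]
  | cons a x ih =>
    obtain ⟨v, e⟩ := a
    have hinj : Set.InjOn (fun q : ℕ × List ℕ => q.1 :: q.2)
        (Finset.range N ×ˢ expLists N x.length : Finset (ℕ × List ℕ)) := by
      rintro ⟨_, _⟩ _ ⟨_, _⟩ _ h
      simpa using h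
    have hpoly : Polynomial.aeval (X k Γ v)
        (PowerSeries.trunc N (PowerSeries.binomialSeries k e)) =
        ∑ j ∈ Finset.range N, ((Ring.choose e j : ℤ) : k) • X k Γ v ^ j := by
      rw [PowerSeries.trunc_apply, map_sum, ← Finset.range_eq_Ico]
      refine Finset.sum_congr rfl fun j _ => ?_
      rw [Polynomial.aeval_monomial, PowerSeries.binomialSeries_coeff, zsmul_eq_mul, mul_one,
        Algebra.smul_def]
    rw [List.map_cons, List.prod_cons, ih, hpoly, List.length_cons, expLists,
      Finset.sum_image hinj, Finset.sum_product, Finset.sum_mul]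
    refine Finset.sum_congr rfl fun j _ => ?_
    rw [Finset.mul_sum]
    refine Finset.sum_congr rfl fun J _ => ?_
    rw [smul_mul_smul_comm]
    simp only [chooseProd, withExps, List.zipWith_cons_cons, List.prod_cons, mono_cons, map_mul,
      map_pow, monoPoly_var]

theorem coeff_eq_of_proj {m : Mon Γ} {y : PowerSeries k Γ} {r : Poly k Γ} {N : ℕ}
    (hN : deg Γ m < N)
    (h : Adic.proj k (polyIdeal k Γ) N y = Ideal.Quotient.mk (polyIdeal k Γ ^ N) r) :
    coeff k Γ m y = polyCoeff k Γ m r := by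
  have e : Adic.proj k (polyIdeal k Γ) (deg Γ m + 1) y =
      Adic.proj k (polyIdeal k Γ) (deg Γ m + 1) (Adic.toCompletion k (polyIdeal k Γ) r) := by
    rw [← Adic.factor_proj k _ (Nat.succ_le_of_lt hN) y, h]
    rfl
  rw [← coeff_toCompletion]
  unfold coeff
  unfold deg at e
  exact congrArg _ e

theorem proj_magnusSeries_gen_zpow (N : ℕ) (v : V) (e : ℤ) :
    Adic.proj k (polyIdeal k Γ) N (magnusSeries k Γ (gen Γ v ^ e)) =
      Ideal.Quotient.mk (polyIdeal k Γ ^ N) (Polynomial.aeval (X k Γ v)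
        (PowerSeries.trunc N (PowerSeries.binomialSeries k e))) := by
  have hx : Ideal.Quotient.mkₐ k (polyIdeal k Γ ^ N) (X k Γ v) ^ N = 0 := by
    rw [← map_pow]
    exact Ideal.Quotient.eq_zero_iff_mem.2 (Ideal.pow_mem_pow (X_mem k Γ v) N)
  have h := units_zpow_eq_aeval (k := k) hx (u := Units.map
    (Adic.proj k (polyIdeal k Γ) N : PowerSeries k Γ →* _) (onePlusX k Γ v)) (by
      rw [Units.coe_map, onePlusX_val]
      change Adic.proj k _ N _ = _
      rw [map_add, map_one]
      rfl) e
  rw [Polynomial.aeval_algHom_apply, ← map_zpow] at h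
  refine Eq.trans ?_ h
  have hm : magnusSeries k Γ (gen Γ v ^ e) =
      (((onePlusX k Γ v : (PowerSeries k Γ)ˣ) ^ e : (PowerSeries k Γ)ˣ) : PowerSeries k Γ) := by
    rw [← magnus_gen, ← Subgroup.coe_zpow, ← map_zpow]
    rfl
  rw [hm]
  rfl

theorem proj_magnusSeries_toGroup (N : ℕ) (x : Word V) :
    Adic.proj k (polyIdeal k Γ) N (magnusSeries k Γ (Word.toGroup Γ x)) =
      Ideal.Quotient.mk (polyIdeal k Γ ^ N) (x.map fun a => Polynomial.aeval (X k Γ a.1)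
        (PowerSeries.trunc N (PowerSeries.binomialSeries k a.2))).prod := by
  induction x with
  | nil => simp [Word.toGroup]
  | cons a x ih =>
    rw [List.map_cons, List.prod_cons, map_mul, ← ih, ← proj_magnusSeries_gen_zpow, ← map_mul,
      ← map_mul]
    rfl

open Classical in
theorem coeff_magnusSeries (x : Word V) (m : Mon Γ) :
    coeff k Γ m (magnusSeries k Γ (Word.toGroup Γ x)) =
      ∑ J ∈ expLists (deg Γ m + 1) x.length,
        if mono Γ (withExps x J) = m then chooseProd k x J else 0 := by
  rw [coeff_eq_of_proj (Nat.lt_succ_self _) (proj_magnusSeries_toGroup _ x), prod_truncated_eq_sum,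
    map_sum]
  refine Finset.sum_congr rfl fun J _ => ?_
  rw [map_smul]
  split_ifs with h
  · rw [h, polyCoeff_monoPoly_self, smul_eq_mul, mul_one]
  · rw [polyCoeff_monoPoly_of_ne k Γ (Ne.symm h), smul_zero]

theorem forall_zip_of_chooseProd_ne_zero {x : Word V} {J : List ℕ} (h : chooseProd k x J ≠ 0) :
    ∀ a ∈ x.zip J, ((Ring.choose a.1.2 a.2 : ℤ) : k) ≠ 0 := by
  intro a ha h0
  refine h (List.prod_eq_zero ?_)
  rw [← h0, ← List.map_uncurry_zip_eq_zipWith]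
  exact List.mem_map.2 ⟨a, ha, rfl⟩

/-- The monomials with non-zero coefficient in `μ(v₁ ^ e₁ ⋯ vₙ ^ eₙ)` have the form
`v₁ ^ j₁ ⋯ vₙ ^ jₙ` with non-zero binomial coefficients. -/
theorem exists_of_coeff_ne_zero {x : Word V} {m : Mon Γ}
    (h : coeff k Γ m (magnusSeries k Γ (Word.toGroup Γ x)) ≠ 0) :
    ∃ J : List ℕ, J.length = x.length ∧ mono Γ (withExps x J) = m ∧
      ∀ a ∈ x.zip J, ((Ring.choose a.1.2 a.2 : ℤ) : k) ≠ 0 := by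
  classical
  rw [coeff_magnusSeries] at h
  obtain ⟨J, hJ, h⟩ := Finset.exists_ne_zero_of_sum_ne_zero h
  obtain ⟨h₁, h₂⟩ := ite_ne_right_iff.1 h
  exact ⟨J, (mem_expLists.1 hJ).1, h₁, forall_zip_of_chooseProd_ne_zero h₂⟩

theorem le_deg_mono {z : List (V × ℕ)} {a : V × ℕ} (ha : a ∈ z) : a.2 ≤ deg Γ (mono Γ z) := by
  induction z with
  | nil => simp at ha
  | cons b z ih =>
    rw [mono_cons, deg_mul, deg_pow, deg_var, mul_one]
    rcases List.mem_cons.1 ha with rfl | h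
    · exact Nat.le_add_right _ _
    · exact (ih h).trans (Nat.le_add_left _ _)

/-- For a reduced word, the expansion of `μ(v₁ ^ e₁ ⋯ vₙ ^ eₙ)` contains the monomial
`v₁ ^ j₁ ⋯ vₙ ^ jₙ` with positive `jᵢ` only once. -/
theorem coeff_magnusSeries_withExps {x : Word V} (hx : Rigid Γ (x.map Prod.fst)) {J : List ℕ}
    (hJ : J.length = x.length) (hpos : ∀ j ∈ J, 0 < j) :
    coeff k Γ (mono Γ (withExps x J)) (magnusSeries k Γ (Word.toGroup Γ x)) =
      chooseProd k x J := by
  classical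
  have hpos' : ∀ a ∈ withExps x J, 0 < a.2 := fun a ha =>
    hpos _ (map_snd_withExps hJ ▸ List.mem_map_of_mem ha)
  rw [coeff_magnusSeries, Finset.sum_eq_single J, if_pos rfl]
  · intro J' hJ' hne
    refine if_neg fun h => hne ?_
    have hl := (mem_expLists.1 hJ').1
    have hr : Rigid Γ ((withExps x J).map Prod.fst) := by rwa [map_fst_withExps hJ]
    have h' := (length_le_of_mono_eq hpos' hr h.symm).2
      (by rw [length_withExps hJ, length_withExps hl])
    have he := eq_of_sameProj hpos' hr h'
      (by rw [map_fst_withExps hJ, map_fst_withExps hl]) (.of_eq h.symm)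
    rw [← map_snd_withExps hJ, he, map_snd_withExps hl]
  · refine fun h => absurd (mem_expLists.2 ⟨hJ, fun j hj => ?_⟩) h
    rw [← map_snd_withExps hJ] at hj
    obtain ⟨a, ha, rfl⟩ := List.mem_map.1 hj
    exact Nat.lt_succ_of_le (le_deg_mono ha)

end Coefficients

end Raag

/-! ### Leading monomials and injectivity -/

namespace Raag

section Leading

variable {k : Type*} [CommRing k] {V : Type*} {Γ : SimpleGraph V} {p : ℕ}

theorem pMon_eq_mono (l : List (V × ℕ)) :
    pMon Γ p l = mono Γ (l.map fun a => (a.1, p ^ a.2)) := by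
  simp [pMon, mono, Function.comp_def]

theorem isReduced_pWord_iff (hp : 0 < p) {l : List (V × ℕ)} :
    IsReduced Γ (pWord p l) ↔ Rigid Γ (l.map Prod.fst) := by
  rw [isReduced_iff]
  have h : (pWord p l).map Prod.fst = l.map Prod.fst := by simp [pWord, Function.comp_def]
  rw [h]
  refine and_iff_left fun a ha => ?_
  obtain ⟨b, -, rfl⟩ := List.mem_map.1 ha
  exact pow_ne_zero _ (Int.natCast_ne_zero.2 hp.ne')

theorem pos_of_mem_map_pow (hp : 0 < p) (l : List (V × ℕ)) :
    ∀ a ∈ l.map fun a => (a.1, p ^ a.2), 0 < a.2 := by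
  intro a ha
  obtain ⟨b, -, rfl⟩ := List.mem_map.1 ha
  exact pow_pos hp _

theorem map_fst_map_pow (l : List (V × ℕ)) :
    (l.map fun a => (a.1, p ^ a.2)).map Prod.fst = l.map Prod.fst := by
  simp [Function.comp_def]

theorem deg_pMon_le_of_forall₂ (hp : 0 < p) {l u : List (V × ℕ)}
    (h : List.Forall₂ (fun a b => a.1 = b.1 ∧ a.2 ≤ b.2) l u) :
    deg Γ (pMon Γ p l) ≤ deg Γ (pMon Γ p u) ∧
      (deg Γ (pMon Γ p l) = deg Γ (pMon Γ p u) → pMon Γ p l = pMon Γ p u) := by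
  induction h with
  | nil => exact ⟨le_rfl, fun _ => rfl⟩
  | @cons a b l u hab _ ih =>
    obtain ⟨v, s⟩ := a
    obtain ⟨w, t⟩ := b
    obtain ⟨rfl, hst⟩ : v = w ∧ s ≤ t := hab
    have hpow : p ^ s ≤ p ^ t := Nat.pow_le_pow_right hp hst
    simp only [pMon, List.map_cons, List.prod_cons, deg_mul, deg_pow, deg_var, mul_one] at ih ⊢
    refine ⟨add_le_add hpow ih.1, fun h => ?_⟩
    have h₁ : p ^ s = p ^ t := by have := ih.1; omega
    rw [h₁, ih.2 (by omega)]

/-- Minimality of the exponents implies uniqueness, because it bounds the degrees. -/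
theorem IsLeading.unique (hp : 0 < p) {g : ArtinGroup Γ} {m m' : Mon Γ}
    (h : IsLeading k Γ p g m) (h' : IsLeading k Γ p g m') : m = m' := by
  obtain ⟨l, hl, rfl, hc, hmax⟩ := h
  obtain ⟨l', hl', rfl, hc', hmax'⟩ := h'
  obtain ⟨h₁, h₂⟩ := hmax l' hl' hc'
  obtain ⟨h₃, h₄⟩ := hmax' l hl hc
  obtain ⟨z, -, hz, hzl⟩ := h₂ (le_antisymm h₁ h₃)
  obtain ⟨z', -, hz', hzl'⟩ := h₄ (le_antisymm h₃ h₁)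
  have k₁ := deg_pMon_le_of_forall₂ (Γ := Γ) hp hzl
  have k₂ := deg_pMon_le_of_forall₂ (Γ := Γ) hp hzl'
  rw [hz] at k₁
  rw [hz'] at k₂
  exact k₁.2 (le_antisymm k₁.1 k₂.1)

/-- The list of the letters of `x` with the `p`-adic valuations of the exponents. -/
def valList (p : ℕ) (x : Word V) : List (V × ℕ) := x.map fun a => (a.1, padicValInt p a.2)

theorem pMon_valList (x : Word V) :
    pMon Γ p (valList p x) = mono Γ (withExps x (x.map fun a => p ^ padicValInt p a.2)) := by
  rw [pMon_eq_mono, withExps_map, valList, List.map_map]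
  rfl

theorem map_fst_valList (x : Word V) : (valList p x).map Prod.fst = x.map Prod.fst := by
  simp [valList, Function.comp_def]

theorem length_valList (x : Word V) : (valList p x).length = x.length := by simp [valList]

theorem coeff_pMon_valList [Fact p.Prime] [CharP k p] {x : Word V}
    (hx : Rigid Γ (x.map Prod.fst)) :
    coeff k Γ (pMon Γ p (valList p x)) (magnusSeries k Γ (Word.toGroup Γ x)) =
      (x.map fun a => ((a.2 / (p : ℤ) ^ padicValInt p a.2 : ℤ) : k)).prod := by
  rw [pMon_valList, coeff_magnusSeries_withExps hx (by simp), chooseProd_map]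
  · refine congrArg List.prod (List.map_congr_left fun a _ => ?_)
    exact cast_choose_prime_pow p (padicValInt_dvd a.2)
  · intro j hj
    obtain ⟨a, -, rfl⟩ := List.mem_map.1 hj
    exact pow_pos (Nat.Prime.pos Fact.out) _

theorem isUnit_coeff_pMon_valList [Fact p.Prime] [CharP k p] {x : Word V}
    (h0 : ∀ a ∈ x, a.2 ≠ 0) :
    IsUnit (x.map fun a => ((a.2 / (p : ℤ) ^ padicValInt p a.2 : ℤ) : k)).prod := by
  refine List.prod_isUnit fun c hc => ?_
  obtain ⟨a, ha, rfl⟩ := List.mem_map.1 hc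
  have hnd := not_dvd_ediv_pow_padicValInt p (h0 a ha)
  obtain ⟨b, c, hbc⟩ := (Nat.prime_iff_prime_int.1 Fact.out).coprime_iff_not_dvd.2 hnd
  have h := congrArg (Int.cast : ℤ → k) hbc
  push_cast at h
  rw [CharP.cast_eq_zero, mul_zero, zero_add] at h
  exact IsUnit.of_mul_eq_one_right _ h

theorem pow_padicValInt_le_of_choose_ne_zero [Fact p.Prime] [CharP k p] {e : ℤ} {j : ℕ}
    (hj : 0 < j) (h : ((Ring.choose e j : ℤ) : k) ≠ 0) : p ^ padicValInt p e ≤ j :=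
  not_lt.1 fun hlt => h (cast_choose_eq_zero p (padicValInt_dvd e) hj hlt)

/-- If `x` is a reduced word for `g`, the monomial with the letters of `x`, each with the largest
power of `p` dividing its exponent, is leading. -/
theorem isLeading_valList [Fact p.Prime] [CharP k p] [Nontrivial k] {x : Word V}
    (hx : IsReduced Γ x) :
    IsLeading k Γ p (Word.toGroup Γ x) (pMon Γ p (valList p x)) := by
  have hp : 0 < p := Nat.Prime.pos Fact.out
  obtain ⟨hr, h0⟩ := isReduced_iff.1 hx
  refine ⟨valList p x, (isReduced_pWord_iff hp).2 (by rwa [map_fst_valList]), rfl, ?_, ?_⟩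
  · rw [coeff_pMon_valList hr]
    exact (isUnit_coeff_pMon_valList h0).ne_zero
  intro u hu hc
  rw [isReduced_pWord_iff hp] at hu
  obtain ⟨J, hJ, hm, hne⟩ := exists_of_coeff_ne_zero hc
  rw [pMon_eq_mono] at hm
  have hpos := pos_of_mem_map_pow hp u
  have hu' : Rigid Γ ((u.map fun a => (a.1, p ^ a.2)).map Prod.fst) := by rwa [map_fst_map_pow]
  obtain ⟨h₁, h₂⟩ := length_le_of_mono_eq hpos hu' hm.symm
  rw [length_withExps hJ, List.length_map] at h₁ h₂
  rw [length_valList]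
  refine ⟨h₁, fun hl => ?_⟩
  have hJpos := h₂ hl
  have hs : Shuffle Γ Prod.fst (withExps x J) (u.map fun a => (a.1, p ^ a.2)) :=
    shuffle_of_sameProj hJpos (by rwa [map_fst_withExps hJ]) hpos hu' (.of_eq hm)
  -- the shuffle carries along the exponents `e` of `x` in addition to the `j` in `J`
  let φ : (V × ℤ) × ℕ → V × ℕ := fun a => (a.1.1, a.2)
  have hφ : (x.zip J).map φ = withExps x J := by
    rw [withExps, ← List.map_uncurry_zip_eq_zipWith]
    rfl
  obtain ⟨z, hz, hsz⟩ := hs.exists_lift hφ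
  let ψ : (V × ℤ) × ℕ → V × ℕ := fun a => (a.1.1, padicValInt p a.1.2)
  have hψ : (x.zip J).map ψ = valList p x := by
    have h : ((x.zip J).map Prod.fst).map (fun a : V × ℤ => (a.1, padicValInt p a.2)) =
        valList p x := by rw [List.map_fst_zip hJ.ge, valList]
    rw [← h, List.map_map]
    rfl
  have hsψ : Shuffle Γ Prod.fst (valList p x) (z.map ψ) := hψ ▸ Shuffle.map (φ := ψ) hsz
  refine ⟨z.map ψ, (isReduced_pWord_iff hp).2 (hsψ.rigid (by rwa [map_fst_valList])), ?_, ?_⟩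
  · rw [pMon, pMon]
    exact (hsψ.prod_eq fun a b hab => commute_monVar_pow hab _ _).symm
  · have hF : List.Forall₂ (fun a b => a = b) (z.map φ) (u.map fun a => (a.1, p ^ a.2)) := by
      rw [List.forall₂_eq_eq_eq]
      exact hz
    rw [List.forall₂_map_left_iff, List.forall₂_map_right_iff] at hF
    rw [List.forall₂_map_left_iff]
    have hmem : ∀ a ∈ z, p ^ padicValInt p a.1.2 ≤ a.2 := by
      intro a ha
      have ha' := hsz.perm.mem_iff.2 ha
      have hφa : φ a ∈ withExps x J := hφ ▸ List.mem_map_of_mem ha'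
      exact pow_padicValInt_le_of_choose_ne_zero (k := k) (hJpos _ hφa) (hne a ha')
    refine ((List.forall₂_and_left _ _).2 ⟨hmem, hF⟩).imp fun a b hab => ?_
    obtain ⟨h₁, h₂⟩ := hab
    refine ⟨(Prod.ext_iff.1 h₂).1, ?_⟩
    rw [show a.2 = p ^ b.2 from (Prod.ext_iff.1 h₂).2] at h₁
    exact (Nat.pow_le_pow_iff_right (Nat.Prime.one_lt Fact.out)).1 h₁

theorem leading_monomial [Nontrivial k] (hp : p.Prime) [CharP k p] (g : ArtinGroup Γ) :
    (∃! m : Mon Γ, IsLeading k Γ p g m) ∧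
    ∀ m : Mon Γ, IsLeading k Γ p g m → ∀ x : Word V, IsReduced Γ x → Word.toGroup Γ x = g →
      (∀ l : List (V × ℕ), IsReduced Γ (pWord p l) → pMon Γ p l = m →
        x.length = l.length ∧
        (x.map fun a => monVar Γ a.1).prod = (l.map fun a => monVar Γ a.1).prod) ∧
      ∃ l : List (V × ℕ), IsReduced Γ (pWord p l) ∧ pMon Γ p l = m ∧
        List.Forall₂ (fun a b => a.1 = b.1 ∧ (p : ℤ) ^ b.2 ∣ a.2) x l ∧
        coeff k Γ m (magnusSeries k Γ g) =
          (List.zipWith (fun a b => ((a.2 / (p : ℤ) ^ b.2 : ℤ) : k)) x l).prod := by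
  have : Fact p.Prime := ⟨hp⟩
  constructor
  · obtain ⟨x, hx, rfl⟩ := exists_isReduced g
    exact ⟨_, isLeading_valList hx, fun m hm => hm.unique hp.pos (isLeading_valList hx)⟩
  rintro m hm x hx rfl
  obtain rfl := hm.unique hp.pos (isLeading_valList hx)
  obtain ⟨hr, h0⟩ := isReduced_iff.1 hx
  have hrv : Rigid Γ ((valList p x).map Prod.fst) := by rwa [map_fst_valList]
  refine ⟨fun l hl hlm => ?_, valList p x, (isReduced_pWord_iff hp.pos).2 hrv, rfl, ?_, ?_⟩
  · rw [isReduced_pWord_iff hp.pos] at hl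
    rw [pMon_eq_mono, pMon_eq_mono] at hlm
    have hs := shuffle_of_sameProj (pos_of_mem_map_pow hp.pos _) (by rwa [map_fst_map_pow])
      (pos_of_mem_map_pow hp.pos _) (by rwa [map_fst_map_pow]) (SameProj.of_eq hlm.symm)
    refine ⟨by simpa [valList] using hs.perm.length_eq, ?_⟩
    have h := hs.prod_eq (f := fun a : V × ℕ => monVar Γ a.1) fun _ _ hab => monVar_comm Γ hab
    simpa [valList, Function.comp_def] using h
  · rw [valList, List.forall₂_map_right_iff, List.forall₂_same]
    exact fun a _ => ⟨rfl, padicValInt_dvd a.2⟩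
  · rw [coeff_pMon_valList hr, valList, List.zipWith_map_right, List.zipWith_self]

/-- The image of a non-trivial element has a non-zero coefficient at some monomial of positive
degree: for a reduced word with exponents `eᵢ`, choose `jᵢ > 0` such that the binomial coefficients
of `eᵢ` and `jᵢ` do not vanish in a residue field of `k`. -/
theorem magnusSeries_injective [Nontrivial k] : Function.Injective (magnusSeries k Γ) := by
  obtain ⟨M, hM⟩ := Ideal.exists_maximal k
  let _ : Field (k ⧸ M) := Ideal.Quotient.field M
  have key : ∀ g, magnusSeries k Γ g = 1 → g = 1 := by
    intro g hg
    obtain ⟨x, hx, rfl⟩ := exists_isReduced g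
    obtain ⟨hr, h0⟩ := isReduced_iff.1 hx
    have hex : ∀ a : V × ℤ, ∃ j, 0 < j ∧ (a.2 ≠ 0 → ((Ring.choose a.2 j : ℤ) : k ⧸ M) ≠ 0) := by
      intro a
      by_cases ha : a.2 = 0
      · exact ⟨1, one_pos, fun h => absurd ha h⟩
      · obtain ⟨j, hj, hne⟩ := exists_choose_ne_zero (k ⧸ M) ha
        exact ⟨j, hj, fun _ => hne⟩
    choose f hf hf' using hex
    have hpos : ∀ j ∈ x.map f, 0 < j := by
      intro j hj
      obtain ⟨a, -, rfl⟩ := List.mem_map.1 hj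
      exact hf a
    have hc := coeff_magnusSeries_withExps (k := k) hr (J := x.map f) (by simp) hpos
    have hne : chooseProd k x (x.map f) ≠ 0 := by
      intro h
      have h' := congrArg (Ideal.Quotient.mk M) h
      rw [chooseProd_map, map_list_prod, map_zero, List.map_map, List.prod_eq_zero_iff] at h'
      obtain ⟨a, ha, h''⟩ := List.mem_map.1 h'
      rw [Function.comp_apply, map_intCast] at h''
      exact hf' a (h0 a ha) h''
    rw [hg, ← map_one (Adic.toCompletion k (polyIdeal k Γ)), coeff_toCompletion,
      ← map_one (monoPoly k Γ)] at hc
    have hm : mono Γ (withExps x (x.map f)) = 1 := by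
      by_contra hm
      rw [polyCoeff_monoPoly_of_ne k Γ hm] at hc
      exact hne hc.symm
    have hnil : withExps x (x.map f) = [] := by
      refine eq_nil_of_sameProj_one (fun a ha => ?_) (.of_eq hm)
      rw [withExps_map] at ha
      obtain ⟨b, -, rfl⟩ := List.mem_map.1 ha
      exact hf b
    rw [withExps_map, List.map_eq_nil_iff] at hnil
    rw [hnil]
    rfl
  intro g h hgh
  have hu : magnusSeries k Γ (g * h⁻¹) = 1 := by
    rw [map_mul, hgh, ← map_mul, mul_inv_cancel, map_one]
  exact mul_inv_eq_one.1 (key _ hu)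

end Leading

end Raag

/-! ### Graded Lie rings of central filtrations -/

namespace NSeries

section

/-- An additive map that preserves brackets is a homomorphism of Lie algebras over `ℤ`. -/
def lieHomOfAddHom {L L' : Type*} [LieRing L] [LieAlgebra ℤ L] [LieRing L'] [LieAlgebra ℤ L']
    (f : L →+ L') (hf : ∀ x y, f ⁅x, y⁆ = ⁅f x, f y⁆) : L →ₗ⁅ℤ⁆ L' where
  toFun := f
  map_add' := map_add f
  map_smul' c x := (congrArg f (int_smul_eq_zsmul _ c x)).trans
    ((map_zsmul f c x).trans (int_smul_eq_zsmul _ c (f x)).symm)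
  map_lie' := hf _ _

variable {G : Type*} [Group G] (F : NSeries G) {L : Type*} [LieRing L] [LieAlgebra ℤ L]

/-- The component of degree `n` of an element of `⨁ F n / F (n + 1)`. -/
def component (n : ℕ+) : F.Gr →+ F.Component n := DFinsupp.evalAddMonoidHom n

theorem component_cls_same (n : ℕ+) (x : F.term n) : F.component n (F.cls n x) = F.cl n x :=
  DirectSum.of_eq_same _ _

theorem component_cls_of_ne {m n : ℕ+} (h : m ≠ n) (x : F.term m) :
    F.component n (F.cls m x) = 0 := DirectSum.of_eq_of_ne _ _ _ h.symm

variable {F} in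
theorem gr_eq_zero {x : F.Gr} (h : ∀ n, F.component n x = 0) : x = 0 := DFinsupp.ext h

theorem cls_eq_zero {n : ℕ+} {x : F.term n} (h : (x : G) ∈ F.term (n + 1)) : F.cls n x = 0 :=
  (congrArg (DirectSum.of F.Component n) (F.cl_eq_zero h)).trans (map_zero _)

variable {F} in
theorem eq_of_cl_eq {φ : ∀ n, F.term n → L} (hmul : ∀ n x y, φ n (x * y) = φ n x + φ n y)
    (hker : ∀ n (x : F.term n), (x : G) ∈ F.term (n + 1) → φ n x = 0) {n : ℕ+} {x y : F.term n}
    (h : F.cl n x = F.cl n y) : φ n x = φ n y := by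
  have h' := hker n (x⁻¹ * y) (F.cl_eq_iff.1 h)
  have h'' := hmul n x (x⁻¹ * y)
  rwa [mul_inv_cancel_left, h', add_zero, eq_comm] at h''

/-- The additive map from `⨁ F n / F (n + 1)` that is given by homomorphisms `φ n : F n → L` which
kill `F (n + 1)`. -/
noncomputable def grLiftAdd (φ : ∀ n, F.term n → L)
    (hmul : ∀ n x y, φ n (x * y) = φ n x + φ n y)
    (hker : ∀ n (x : F.term n), (x : G) ∈ F.term (n + 1) → φ n x = 0) : F.Gr →+ L :=
  DirectSum.toAddMonoid (β := F.Component) fun n =>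
    AddMonoidHom.mk' (fun a => φ n (F.rep n a)) fun a b => by
      rw [← hmul]
      exact eq_of_cl_eq hmul hker (by rw [cl_mul, cl_rep, cl_rep, cl_rep])

theorem grLiftAdd_cls (φ : ∀ n, F.term n → L)
    (hmul : ∀ n x y, φ n (x * y) = φ n x + φ n y)
    (hker : ∀ n (x : F.term n), (x : G) ∈ F.term (n + 1) → φ n x = 0) (n : ℕ+) (x : F.term n) :
    F.grLiftAdd φ hmul hker (F.cls n x) = φ n x :=
  (DirectSum.toAddMonoid_of (β := F.Component) _ n (F.cl n x)).trans
    (eq_of_cl_eq hmul hker (F.cl_rep _ _))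

/-- The homomorphism from the Lie ring `⨁ F n / F (n + 1)` that is given by homomorphisms
`φ n : F n → L` which kill `F (n + 1)` and turn commutators into brackets. -/
noncomputable def grLift (φ : ∀ n, F.term n → L)
    (hmul : ∀ n x y, φ n (x * y) = φ n x + φ n y)
    (hker : ∀ n (x : F.term n), (x : G) ∈ F.term (n + 1) → φ n x = 0)
    (hcomm : ∀ m n x y, φ (m + n) (F.comm m n x y) = ⁅φ m x, φ n y⁆) : F.Gr →ₗ⁅ℤ⁆ L :=
  lieHomOfAddHom (F.grLiftAdd φ hmul hker) fun x y => by
    induction x using F.gr_induction with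
    | h0 => simp
    | ha x x' hx hx' => rw [add_lie, map_add, map_add, hx, hx', add_lie]
    | hc m x =>
      induction y using F.gr_induction with
      | h0 => simp
      | ha y y' hy hy' => rw [lie_add, map_add, map_add, hy, hy', lie_add]
      | hc n y => rw [lie_cls, grLiftAdd_cls, grLiftAdd_cls, grLiftAdd_cls, hcomm]

theorem grLift_cls (φ : ∀ n, F.term n → L)
    (hmul : ∀ n x y, φ n (x * y) = φ n x + φ n y)
    (hker : ∀ n (x : F.term n), (x : G) ∈ F.term (n + 1) → φ n x = 0)
    (hcomm : ∀ m n x y, φ (m + n) (F.comm m n x y) = ⁅φ m x, φ n y⁆) (n : ℕ+) (x : F.term n) :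
    F.grLift φ hmul hker hcomm (F.cls n x) = φ n x := F.grLiftAdd_cls φ hmul hker n x

variable {H : Type*} [Group H] (F' : NSeries H) (f : G →* H)
  (hf : ∀ n x, x ∈ F.term n → f x ∈ F'.term n)

/-- The homomorphism of graded Lie rings induced by a homomorphism of filtered groups. -/
noncomputable def grMap : F.Gr →ₗ⁅ℤ⁆ F'.Gr :=
  F.grLift (fun n x => F'.cls n ⟨f x, hf n x x.2⟩)
    (fun n x y => by
      rw [← cls_mul]
      exact F'.cls_congr rfl _ _ (map_mul f _ _))
    (fun n x hx => F'.cls_eq_zero (hf _ _ hx))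
    (fun m n x y => by
      rw [lie_cls]
      exact F'.cls_congr rfl _ _ (map_commutatorElement f _ _))

theorem grMap_cls (n : ℕ+) (x : F.term n) :
    F.grMap F' f hf (F.cls n x) = F'.cls n ⟨f x, hf n x x.2⟩ := F.grLift_cls _ _ _ _ n x

/-- The lower central series is the smallest central filtration that starts with the whole group:
homomorphisms map it into every such filtration. -/
theorem map_lowerCentral_mem (h1 : F'.term 1 = ⊤) (n : ℕ+) (x : G)
    (hx : x ∈ (lowerCentral G).term n) : f x ∈ F'.term n := by
  induction n generalizing x with
  | one =>
    rw [h1]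
    trivial
  | succ n ih =>
    have hle : (⊤ : Subgroup G).lowerCentralSeries (n : ℕ) ≤ (F'.term (n + 1)).comap f := by
      obtain ⟨j, hj⟩ := Nat.exists_eq_succ_of_ne_zero n.ne_zero
      have ih' : ∀ x ∈ (⊤ : Subgroup G).lowerCentralSeries j, f x ∈ F'.term n := fun x hx =>
        ih x (by
          change x ∈ (⊤ : Subgroup G).lowerCentralSeries ((n : ℕ) - 1)
          rwa [hj])
      rw [hj, Subgroup.lowerCentralSeries_succ, Subgroup.commutator_le]
      intro y hy z _
      rw [Subgroup.mem_comap, map_commutatorElement]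
      exact F'.commutator_mem n 1 _ _ (ih' y hy) (by rw [h1]; trivial)
    exact hle hx

end

end NSeries

/-! ### The graded Lie ring of the group `1 + ϖ` -/

namespace Adic

section

variable (k : Type*) {A : Type*} [CommRing k] [Ring A] [Algebra k A] (I : Ideal A) [I.IsTwoSided]

theorem toCompletion_mem_fil {n : ℕ} {a : A} : toCompletion k I a ∈ fil k I n ↔ a ∈ I ^ n := by
  rw [mem_fil, proj_toCompletion, Ideal.Quotient.eq_zero_iff_mem]

theorem exists_sub_toCompletion_mem {m n : ℕ} (h : m ≤ n) {x : Completion k I}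
    (hx : x ∈ fil k I m) : ∃ a ∈ I ^ m, x - toCompletion k I a ∈ fil k I n := by
  obtain ⟨a, ha, e⟩ := exists_rep k I h hx
  exact ⟨a, ha, by rw [mem_fil, map_sub, proj_toCompletion, e, sub_self]⟩

theorem symbol_eq_symbol_of_mem {n : ℕ} {a b : A} (ha : a ∈ I ^ n) (hb : b ∈ I ^ n)
    {x : Completion k I} (hxa : x - toCompletion k I a ∈ fil k I (n + 1))
    (hxb : x - toCompletion k I b ∈ fil k I (n + 1)) : symbol k I n a ha = symbol k I n b hb := by
  refine symbol_congr k I rfl _ _ ?_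
  rw [← toCompletion_mem_fil k, map_sub]
  have h := sub_mem hxb hxa
  rwa [sub_sub_sub_cancel_left] at h

theorem mul_sub_toCompletion_mem {m n : ℕ} {x y : Completion k I} {a b : A} (ha : a ∈ I ^ m)
    (hx : x - toCompletion k I a ∈ fil k I (m + 1)) (hy : y ∈ fil k I n)
    (hyb : y - toCompletion k I b ∈ fil k I (n + 1)) :
    x * y - toCompletion k I (a * b) ∈ fil k I (m + n + 1) := by
  have h1 := mul_mem_fil k I hx hy
  have h2 := mul_mem_fil k I ((toCompletion_mem_fil k I).2 ha) hyb
  rw [add_right_comm] at h1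
  have h := add_mem h1 h2
  have e : (x - toCompletion k I a) * y + toCompletion k I a * (y - toCompletion k I b) =
      x * y - toCompletion k I (a * b) := by
    rw [map_mul, sub_mul, mul_sub, sub_add_sub_cancel]
  rwa [e] at h

variable {I}

theorem sub_one_mem_of_mem_term {n : ℕ+} (u : (oneSeries k I).term n) :
    ((u.1.1 : (Completion k I)ˣ) : Completion k I) - 1 ∈ fil k I n :=
  (mem_onePlus k I).1 u.2

theorem exists_oneSymbol {n : ℕ+} (u : (oneSeries k I).term n) :
    ∃ y : Gr k I, ∀ (r : A) (hr : r ∈ I ^ (n : ℕ)),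
      ((u.1.1 : (Completion k I)ˣ) : Completion k I) - 1 - toCompletion k I r ∈
        fil k I ((n : ℕ) + 1) → y = symbol k I n r hr := by
  obtain ⟨a, ha, h⟩ := exists_sub_toCompletion_mem k I (Nat.le_succ n) (sub_one_mem_of_mem_term k u)
  exact ⟨symbol k I n a ha, fun r hr h' => symbol_eq_symbol_of_mem k I ha hr h h'⟩

/-- The class in `I ^ n / I ^ (n + 1)` of `w`, for `1 + w` in `1 + fil n`. -/
noncomputable def oneSymbol (n : ℕ+) (u : (oneSeries k I).term n) : Gr k I :=
  (exists_oneSymbol k u).choose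

theorem oneSymbol_eq {n : ℕ+} (u : (oneSeries k I).term n) (r : A) (hr : r ∈ I ^ (n : ℕ))
    (h : ((u.1.1 : (Completion k I)ˣ) : Completion k I) - 1 - toCompletion k I r ∈
      fil k I ((n : ℕ) + 1)) : oneSymbol k n u = symbol k I n r hr :=
  (exists_oneSymbol k u).choose_spec r hr h

theorem exists_oneSymbol_eq {n : ℕ+} (u : (oneSeries k I).term n) :
    ∃ (r : A) (hr : r ∈ I ^ (n : ℕ)),
      ((u.1.1 : (Completion k I)ˣ) : Completion k I) - 1 - toCompletion k I r ∈
        fil k I ((n : ℕ) + 1) ∧ oneSymbol k n u = symbol k I n r hr := by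
  obtain ⟨a, ha, h⟩ := exists_sub_toCompletion_mem k I (Nat.le_succ n) (sub_one_mem_of_mem_term k u)
  exact ⟨a, ha, h, oneSymbol_eq k u a ha h⟩

theorem oneSymbol_mul (n : ℕ+) (u v : (oneSeries k I).term n) :
    oneSymbol k n (u * v) = oneSymbol k n u + oneSymbol k n v := by
  obtain ⟨r, hr, h, e⟩ := exists_oneSymbol_eq k u
  obtain ⟨s, hs, h', e'⟩ := exists_oneSymbol_eq k v
  rw [e, e', ← symbol_add]
  refine oneSymbol_eq k _ _ _ ?_
  have hm := mul_mem_fil k I (sub_one_mem_of_mem_term k u) (sub_one_mem_of_mem_term k v)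
  have hm' := fil_antitone k I (Nat.add_le_add_left n.pos n) hm
  have hsum := add_mem (add_mem h h') hm'
  convert hsum using 1
  simp only [Subgroup.coe_mul, Units.val_mul, map_add, sub_mul, mul_sub, one_mul, mul_one]
  abel

theorem oneSymbol_eq_zero_iff (n : ℕ+) (u : (oneSeries k I).term n) :
    oneSymbol k n u = 0 ↔ (u : onePlus k I 1) ∈ (oneSeries k I).term (n + 1) := by
  obtain ⟨r, hr, h, e⟩ := exists_oneSymbol_eq k u
  have hu : (u : onePlus k I 1) ∈ (oneSeries k I).term (n + 1) ↔ r ∈ I ^ ((n : ℕ) + 1) := by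
    rw [← toCompletion_mem_fil k]
    refine Iff.trans (mem_onePlus k I (n := (n : ℕ) + 1)) ?_
    exact ⟨fun hu => by simpa using sub_mem hu h, fun hr => by simpa using add_mem h hr⟩
  rw [hu, e]
  refine ⟨fun h0 => ?_, symbol_eq_zero k I hr⟩
  have h1 := symbol_apply_same k I hr
  rw [h0, DirectSum.zero_apply, ← map_zero (grMk k I n), eq_comm, grMk_eq_iff] at h1
  simpa using h1

/-- Modulo `fil (m + n + 1)`, the commutator of `1 + a` in `1 + fil m` and `1 + b` in `1 + fil n` is
`1 + a b - b a`. -/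
theorem commutator_sub_toCompletion_mem {m n : ℕ} {u v : (Completion k I)ˣ} {r s : A}
    (hu1 : u ∈ onePlus k I 1) (hv1 : v ∈ onePlus k I 1)
    (hu : (u : Completion k I) - 1 ∈ fil k I m) (hv : (v : Completion k I) - 1 ∈ fil k I n)
    (hr : r ∈ I ^ m) (hs : s ∈ I ^ n)
    (hur : (u : Completion k I) - 1 - toCompletion k I r ∈ fil k I (m + 1))
    (hvs : (v : Completion k I) - 1 - toCompletion k I s ∈ fil k I (n + 1)) :
    ((⁅u, v⁆ : (Completion k I)ˣ) : Completion k I) - 1 -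
      toCompletion k I (r * s + -(s * r)) ∈ fil k I (m + n + 1) := by
  have h1 := mul_sub_toCompletion_mem k I hr hur hv hvs
  have h2 := mul_sub_toCompletion_mem k I hs hvs hu hur
  have h4 := mul_mem_fil k I hu hv
  have h5 := mul_mem_fil k I hv hu
  rw [add_comm n m] at h2 h5
  have h3 : ((u⁻¹ * v⁻¹ : (Completion k I)ˣ) : Completion k I) - 1 ∈ fil k I 1 :=
    (mem_onePlus k I).1 (mul_mem (inv_mem hu1) (inv_mem hv1))
  have h6 := add_mem (sub_mem h1 h2) (mul_mem_fil k I (sub_mem h4 h5) h3)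
  have hc : ((⁅u, v⁆ : (Completion k I)ˣ) : Completion k I) =
      u * v * (u⁻¹ * v⁻¹ : (Completion k I)ˣ) := by
    simp [commutatorElement_def, mul_assoc]
  have hc' : (v : Completion k I) * u * (u⁻¹ * v⁻¹ : (Completion k I)ˣ) = 1 := by
    rw [← Units.val_mul, ← Units.val_mul, ← mul_inv_rev, mul_inv_cancel, Units.val_one]
  rw [hc, map_add, map_neg]
  revert h6 hc'
  generalize ((u⁻¹ * v⁻¹ : (Completion k I)ˣ) : Completion k I) = w
  generalize (u : Completion k I) = x
  generalize (v : Completion k I) = y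
  intro h6 hc'
  have e6 : ((x - 1) * (y - 1) - (y - 1) * (x - 1)) * (w - 1) =
      x * y * w - y * x * w - (x * y - y * x) := by
    simp only [sub_mul, mul_sub, one_mul, mul_one]
    abel
  rw [e6, hc'] at h6
  convert h6 using 1
  simp only [sub_mul, mul_sub, one_mul, mul_one]
  abel

theorem lie_symbol {m n : ℕ} {r s : A} (hr : r ∈ I ^ m) (hs : s ∈ I ^ n)
    (h : r * s + -(s * r) ∈ I ^ (m + n)) :
    ⁅symbol k I m r hr, symbol k I n s hs⁆ = symbol k I (m + n) (r * s + -(s * r)) h := by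
  have hrs : r * s ∈ I ^ (m + n) := by
    rw [Ideal.IsTwoSided.pow_add]
    exact Ideal.mul_mem_mul hr hs
  have hsr : s * r ∈ I ^ (n + m) := by
    rw [Ideal.IsTwoSided.pow_add]
    exact Ideal.mul_mem_mul hs hr
  have hsr' : s * r ∈ I ^ (m + n) := by rwa [add_comm]
  rw [LieRing.of_associative_ring_bracket, symbol_mul k I hr hs hrs, symbol_mul k I hs hr hsr,
    sub_eq_iff_eq_add, symbol_congr k I (add_comm n m) hsr hsr'
      (by rw [sub_self]; exact zero_mem _), ← symbol_add]
  exact symbol_congr k I rfl _ _ (by rw [neg_add_cancel_right, sub_self]; exact zero_mem _)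

theorem oneSymbol_comm (m n : ℕ+) (u : (oneSeries k I).term m) (v : (oneSeries k I).term n) :
    oneSymbol k (m + n) ((oneSeries k I).comm m n u v) = ⁅oneSymbol k m u, oneSymbol k n v⁆ := by
  obtain ⟨r, hr, h, e⟩ := exists_oneSymbol_eq k u
  obtain ⟨s, hs, h', e'⟩ := exists_oneSymbol_eq k v
  have hmem : r * s + -(s * r) ∈ I ^ ((m : ℕ) + n) := by
    refine add_mem ?_ (neg_mem ?_)
    · rw [Ideal.IsTwoSided.pow_add]
      exact Ideal.mul_mem_mul hr hs
    · rw [add_comm, Ideal.IsTwoSided.pow_add]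
      exact Ideal.mul_mem_mul hs hr
  rw [e, e', lie_symbol k hr hs hmem]
  exact oneSymbol_eq k _ _ hmem (commutator_sub_toCompletion_mem k u.1.2 v.1.2
    (sub_one_mem_of_mem_term k u) (sub_one_mem_of_mem_term k v) hr hs h h')

variable (I)

/-- The homomorphism `[1 + w] ↦ [w]` of graded Lie rings. -/
noncomputable def grOne : (oneSeries k I).Gr →ₗ⁅ℤ⁆ Gr k I :=
  (oneSeries k I).grLift (oneSymbol k) (oneSymbol_mul k)
    (fun n u h => (oneSymbol_eq_zero_iff k n u).2 h) (oneSymbol_comm k)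

theorem grOne_cls (n : ℕ+) (u : (oneSeries k I).term n) :
    grOne k I ((oneSeries k I).cls n u) = oneSymbol k n u := NSeries.grLift_cls _ _ _ _ _ n u

theorem oneSymbol_apply_of_ne (n : ℕ+) (u : (oneSeries k I).term n) {i : ℕ} (h : (n : ℕ) ≠ i) :
    oneSymbol k n u i = 0 := by
  obtain ⟨r, hr, -, e⟩ := exists_oneSymbol_eq k u
  rw [e, symbol_apply_of_ne k I hr h]

/-- The map `[1 + w] ↦ [w]` is compatible with passing to the component of degree `n`. -/
theorem grOne_apply (x : (oneSeries k I).Gr) (n : ℕ+) (u : (oneSeries k I).term n)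
    (hu : (oneSeries k I).component n x = (oneSeries k I).cl n u) :
    grOne k I x n = oneSymbol k n u n := by
  induction x using NSeries.gr_induction generalizing u with
  | h0 =>
    have h := (NSeries.cl_eq_iff _ (x := 1)).1 hu
    rw [(oneSymbol_eq_zero_iff k n u).2 (by simpa using h), map_zero]
  | hc m v =>
    by_cases hmn : m = n
    · subst hmn
      rw [NSeries.component_cls_same] at hu
      have h : (oneSeries k I).cls m v = (oneSeries k I).cls m u :=
        congrArg (DirectSum.of (oneSeries k I).Component m) hu
      rw [h, grOne_cls]
    · rw [NSeries.component_cls_of_ne _ hmn] at hu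
      have h := (NSeries.cl_eq_iff _ (x := 1)).1 hu
      rw [(oneSymbol_eq_zero_iff k n u).2 (by simpa using h), grOne_cls,
        oneSymbol_apply_of_ne k I m v (fun e => hmn (PNat.coe_injective e)), DirectSum.zero_apply]
  | ha x y hx hy =>
    obtain ⟨v, hv⟩ := (oneSeries k I).cl_surjective n ((oneSeries k I).component n x)
    obtain ⟨w, hw⟩ := (oneSeries k I).cl_surjective n ((oneSeries k I).component n y)
    rw [map_add, ← hv, ← hw, ← NSeries.cl_mul] at hu
    have h : (oneSeries k I).cls n (v * w) = (oneSeries k I).cls n u :=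
      congrArg (DirectSum.of (oneSeries k I).Component n) hu
    rw [map_add, DirectSum.add_apply, hx v hv.symm, hy w hw.symm, ← DirectSum.add_apply,
      ← oneSymbol_mul, ← grOne_cls, h, grOne_cls]

theorem grOne_injective : Function.Injective (grOne k I) := by
  rw [injective_iff_map_eq_zero]
  intro x hx
  refine NSeries.gr_eq_zero fun n => ?_
  obtain ⟨u, hu⟩ := (oneSeries k I).cl_surjective n ((oneSeries k I).component n x)
  have h := grOne_apply k I x n u hu.symm
  rw [hx, DirectSum.zero_apply] at h
  rw [← hu]
  refine NSeries.cl_eq_zero _ ((oneSymbol_eq_zero_iff k n u).1 (DFinsupp.ext fun i => ?_))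
  by_cases hi : (n : ℕ) = i
  · subst hi
    exact h.symm
  · exact oneSymbol_apply_of_ne k I n u hi

theorem range_grOne : Set.range (grOne k I) = {x : Gr k I | x 0 = 0} := by
  apply Set.Subset.antisymm
  · rintro _ ⟨x, rfl⟩
    rw [Set.mem_ofPred_eq]
    induction x using NSeries.gr_induction with
    | h0 => rw [map_zero, DirectSum.zero_apply]
    | hc n u => rw [grOne_cls, oneSymbol_apply_of_ne k I n u n.ne_zero]
    | ha x y hx hy => rw [map_add, DirectSum.add_apply, hx, hy, add_zero]
  · have key : ∀ x : Gr k I, ∃ y, grOne k I y = x - DirectSum.of (GrPiece k I) 0 (x 0) := by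
      intro x
      induction x using gr_symbol_induction with
      | hz => exact ⟨0, by rw [map_zero, DirectSum.zero_apply, map_zero, sub_zero]⟩
      | ha x y hx hy =>
        obtain ⟨x', hx⟩ := hx
        obtain ⟨y', hy⟩ := hy
        refine ⟨x' + y', ?_⟩
        rw [map_add, hx, hy, DirectSum.add_apply, map_add]
        abel
      | hs n a ha =>
        rcases Nat.eq_zero_or_pos n with rfl | hn
        · refine ⟨0, ?_⟩
          rw [map_zero, symbol_apply_same, symbol, sub_self]
        · rw [symbol_apply_of_ne k I ha hn.ne', map_zero, sub_zero]
          have hmem : 1 + toCompletion k I a - 1 ∈ fil k I n := by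
            rw [add_sub_cancel_left]
            exact (toCompletion_mem_fil k I).2 ha
          let u : onePlus k I 1 := onePlus.mk k I le_rfl (1 + toCompletion k I a)
            (fil_antitone k I hn hmem)
          obtain ⟨n, rfl⟩ : ∃ n' : ℕ+, (n' : ℕ) = n := ⟨⟨n, hn⟩, rfl⟩
          have hu : u ∈ (oneSeries k I).term n := (mem_onePlus k I (n := (n : ℕ))).2 hmem
          refine ⟨(oneSeries k I).cls n ⟨u, hu⟩, ?_⟩
          rw [grOne_cls]
          refine oneSymbol_eq k _ _ _ ?_
          change 1 + toCompletion k I a - 1 - toCompletion k I a ∈ _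
          rw [add_sub_cancel_left, sub_self]
          exact zero_mem _
    intro x hx
    obtain ⟨y, hy⟩ := key x
    rw [Set.mem_ofPred_eq] at hx
    rw [hx, map_zero, sub_zero] at hy
    exact ⟨y, hy⟩

end

end Adic

/-! ### The Magnus map on graded Lie rings -/

namespace Raag

section GradedMagnus

variable (k : Type*) [CommRing k] {V : Type*} (Γ : SimpleGraph V)

/-- The identification of `Poly k Γ` with its associated graded algebra. -/
noncomputable def polyGrEquiv : Poly k Γ ≃ₐ[k] Adic.Gr k (polyIdeal k Γ) :=
  symbolEquiv (AlgHom.id k (Poly k Γ)) (X_mem k Γ) (fun _ _ h => h)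
    (fun _ b => ⟨b, by rw [AlgHom.id_apply, sub_self]; exact zero_mem _⟩)

variable {k Γ} in
theorem polyGrEquiv_of_mem {n : ℕ} {r : Poly k Γ} (hr : r ∈ polyIdeal k Γ ^ n)
    (h : r ∈ polyHomog k Γ n) :
    polyGrEquiv k Γ r = Adic.symbol k (polyIdeal k Γ) n r hr :=
  symbolHom_of_mem_polyHomog (AlgHom.id k (Poly k Γ)) _ h hr

theorem oneSeries_term_one : (Adic.oneSeries k (polyIdeal k Γ)).term 1 = ⊤ :=
  Subgroup.subgroupOf_self _

theorem magnus_mem (n : ℕ+) (g : ArtinGroup Γ)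
    (hg : g ∈ (NSeries.lowerCentral (ArtinGroup Γ)).term n) :
    magnus k Γ g ∈ (Adic.oneSeries k (polyIdeal k Γ)).term n :=
  NSeries.map_lowerCentral_mem _ _ (oneSeries_term_one k Γ) n g hg

/-- The map of graded Lie rings induced by the Magnus map. -/
noncomputable def grMagnus : (NSeries.lowerCentral (ArtinGroup Γ)).Gr →ₗ⁅ℤ⁆
    (Adic.oneSeries k (polyIdeal k Γ)).Gr :=
  NSeries.grMap _ _ (magnus k Γ) (magnus_mem k Γ)

/-- The inverse of `polyGrEquiv`, as a homomorphism of Lie rings. -/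
noncomputable def grPolyLie : Adic.Gr k (polyIdeal k Γ) →ₗ⁅ℤ⁆ Poly k Γ :=
  NSeries.lieHomOfAddHom ((polyGrEquiv k Γ).symm : Adic.Gr k (polyIdeal k Γ) →+ Poly k Γ)
    fun x y => by
      have h : (polyGrEquiv k Γ).symm (x * y - y * x) =
          (polyGrEquiv k Γ).symm x * (polyGrEquiv k Γ).symm y -
            (polyGrEquiv k Γ).symm y * (polyGrEquiv k Γ).symm x := by
        rw [map_sub, map_mul, map_mul]
      exact h

/-- The map from the graded Lie ring of the lower central series to the polynomials that takes the
lowest homogeneous component of the Magnus map. -/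
noncomputable def magnusLie : (NSeries.lowerCentral (ArtinGroup Γ)).Gr →ₗ⁅ℤ⁆ Poly k Γ :=
  (grPolyLie k Γ).comp ((Adic.grOne k (polyIdeal k Γ)).comp (grMagnus k Γ))

theorem polyGrEquiv_magnusLie (x : (NSeries.lowerCentral (ArtinGroup Γ)).Gr) :
    polyGrEquiv k Γ (magnusLie k Γ x) = Adic.grOne k (polyIdeal k Γ) (grMagnus k Γ x) :=
  (polyGrEquiv k Γ).apply_symm_apply _

theorem magnusLie_cls (n : ℕ+) (g : (NSeries.lowerCentral (ArtinGroup Γ)).term n) :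
    magnusLie k Γ (NSeries.cls _ n g) ∈ polyHomog k Γ n ∧
      magnusSeries k Γ g - 1 - Adic.toCompletion k (polyIdeal k Γ)
        (magnusLie k Γ (NSeries.cls _ n g)) ∈ Adic.fil k (polyIdeal k Γ) ((n : ℕ) + 1) := by
  obtain ⟨r, hr, h, e⟩ := Adic.exists_oneSymbol_eq k
    (⟨magnus k Γ g, magnus_mem k Γ n g g.2⟩ : (Adic.oneSeries k (polyIdeal k Γ)).term n)
  have hh := homogPart_mem (k := k) (Γ := Γ) n r
  have hsub := sub_homogPart_mem hr
  have he : magnusLie k Γ (NSeries.cls _ n g) = homogPart k Γ n r := by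
    apply (polyGrEquiv k Γ).injective
    rw [polyGrEquiv_magnusLie, grMagnus, NSeries.grMap_cls, Adic.grOne_cls, e,
      polyGrEquiv_of_mem (mem_pow_of_mem_polyHomog hh) hh]
    exact Adic.symbol_congr k _ rfl _ _ hsub
  rw [he]
  refine ⟨hh, ?_⟩
  have h' := add_mem h ((Adic.toCompletion_mem_fil k _).2 hsub)
  rw [map_sub, sub_add_sub_cancel] at h'
  exact h'

end GradedMagnus

end Raag

/-! ### Isomorphisms of completions -/

namespace Adic

section

variable (k : Type*) {A B : Type*} [CommRing k] [Ring A] [Algebra k A] [Ring B] [Algebra k B]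

/-- The isomorphism of quotients induced by an isomorphism of algebras. -/
noncomputable def quotientEquiv (e : A ≃ₐ[k] B) (I : Ideal A) [I.IsTwoSided] (J : Ideal B)
    [J.IsTwoSided] (h : ∀ a, e a ∈ J ↔ a ∈ I) : (A ⧸ I) ≃ₐ[k] (B ⧸ J) :=
  AlgEquiv.ofBijective (Ideal.Quotient.liftₐ I ((Ideal.Quotient.mkₐ k J).comp e.toAlgHom)
      fun a ha => Ideal.Quotient.eq_zero_iff_mem.2 ((h a).2 ha)) (by
    constructor
    · rw [injective_iff_map_eq_zero]
      intro x hx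
      obtain ⟨a, rfl⟩ := Ideal.Quotient.mk_surjective x
      exact Ideal.Quotient.eq_zero_iff_mem.2 ((h a).1 (Ideal.Quotient.eq_zero_iff_mem.1 hx))
    · intro y
      obtain ⟨b, rfl⟩ := Ideal.Quotient.mk_surjective y
      obtain ⟨a, rfl⟩ := e.surjective b
      exact ⟨Ideal.Quotient.mk I a, rfl⟩)

variable (I : Ideal A) [I.IsTwoSided] (J : Ideal B) [J.IsTwoSided]

/-- The quotient `A / I ^ n` is also a quotient of the completion. -/
noncomputable def completionQuotientEquiv (n : ℕ) :
    (A ⧸ I ^ n) ≃ₐ[k] (Completion k I ⧸ fil k I n) :=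
  AlgEquiv.ofBijective
    (Ideal.Quotient.liftₐ (I ^ n) ((Ideal.Quotient.mkₐ k (fil k I n)).comp (toCompletion k I))
      fun _ ha => Ideal.Quotient.eq_zero_iff_mem.2 ((toCompletion_mem_fil k I).2 ha)) (by
    constructor
    · rw [injective_iff_map_eq_zero]
      intro x hx
      obtain ⟨a, rfl⟩ := Ideal.Quotient.mk_surjective x
      exact Ideal.Quotient.eq_zero_iff_mem.2
        ((toCompletion_mem_fil k I).1 (Ideal.Quotient.eq_zero_iff_mem.1 hx))
    · intro y
      obtain ⟨y, rfl⟩ := Ideal.Quotient.mk_surjective y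
      have hy : y ∈ fil k I 0 := by
        obtain ⟨a, ha⟩ := Ideal.Quotient.mk_surjective (proj k I 0 y)
        rw [mem_fil, ← ha, Ideal.Quotient.eq_zero_iff_mem, Submodule.pow_zero, Ideal.one_eq_top]
        trivial
      obtain ⟨a, -, h⟩ := exists_sub_toCompletion_mem k I (Nat.zero_le n) hy
      exact ⟨Ideal.Quotient.mk _ a, (Ideal.Quotient.eq.2 h).symm⟩)

variable {k I J}

/-- The homomorphism of completions given by compatible homomorphisms of the quotients. -/
def completionMap (f : ∀ n, (A ⧸ I ^ n) →ₐ[k] (B ⧸ J ^ n))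
    (hf : ∀ (m n : ℕ) (h : m ≤ n) (x : A ⧸ I ^ n),
      Ideal.Quotient.factorₐ k (Ideal.pow_le_pow_right h) (f n x) =
        f m (Ideal.Quotient.factorₐ k (Ideal.pow_le_pow_right h) x)) :
    Completion k I →ₐ[k] Completion k J :=
  (AlgHom.pi fun n => (f n).comp (proj k I n)).codRestrict (Completion k J) fun x m n h =>
    (hf m n h _).trans (congrArg (f m) (factor_proj k I h x))

/-- An algebra homomorphism to a completion that maps `J` into `fil 1` maps `J ^ n` into `fil n`. -/
theorem map_pow_mem_fil {f : B →ₐ[k] Completion k I} (hf : ∀ b ∈ J, f b ∈ fil k I 1) {n : ℕ} {b : B}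
    (hb : b ∈ J ^ n) : f b ∈ fil k I n := by
  induction n generalizing b with
  | zero =>
    obtain ⟨a, ha⟩ := Ideal.Quotient.mk_surjective (proj k I 0 (f b))
    rw [mem_fil, ← ha, Ideal.Quotient.eq_zero_iff_mem, Submodule.pow_zero, Ideal.one_eq_top]
    trivial
  | succ n ih =>
    rw [Ideal.IsTwoSided.pow_succ] at hb
    induction hb using Submodule.smul_induction_on' with
    | smul a ha b hb =>
      rw [smul_eq_mul, map_mul, add_comm]
      exact mul_mem_fil k I (hf a ha) (ih hb)
    | add x hx y hy ex ey =>
      rw [map_add]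
      exact add_mem ex ey

end

end Adic

/-! ### The completed group algebra -/

namespace Raag

section GroupAlgebra

variable (k : Type*) [CommRing k] {V : Type*} (Γ : SimpleGraph V)

/-- The homomorphism `v ↦ v - 1` from the polynomials to the group algebra. -/
noncomputable def polyToGroup : Poly k Γ →ₐ[k] GroupAlg k Γ :=
  polyLift k Γ (fun v => grp k Γ (gen Γ v) - 1) fun v w h => by
    have hc : grp k Γ (gen Γ v) * grp k Γ (gen Γ w) = grp k Γ (gen Γ w) * grp k Γ (gen Γ v) := by
      rw [grp, grp, ← map_mul, ← map_mul, (commute_gen h).eq]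
    simp only [sub_mul, mul_sub, one_mul, mul_one, hc]
    abel

theorem polyToGroup_X (v : V) : polyToGroup k Γ (X k Γ v) = grp k Γ (gen Γ v) - 1 :=
  polyLift_X k Γ _ _ v

theorem polyToGroup_X_mem (v : V) : polyToGroup k Γ (X k Γ v) ∈ groupIdeal k Γ := by
  rw [polyToGroup_X]
  exact grp_sub_one_mem k Γ _

theorem magnusLinear_grp (g : ArtinGroup Γ) :
    magnusLinear k Γ (grp k Γ g) = magnusSeries k Γ g := MonoidAlgebra.lift_of _ _

theorem magnusSeries_gen (v : V) :
    magnusSeries k Γ (gen Γ v) = 1 + Adic.toCompletion k (polyIdeal k Γ) (X k Γ v) := by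
  rw [← onePlusX_val, ← magnus_gen]
  rfl

theorem magnusLinear_polyToGroup (r : Poly k Γ) :
    magnusLinear k Γ (polyToGroup k Γ r) = Adic.toCompletion k (polyIdeal k Γ) r := by
  have h : (magnusLinear k Γ).comp (polyToGroup k Γ) = Adic.toCompletion k (polyIdeal k Γ) :=
    poly_hom_ext fun v => by
      rw [AlgHom.comp_apply, polyToGroup_X, map_sub, map_one, magnusLinear_grp, magnusSeries_gen,
        add_sub_cancel_left]
  exact DFunLike.congr_fun h r

variable {k Γ} in
theorem groupAlg_hom_ext {B : Type*} [Ring B] [Algebra k B] {f g : GroupAlg k Γ →ₐ[k] B}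
    (h : ∀ x, f (grp k Γ x) = g (grp k Γ x)) : f = g :=
  (MonoidAlgebra.lift k B (ArtinGroup Γ)).symm.injective (MonoidHom.ext h)

variable {k Γ} in
/-- Homomorphisms of algebras on the group algebra are determined by the images of the generators
of the group, because these determine the images of their inverses. -/
theorem groupAlg_hom_ext_gen {B : Type*} [Ring B] [Algebra k B] {f g : GroupAlg k Γ →ₐ[k] B}
    (h : ∀ v, f (grp k Γ (gen Γ v)) = g (grp k Γ (gen Γ v))) : f = g := by
  let F : ArtinGroup Γ →* B := (f : GroupAlg k Γ →* B).comp (MonoidAlgebra.of k (ArtinGroup Γ))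
  let F' : ArtinGroup Γ →* B := (g : GroupAlg k Γ →* B).comp (MonoidAlgebra.of k (ArtinGroup Γ))
  have hF : F.toHomUnits = F'.toHomUnits := by
    apply PresentedGroup.ext
    intro v
    exact Units.ext (h v)
  exact groupAlg_hom_ext fun x => congrArg (fun φ => ((φ x : Bˣ) : B)) hF

theorem magnusLinear_mem_fil_one (a : GroupAlg k Γ) (ha : a ∈ groupIdeal k Γ) :
    magnusLinear k Γ a ∈ Adic.fil k (polyIdeal k Γ) 1 := by
  have h : (Adic.proj k (polyIdeal k Γ) 1).comp (magnusLinear k Γ) =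
      (Algebra.ofId k (Poly k Γ ⧸ polyIdeal k Γ ^ 1)).comp (groupAug k Γ) :=
    groupAlg_hom_ext fun x => by
      have hx : magnusSeries k Γ x - 1 ∈ Adic.fil k (polyIdeal k Γ) 1 :=
        (Adic.mem_onePlus k _).1 (magnus k Γ x).2
      rw [Adic.mem_fil, map_sub, map_one, sub_eq_zero] at hx
      have h1 : groupAug k Γ (grp k Γ x) = 1 := (MonoidAlgebra.lift_of _ _).trans rfl
      rw [AlgHom.comp_apply, AlgHom.comp_apply, magnusLinear_grp, hx, h1, map_one]
  rw [Adic.mem_fil]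
  refine (DFunLike.congr_fun h a).trans ?_
  rw [AlgHom.comp_apply, show groupAug k Γ a = 0 from ha, map_zero]

theorem magnusLinear_mem_fil {n : ℕ} {a : GroupAlg k Γ} (ha : a ∈ groupIdeal k Γ ^ n) :
    magnusLinear k Γ a ∈ Adic.fil k (polyIdeal k Γ) n :=
  Adic.map_pow_mem_fil (magnusLinear_mem_fil_one k Γ) ha

/-- The Magnus map modulo the `n`-th powers of the augmentation ideals. -/
noncomputable def groupToPolyMod (n : ℕ) :
    (GroupAlg k Γ ⧸ groupIdeal k Γ ^ n) →ₐ[k] (Poly k Γ ⧸ polyIdeal k Γ ^ n) :=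
  Ideal.Quotient.liftₐ _ ((Adic.proj k (polyIdeal k Γ) n).comp (magnusLinear k Γ))
    fun _ ha => magnusLinear_mem_fil k Γ ha

/-- The homomorphism `v ↦ v - 1` modulo the `n`-th powers of the augmentation ideals. -/
noncomputable def polyToGroupMod (n : ℕ) :
    (Poly k Γ ⧸ polyIdeal k Γ ^ n) →ₐ[k] (GroupAlg k Γ ⧸ groupIdeal k Γ ^ n) :=
  Ideal.Quotient.liftₐ _ ((Ideal.Quotient.mkₐ k (groupIdeal k Γ ^ n)).comp (polyToGroup k Γ))
    fun _ hr => Ideal.Quotient.eq_zero_iff_mem.2 (map_mem_pow _ (polyToGroup_X_mem k Γ) hr)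

theorem polyToGroupMod_mk (n : ℕ) (r : Poly k Γ) :
    polyToGroupMod k Γ n (Ideal.Quotient.mk _ r) = Ideal.Quotient.mk _ (polyToGroup k Γ r) := rfl

theorem polyToGroupMod_groupToPolyMod_grp (n : ℕ) (v : V) :
    polyToGroupMod k Γ n (groupToPolyMod k Γ n (Ideal.Quotient.mk _ (grp k Γ (gen Γ v)))) =
      Ideal.Quotient.mk _ (grp k Γ (gen Γ v)) := by
  have h : groupToPolyMod k Γ n (Ideal.Quotient.mk _ (grp k Γ (gen Γ v))) =
      Ideal.Quotient.mk _ (1 + X k Γ v) := by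
    change Adic.proj k (polyIdeal k Γ) n (magnusLinear k Γ (grp k Γ (gen Γ v))) = _
    rw [magnusLinear_grp, magnusSeries_gen, map_add, map_one, map_add, map_one]
    rfl
  rw [h, polyToGroupMod_mk, map_add, map_one, polyToGroup_X, add_sub_cancel]

/-- The Magnus map modulo the `n`-th powers of the augmentation ideals is an isomorphism, with the
inverse induced by `v ↦ v - 1`. -/
noncomputable def magnusMod (n : ℕ) :
    (GroupAlg k Γ ⧸ groupIdeal k Γ ^ n) ≃ₐ[k] (Poly k Γ ⧸ polyIdeal k Γ ^ n) :=
  AlgEquiv.ofAlgHom (groupToPolyMod k Γ n) (polyToGroupMod k Γ n)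
    (Ideal.Quotient.algHom_ext _ (AlgHom.ext fun r =>
      congrArg (Adic.proj k (polyIdeal k Γ) n) (magnusLinear_polyToGroup k Γ r)))
    (Ideal.Quotient.algHom_ext _ (groupAlg_hom_ext_gen
      (polyToGroupMod_groupToPolyMod_grp k Γ n)))

theorem magnusMod_symm_mk (n : ℕ) (r : Poly k Γ) :
    (magnusMod k Γ n).symm (Ideal.Quotient.mk _ r) =
      Ideal.Quotient.mk _ (polyToGroup k Γ r) := rfl

theorem polyToGroup_mem_pow (n : ℕ) (r : Poly k Γ) (h : polyToGroup k Γ r ∈ groupIdeal k Γ ^ n) :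
    r ∈ polyIdeal k Γ ^ n := by
  rw [← Adic.toCompletion_mem_fil k, ← magnusLinear_polyToGroup]
  exact magnusLinear_mem_fil k Γ h

theorem exists_sub_polyToGroup_mem (n : ℕ) (b : GroupAlg k Γ) :
    ∃ r, b - polyToGroup k Γ r ∈ groupIdeal k Γ ^ n := by
  obtain ⟨r, hr⟩ := Ideal.Quotient.mk_surjective (magnusMod k Γ n (Ideal.Quotient.mk _ b))
  refine ⟨r, Ideal.Quotient.eq.1 ?_⟩
  rw [← magnusMod_symm_mk, hr, AlgEquiv.symm_apply_apply]

/-- The isomorphism of the completed group algebra with the power series. -/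
noncomputable def magnusCompletion : GroupCompletion k Γ ≃ₐ[k] PowerSeries k Γ :=
  AlgEquiv.ofAlgHom
    (Adic.completionMap (fun n => (magnusMod k Γ n).toAlgHom) fun m n h x => by
      obtain ⟨a, rfl⟩ := Ideal.Quotient.mk_surjective x
      exact Adic.factor_proj k _ h _)
    (Adic.completionMap (fun n => (magnusMod k Γ n).symm.toAlgHom) fun m n h x => by
      obtain ⟨r, rfl⟩ := Ideal.Quotient.mk_surjective x
      rfl)
    (AlgHom.ext fun x => Adic.proj_ext k _ fun n => (magnusMod k Γ n).apply_symm_apply _)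
    (AlgHom.ext fun x => Adic.proj_ext k _ fun n => (magnusMod k Γ n).symm_apply_apply _)

theorem proj_magnusCompletion (n : ℕ) (x : GroupCompletion k Γ) :
    Adic.proj k (polyIdeal k Γ) n (magnusCompletion k Γ x) =
      magnusMod k Γ n (Adic.proj k (groupIdeal k Γ) n x) := rfl

theorem magnusCompletion_toCompletion (a : GroupAlg k Γ) :
    magnusCompletion k Γ (Adic.toCompletion k (groupIdeal k Γ) a) = magnusLinear k Γ a :=
  Adic.proj_ext k _ fun _ => rfl

theorem magnusCompletion_mem_fil (n : ℕ) (x : GroupCompletion k Γ) :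
    magnusCompletion k Γ x ∈ Adic.fil k (polyIdeal k Γ) n ↔ x ∈ Adic.fil k (groupIdeal k Γ) n := by
  rw [Adic.mem_fil, Adic.mem_fil, proj_magnusCompletion, map_eq_zero_iff _ (AlgEquiv.injective _)]

/-- The image of the group algebra is dense, so that a continuous extension of its Magnus map is
unique. -/
theorem eq_magnusCompletion (f : GroupCompletion k Γ →ₐ[k] PowerSeries k Γ)
    (h : ∀ a : GroupAlg k Γ,
      f (Adic.toCompletion k (groupIdeal k Γ) a) = magnusLinear k Γ a)
    (hf : ∀ n : ℕ, ∃ N : ℕ, ∀ x ∈ Adic.fil k (groupIdeal k Γ) N,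
      f x ∈ Adic.fil k (polyIdeal k Γ) n) (x : GroupCompletion k Γ) :
    f x = magnusCompletion k Γ x := by
  refine Adic.proj_ext k _ fun n => ?_
  obtain ⟨N, hN⟩ := hf n
  obtain ⟨a, ha⟩ := Ideal.Quotient.mk_surjective (Adic.proj k (groupIdeal k Γ) (max n N) x)
  have hxa : x - Adic.toCompletion k _ a ∈ Adic.fil k (groupIdeal k Γ) (max n N) := by
    rw [Adic.mem_fil, map_sub, Adic.proj_toCompletion, ha, sub_self]
  have h1 := hN _ (Adic.fil_antitone k _ (le_max_right n N) hxa)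
  have h2 := (magnusCompletion_mem_fil k Γ n _).2 (Adic.fil_antitone k _ (le_max_left n N) hxa)
  rw [Adic.mem_fil, map_sub, map_sub, sub_eq_zero] at h1 h2
  rw [h1, h2, h, magnusCompletion_toCompletion]

/-- The isomorphism of the polynomials with the associated graded algebra of the group algebra. -/
noncomputable def groupGrEquiv : Poly k Γ ≃ₐ[k] Adic.Gr k (groupIdeal k Γ) :=
  symbolEquiv (polyToGroup k Γ) (polyToGroup_X_mem k Γ) (polyToGroup_mem_pow k Γ)
    (exists_sub_polyToGroup_mem k Γ)

theorem groupGrEquiv_X (v : V) (hv : grp k Γ (gen Γ v) - 1 ∈ groupIdeal k Γ ^ 1) :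
    groupGrEquiv k Γ (X k Γ v) =
      Adic.symbol k (groupIdeal k Γ) 1 (grp k Γ (gen Γ v) - 1) hv := by
  have h := polyToGroup_X k Γ v
  refine (symbolHom_X (polyToGroup k Γ) _ v (by rw [h]; exact hv)).trans ?_
  exact Adic.symbol_congr k _ rfl _ _ (by rw [h, sub_self]; exact zero_mem _)

theorem groupGrEquiv_mem (n : ℕ) (r : Poly k Γ) :
    groupGrEquiv k Γ r ∈ Adic.grGE k (groupIdeal k Γ) n ↔ r ∈ polyIdeal k Γ ^ n :=
  symbolHom_mem_grGE (polyToGroup k Γ) (polyToGroup_X_mem k Γ) (polyToGroup_mem_pow k Γ)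

end GroupAlgebra

end Raag

/-- The Magnus map of a right-angled Artin group. -/
theorem mainTheorem4 {V : Type*} (Γ : SimpleGraph V) (k : Type*) [CommRing k] [Nontrivial k] :
    -- in prime characteristic: the leading monomial of `μ(g)`
    (∀ p : ℕ, p.Prime → CharP k p → ∀ g : Raag.ArtinGroup Γ,
      (∃! m : Raag.Mon Γ, Raag.IsLeading k Γ p g m) ∧
      ∀ m : Raag.Mon Γ, Raag.IsLeading k Γ p g m →
        ∀ x : Raag.Word V, Raag.IsReduced Γ x → Raag.Word.toGroup Γ x = g →
          (∀ l : List (V × ℕ), Raag.IsReduced Γ (Raag.pWord p l) → Raag.pMon Γ p l = m →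
            x.length = l.length ∧
            (x.map fun a => Raag.monVar Γ a.1).prod = (l.map fun a => Raag.monVar Γ a.1).prod) ∧
          ∃ l : List (V × ℕ), Raag.IsReduced Γ (Raag.pWord p l) ∧ Raag.pMon Γ p l = m ∧
            List.Forall₂ (fun a b => a.1 = b.1 ∧ (p : ℤ) ^ b.2 ∣ a.2) x l ∧
            Raag.coeff k Γ m (Raag.magnusSeries k Γ g) =
              (List.zipWith (fun a b => ((a.2 / (p : ℤ) ^ b.2 : ℤ) : k)) x l).prod) ∧
    -- the Magnus map is injective
    Function.Injective (Raag.magnusSeries k Γ) ∧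
    -- it maps `γ n` into `1 + ϖ ^ n`, and induces a map of graded Lie algebras
    (∃ hγ : ∀ (n : ℕ+) (g : Raag.ArtinGroup Γ),
        g ∈ (NSeries.lowerCentral (Raag.ArtinGroup Γ)).term n →
          Raag.magnus k Γ g ∈ (Adic.oneSeries k (Raag.polyIdeal k Γ)).term n,
      ∃ (grμ : (NSeries.lowerCentral (Raag.ArtinGroup Γ)).Gr →ₗ⁅ℤ⁆
          (Adic.oneSeries k (Raag.polyIdeal k Γ)).Gr)
        (θ : (Adic.oneSeries k (Raag.polyIdeal k Γ)).Gr →ₗ⁅ℤ⁆ Adic.Gr k (Raag.polyIdeal k Γ))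
        (j : Raag.Poly k Γ ≃ₐ[k] Adic.Gr k (Raag.polyIdeal k Γ))
        (μL : (NSeries.lowerCentral (Raag.ArtinGroup Γ)).Gr →ₗ⁅ℤ⁆ Raag.Poly k Γ),
        -- the map of graded Lie algebras induced by `μ`
        (∀ (n : ℕ+) (g : (NSeries.lowerCentral (Raag.ArtinGroup Γ)).term n),
          grμ (NSeries.cls _ n g) = NSeries.cls _ n ⟨Raag.magnus k Γ g, hγ n g g.2⟩) ∧
        -- the isomorphism `[1 + w] ↦ [w]` onto the sum of the components of positive degree
        (∀ (n : ℕ+) (u : (Adic.oneSeries k (Raag.polyIdeal k Γ)).term n) (r : Raag.Poly k Γ)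
          (hr : r ∈ Raag.polyIdeal k Γ ^ (n : ℕ)),
          ((u.1.1 : (Raag.PowerSeries k Γ)ˣ) : Raag.PowerSeries k Γ) - 1 -
              Adic.toCompletion k (Raag.polyIdeal k Γ) r ∈
            Adic.fil k (Raag.polyIdeal k Γ) ((n : ℕ) + 1) →
          θ (NSeries.cls _ n u) = Adic.symbol k (Raag.polyIdeal k Γ) n r hr) ∧
        Function.Injective θ ∧
        (Set.range θ = {x : Adic.Gr k (Raag.polyIdeal k Γ) | x 0 = 0}) ∧
        -- the identification of `Poly k Γ` with its associated graded algebra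
        (∀ (n : ℕ) (r : Raag.Poly k Γ) (hr : r ∈ Raag.polyIdeal k Γ ^ n),
          r ∈ Raag.polyHomog k Γ n → j r = Adic.symbol k (Raag.polyIdeal k Γ) n r hr) ∧
        -- the resulting map of graded Lie algebras to `Poly k Γ`
        (∀ x, j (μL x) = θ (grμ x)) ∧
        (∀ (n : ℕ+) (g : (NSeries.lowerCentral (Raag.ArtinGroup Γ)).term n),
          μL (NSeries.cls _ n g) ∈ Raag.polyHomog k Γ n ∧
          Raag.magnusSeries k Γ g - 1 -
              Adic.toCompletion k (Raag.polyIdeal k Γ) (μL (NSeries.cls _ n g)) ∈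
            Adic.fil k (Raag.polyIdeal k Γ) ((n : ℕ) + 1))) ∧
    -- the linear extension of `μ` extends continuously to an isomorphism of filtered algebras
    ∃ μbar : Raag.GroupCompletion k Γ ≃ₐ[k] Raag.PowerSeries k Γ,
      (∀ a : Raag.GroupAlg k Γ, μbar (Adic.toCompletion k (Raag.groupIdeal k Γ) a) =
        Raag.magnusLinear k Γ a) ∧
      (∀ (n : ℕ) (x : Raag.GroupCompletion k Γ),
        μbar x ∈ Adic.fil k (Raag.polyIdeal k Γ) n ↔ x ∈ Adic.fil k (Raag.groupIdeal k Γ) n) ∧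
      -- it is the only continuous extension
      (∀ f : Raag.GroupCompletion k Γ →ₐ[k] Raag.PowerSeries k Γ,
        (∀ a : Raag.GroupAlg k Γ, f (Adic.toCompletion k (Raag.groupIdeal k Γ) a) =
          Raag.magnusLinear k Γ a) →
        (∀ n : ℕ, ∃ N : ℕ, ∀ x ∈ Adic.fil k (Raag.groupIdeal k Γ) N,
          f x ∈ Adic.fil k (Raag.polyIdeal k Γ) n) →
        ∀ x, f x = μbar x) ∧
      -- the induced isomorphisms of the quotients
      ∀ n : ℕ,
        ∃ (e₁ : (Raag.GroupAlg k Γ ⧸ Raag.groupIdeal k Γ ^ n) ≃ₐ[k]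
            (Raag.GroupCompletion k Γ ⧸ Adic.fil k (Raag.groupIdeal k Γ) n))
          (e₂ : (Raag.GroupCompletion k Γ ⧸ Adic.fil k (Raag.groupIdeal k Γ) n) ≃ₐ[k]
            (Raag.PowerSeries k Γ ⧸ Adic.fil k (Raag.polyIdeal k Γ) n))
          (e₃ : (Raag.Poly k Γ ⧸ Raag.polyIdeal k Γ ^ n) ≃ₐ[k]
            (Raag.PowerSeries k Γ ⧸ Adic.fil k (Raag.polyIdeal k Γ) n))
          (e₄ : (Raag.Poly k Γ ⧸ Raag.polyIdeal k Γ ^ n) ≃ₐ[k]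
            (Adic.Gr k (Raag.groupIdeal k Γ) ⧸ Adic.grGE k (Raag.groupIdeal k Γ) n))
          (e₅ : Raag.polyLT k Γ n ≃ₗ[k] (Raag.Poly k Γ ⧸ Raag.polyIdeal k Γ ^ n))
          (e₆ : Adic.grLT k (Raag.groupIdeal k Γ) n ≃ₗ[k]
            (Adic.Gr k (Raag.groupIdeal k Γ) ⧸ Adic.grGE k (Raag.groupIdeal k Γ) n)),
          (∀ a, e₁ (Ideal.Quotient.mk _ a) =
            Ideal.Quotient.mk _ (Adic.toCompletion k (Raag.groupIdeal k Γ) a)) ∧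
          (∀ x, e₂ (Ideal.Quotient.mk _ x) = Ideal.Quotient.mk _ (μbar x)) ∧
          (∀ r, e₃ (Ideal.Quotient.mk _ r) =
            Ideal.Quotient.mk _ (Adic.toCompletion k (Raag.polyIdeal k Γ) r)) ∧
          (∀ (v : V) (hv : Raag.grp k Γ (Raag.gen Γ v) - 1 ∈ Raag.groupIdeal k Γ ^ 1),
            e₄ (Ideal.Quotient.mk _ (Raag.X k Γ v)) = Ideal.Quotient.mk _
              (Adic.symbol k (Raag.groupIdeal k Γ) 1 (Raag.grp k Γ (Raag.gen Γ v) - 1) hv)) ∧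
          (∀ r, e₅ r = Ideal.Quotient.mk _ (r : Raag.Poly k Γ)) ∧
          (∀ y, e₆ y = Ideal.Quotient.mk _ (y : Adic.Gr k (Raag.groupIdeal k Γ))) := by
  refine ⟨fun p hp _ g => Raag.leading_monomial hp g, Raag.magnusSeries_injective,
    ⟨Raag.magnus_mem k Γ, Raag.grMagnus k Γ, Adic.grOne k (Raag.polyIdeal k Γ),
      Raag.polyGrEquiv k Γ, Raag.magnusLie k Γ, ?_, ?_, ?_, ?_, ?_, ?_, ?_⟩,
    Raag.magnusCompletion k Γ, Raag.magnusCompletion_toCompletion k Γ,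
    Raag.magnusCompletion_mem_fil k Γ, Raag.eq_magnusCompletion k Γ, fun n =>
    ⟨Adic.completionQuotientEquiv k _ n,
      Adic.quotientEquiv k (Raag.magnusCompletion k Γ) _ _ (Raag.magnusCompletion_mem_fil k Γ n),
      Adic.completionQuotientEquiv k _ n,
      Adic.quotientEquiv k (Raag.groupGrEquiv k Γ) _ _ (Raag.groupGrEquiv_mem k Γ n),
      Raag.polyLTEquiv k Γ n, Adic.grLTEquiv k _ n, fun _ => rfl, fun _ => rfl, fun _ => rfl,
      fun v hv => congrArg (Ideal.Quotient.mk _) (Raag.groupGrEquiv_X k Γ v hv),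
      fun _ => rfl, fun _ => rfl⟩⟩
  · exact NSeries.grMap_cls _ _ _ (Raag.magnus_mem k Γ)
  · intro n u r hr h
    rw [Adic.grOne_cls]
    exact Adic.oneSymbol_eq k u r hr h
  · exact Adic.grOne_injective k _
  · exact Adic.range_grOne k _
  · exact fun n r hr h => Raag.polyGrEquiv_of_mem hr h
  · exact Raag.polyGrEquiv_magnusLie k Γ
  · exact Raag.magnusLie_cls k Γ
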